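/- Let $(M^3,g)$ be a connected smooth Riemannian $3$-manifold with non-empty, connected boundary $\Sigma=\partial M$, and suppose that $(M,g)$ is asymptotically flat: there are a compact set $K\subset M$, a number $R>0$ and a diffeomorphism $M\setminus K\cong\{y\in\mathbb R^3: |y|>R\}$ in whose coordinates, for some $\tau>0$, $\partial^\alpha(g_{ij}-\delta_{ij})=O(|y|^{-\tau-|\alpha|})$ for all $|\alpha|\le 2$. Let $u\in C^2(M)$ (up to the boundary) solve $$\Delta_g u=0 \text{ on } M,\qquad u=1 \text{ on } \Sigma,\qquad u\to 0 \text{ at infinity},$$ let $w=-\log u$, and let $\Sigma_t=\{x\in M: w(x)=t\}$. Let $da$ denote the two-dimensional Hausdorff measure of $(M,g)$, normalized to agree with surface area. Then, for every $t\ge 0$, $|\nabla w|$ is $da$-integrable on $\Sigma_t$ and on $\Sigma$, and $$\int_{\Sigma_t}|\nabla w|\,da=C_0\,e^{t},\qquad\text{where } C_0=\int_{\Sigma}|\nabla w|\,da .$$ -/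

import Mathlib

open Set Filter MeasureTheory Bundle Manifold
open scoped Topology ContDiff Manifold

noncomputable section

/-- The model vector space `ℝ³` with its Euclidean norm. -/
abbrev E3 : Type := EuclideanSpace ℝ (Fin 3)

/-- The `i`-th standard basis vector of `ℝ³`. -/
def stdVec (i : Fin 3) : E3 := EuclideanSpace.single i (1 : ℝ)

section Riemannian

variable {M : Type*} [MetricSpace M] [ChartedSpace (EuclideanHalfSpace 3) M]
  [IsManifold (𝓡∂ 3) ∞ M] [RiemannianBundle (fun x : M ↦ TangentSpace (𝓡∂ 3) x)]

/-- The components `g_{ij}(y) = g(∂_i ψ(y), ∂_j ψ(y))` of the Riemannian metric in the coordinates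
given by a local parametrization `ψ : ℝ³ ⊇ s → M`. -/
def metricCoeff (ψ : E3 → M) (s : Set E3) (y : E3) : Matrix (Fin 3) (Fin 3) ℝ :=
  Matrix.of fun i j ↦
    inner ℝ (mfderivWithin 𝓘(ℝ, E3) (𝓡∂ 3) ψ s y (stdVec i))
      (mfderivWithin 𝓘(ℝ, E3) (𝓡∂ 3) ψ s y (stdVec j))

/-- The Laplace-Beltrami operator in the coordinates given by a parametrization `ψ` of a piece of
`M` by a piece of `s`:
`Δ u = (det g)^{-1/2} ∑_i ∂_i ((det g)^{1/2} ∑_j g^{ij} ∂_j u)`. -/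
def coordLaplacian (ψ : E3 → M) (s : Set E3) (u : M → ℝ) (y : E3) : ℝ :=
  (√(metricCoeff ψ s y).det)⁻¹ *
    ∑ i, fderivWithin ℝ
      (fun z ↦ √(metricCoeff ψ s z).det *
        ∑ j, (metricCoeff ψ s z)⁻¹ i j * fderivWithin ℝ (u ∘ ψ) s z (stdVec j))
      s y (stdVec i)

/-- A function on the Riemannian manifold with boundary `M` is (classically) harmonic if it is `C²`
up to the boundary and its Laplacian vanishes at every point, computed in every smooth chart.
At boundary points the derivatives are the one-sided ones, taken within the half-space. -/
def IsHarmonic (u : M → ℝ) : Prop :=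
  ContMDiff (𝓡∂ 3) 𝓘(ℝ, ℝ) 2 u ∧
    ∀ e ∈ IsManifold.maximalAtlas (𝓡∂ 3) ∞ M, ∀ x ∈ e.source,
      coordLaplacian (e.extend (𝓡∂ 3)).symm (range (𝓡∂ 3)) u (e.extend (𝓡∂ 3) x) = 0

/-- The Riemannian gradient `∇f(x) ∈ T_x M`, i.e. the vector with `g(∇f(x), v) = df_x(v)`. -/
def riemGradient (f : M → ℝ) (x : M) : TangentSpace (𝓡∂ 3) x :=
  haveI : FiniteDimensional ℝ (TangentSpace (𝓡∂ 3) x) :=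
    inferInstanceAs (FiniteDimensional ℝ E3)
  haveI : CompleteSpace (TangentSpace (𝓡∂ 3) x) := FiniteDimensional.complete ℝ _
  (InnerProductSpace.toDual ℝ (TangentSpace (𝓡∂ 3) x)).symm
    (mfderiv (𝓡∂ 3) 𝓘(ℝ, ℝ) f x)

/-- The defining property of the gradient. -/
theorem inner_riemGradient (f : M → ℝ) (x : M) (v : TangentSpace (𝓡∂ 3) x) :
    inner ℝ (riemGradient f x) v = mfderiv (𝓡∂ 3) 𝓘(ℝ, ℝ) f x v := by
  haveI : FiniteDimensional ℝ (TangentSpace (𝓡∂ 3) x) :=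
    inferInstanceAs (FiniteDimensional ℝ E3)
  haveI : CompleteSpace (TangentSpace (𝓡∂ 3) x) := FiniteDimensional.complete ℝ _
  unfold riemGradient
  exact InnerProductSpace.toDual_symm_apply

variable (M) in
/-- `M` is asymptotically flat (with one end, of some order `τ > 0`): outside a compact set, `M` is
diffeomorphic to the complement of a closed ball in `ℝ³`, and in these coordinates
`∂^α (g_{ij} - δ_{ij}) = O(|y|^{-τ-|α|})` for `|α| ≤ 2`. -/
def IsAsymptoticallyFlat : Prop :=
  ∃ (K : Set M) (R τ C : ℝ) (Φ : OpenPartialHomeomorph M E3),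
    IsCompact K ∧ 0 < R ∧ 0 < τ ∧
    Φ.source = Kᶜ ∧ Φ.target = {y | R < ‖y‖} ∧
    ContMDiffOn (𝓡∂ 3) 𝓘(ℝ, E3) ∞ Φ Φ.source ∧
    ContMDiffOn 𝓘(ℝ, E3) (𝓡∂ 3) ∞ Φ.symm Φ.target ∧
    ∀ k ≤ 2, ∀ i j : Fin 3, ∀ y ∈ Φ.target,
      ‖iteratedFDeriv ℝ k
        (fun z ↦ metricCoeff Φ.symm Φ.target z i j - (1 : Matrix (Fin 3) (Fin 3) ℝ) i j) y‖
        ≤ C * ‖y‖ ^ (-τ - (k : ℝ))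

end Riemannian

end

/-!
Write `⟨∇f, ∇g⟩` for the pairing of gradients and `N = |∇u|²`. On a compact piece of `{∇u ≠ 0}`,
straightening `u` in charts gives the coarea formula
`∫ φ(u) χ N dvol = ∫ φ(s) (∫_{u = s} χ |∇u| da) ds`, with an inner integral continuous in `s`.
Testing harmonicity of `u` against `Φ(u) χ`, where `Φ' = φ`, shows that the `χ`-weighted flux
through `{u = s}` varies with `s` by at most `∫ |⟨∇χ, ∇u⟩|`.

No regularity of the level (Sard's theorem) is needed. Take `χₙ` to be a step function of
`(n + 1) N`, cutting off the critical set. On compact sets `|⟨∇N, ∇u⟩| ≤ C N`, so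
`⟨∇χₙ, ∇u⟩` stays bounded and tends to `0` pointwise, hence in `L¹`. Monotone convergence in
`n` then makes the flux `∫_{u = s} |∇u| da` finite and independent of `s ∈ (0, 1]`. Finally
`|∇w| = |∇u| / u`, and `∇u = 0` on the part of `{u = 1}` outside the boundary by the maximum
principle.
-/

section LocalComparison

variable {V : Type*} [TopologicalSpace V] [SecondCountableTopology V] [MeasurableSpace V]
  [BorelSpace V] {μ ν : Measure V} {S : Set V}

theorem measure_le_of_locally_le
    (h : ∀ z ∈ S, ∀ᶠ B in (𝓝[S] z).smallSets, MeasurableSet B → μ B ≤ ν B)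
    {B : Set V} (hB : MeasurableSet B) (hBS : B ⊆ S) : μ B ≤ ν B := by
  have hopen : ∀ z ∈ S, ∃ U, IsOpen U ∧ z ∈ U ∧ ∀ B ⊆ U ∩ S, MeasurableSet B → μ B ≤ ν B := by
    intro z hz
    obtain ⟨N, hN, hNle⟩ := eventually_smallSets.1 (h z hz)
    obtain ⟨U, hUo, hzU, hUN⟩ := mem_nhdsWithin.1 hN
    exact ⟨U, hUo, hzU, fun B hBU ↦ hNle B (hBU.trans hUN)⟩
  choose! U hUo hzU hU using hopen
  obtain ⟨t, htS, htc, hcov⟩ := TopologicalSpace.countable_cover_nhdsWithin (f := U) (s := S)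
    fun z hz ↦ mem_nhdsWithin_of_mem_nhds ((hUo z hz).mem_nhds (hzU z hz))
  rcases t.eq_empty_or_nonempty with rfl | hne
  · simp [subset_empty_iff.1 (show B ⊆ ∅ by simpa using hBS.trans hcov)]
  obtain ⟨e, rfl⟩ := htc.exists_eq_range hne
  let D : ℕ → Set V := fun n ↦ B ∩ disjointed (U ∘ e) n
  have hDm : ∀ n, MeasurableSet (D n) := fun n ↦
    hB.inter (MeasurableSet.disjointed (fun k ↦ (hUo _ (htS ⟨k, rfl⟩)).measurableSet) n)
  have hDd : Pairwise (Function.onFun Disjoint D) := fun _ _ hij ↦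
    (disjoint_disjointed _ hij).mono inter_subset_right inter_subset_right
  have hBD : B = ⋃ n, D n := by
    rw [← inter_iUnion, iUnion_disjointed]
    exact (inter_eq_left.2 (hBS.trans (hcov.trans (by simp)))).symm
  rw [hBD, measure_iUnion hDd hDm, measure_iUnion hDd hDm]
  exact ENNReal.tsum_le_tsum fun n ↦ hU (e n) (htS ⟨n, rfl⟩) _
    (fun x hx ↦ ⟨disjointed_subset (U ∘ e) n hx.2, hBS hx.1⟩) (hDm n)

theorem le_of_forall_one_lt_le_pow_mul {a b : ENNReal} (n : ℕ)
    (h : ∀ K : NNReal, 1 < K → a ≤ (K : ENNReal) ^ n * b) : a ≤ b := by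
  have hlim : Tendsto (fun K : NNReal ↦ (K : ENNReal) ^ n * b) (𝓝[>] 1) (𝓝 (1 ^ n * b)) := by
    refine ENNReal.Tendsto.mul_const ?_ (Or.inl (by simp))
    exact ((ENNReal.continuous_pow n).tendsto _).comp
      ((ENNReal.continuous_coe.tendsto 1).mono_left nhdsWithin_le_nhds)
  rw [one_pow, one_mul] at hlim
  exact ge_of_tendsto hlim (eventually_nhdsWithin_of_forall h)

theorem measure_le_of_locally_le_pow_mul (n : ℕ)
    (h : ∀ K : NNReal, 1 < K → ∀ z ∈ S, ∀ᶠ B in (𝓝[S] z).smallSets,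
      MeasurableSet B → μ B ≤ (K : ENNReal) ^ n * ν B)
    {B : Set V} (hB : MeasurableSet B) (hBS : B ⊆ S) : μ B ≤ ν B :=
  le_of_forall_one_lt_le_pow_mul n fun K hK ↦
    measure_le_of_locally_le (ν := (K : ENNReal) ^ n • ν) (h K hK) hB hBS

end LocalComparison

section HausdorffComparison

variable {V X Y : Type*} [MetricSpace X] [MeasurableSpace X] [BorelSpace X] [MetricSpace Y]
  [MeasurableSpace Y] [BorelSpace Y] {f : V → X} {g : V → Y} {B : Set V} {K : NNReal}

theorem hausdorffMeasure_image_le_of_dist_le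
    (h : ∀ a ∈ B, ∀ b ∈ B, dist (f a) (f b) ≤ K * dist (g a) (g b)) {d : ℝ} (hd : 0 ≤ d) :
    Measure.hausdorffMeasure d (f '' B) ≤
      (K : ENNReal) ^ d * Measure.hausdorffMeasure d (g '' B) := by
  rcases B.eq_empty_or_nonempty with rfl | ⟨b₀, -⟩
  · simp
  have : Nonempty V := ⟨b₀⟩
  have hmem : ∀ a ∈ B, Function.invFunOn g B (g a) ∈ B := fun a ha ↦
    Function.invFunOn_mem ⟨a, ha, rfl⟩
  have heq : ∀ a ∈ B, g (Function.invFunOn g B (g a)) = g a := fun a ha ↦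
    Function.invFunOn_eq ⟨a, ha, rfl⟩
  have himg : f '' B = (f ∘ Function.invFunOn g B) '' (g '' B) := by
    rw [← image_comp]
    refine image_congr fun a ha ↦ dist_le_zero.1 ?_
    simpa only [Function.comp_apply, heq a ha, dist_self, mul_zero] using h a ha _ (hmem a ha)
  rw [himg]
  refine LipschitzOnWith.hausdorffMeasure_image_le (LipschitzOnWith.of_dist_le_mul ?_) hd
  rintro _ ⟨a, ha, rfl⟩ _ ⟨b, hb, rfl⟩
  simpa only [Function.comp_apply, heq a ha, heq b hb] using h _ (hmem a ha) _ (hmem b hb)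

theorem euclideanHausdorffMeasure_image_le_of_dist_le
    (h : ∀ a ∈ B, ∀ b ∈ B, dist (f a) (f b) ≤ K * dist (g a) (g b)) (m : ℕ) :
    μHE[m] (f '' B) ≤ (K : ENNReal) ^ m * μHE[m] (g '' B) := by
  have hle := hausdorffMeasure_image_le_of_dist_le h (Nat.cast_nonneg m)
  rw [ENNReal.rpow_natCast] at hle
  simp only [Measure.euclideanHausdorffMeasure_def, Measure.smul_apply, ENNReal.smul_def,
    smul_eq_mul]
  exact (mul_le_mul_right hle _).trans_eq (mul_left_comm _ _ _)

end HausdorffComparison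

section MetricDerivative

variable {V X F : Type*} [NormedAddCommGroup V] [NormedSpace ℝ V] [MetricSpace X]
  [NormedAddCommGroup F] [NormedSpace ℝ F]

/-- Strict metric differentiability: near `z`, within `S`, the distance of the images of `a` and `b`
under `Ψ` is `‖A (a - b)‖` up to a relatively small error. It replaces the derivative of `Ψ` in the
area formula when the target is only a metric space. -/
def HasMetricDerivWithinAt (Ψ : V → X) (A : V →L[ℝ] F) (S : Set V) (z : V) : Prop :=
  (fun p : V × V ↦ dist (Ψ p.1) (Ψ p.2) - ‖A (p.1 - p.2)‖) =o[𝓝[S] z ×ˢ 𝓝[S] z]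
    fun p ↦ ‖A (p.1 - p.2)‖

theorem hasMetricDerivWithinAt_iff {Ψ : V → X} {A : V →L[ℝ] F} {S : Set V} {z : V} :
    HasMetricDerivWithinAt Ψ A S z ↔ ∀ K : ℝ, 1 < K → ∀ᶠ B in (𝓝[S] z).smallSets,
      ∀ a ∈ B, ∀ b ∈ B,
        dist (Ψ a) (Ψ b) ≤ K * ‖A (a - b)‖ ∧ ‖A (a - b)‖ ≤ K * dist (Ψ a) (Ψ b) := by
  constructor
  · intro h K hK
    have hK0 : 0 < K := one_pos.trans hK
    obtain ⟨U, hU, hUU⟩ := eventually_prod_self_iff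
      (r := fun a b ↦ ‖dist (Ψ a) (Ψ b) - ‖A (a - b)‖‖ ≤ (1 - K⁻¹) * ‖‖A (a - b)‖‖) |>.1
      (h.def (sub_pos.2 (inv_lt_one_of_one_lt₀ hK)))
    refine eventually_smallSets.2 ⟨U, hU, fun B hB a ha b hb ↦ ?_⟩
    have hab := hUU a (hB ha) b (hB hb)
    rw [norm_norm, Real.norm_eq_abs, abs_le] at hab
    have hK2 : 2 ≤ K + K⁻¹ := by
      have : K + K⁻¹ - 2 = (K - 1) ^ 2 / K := by field_simp; ring
      linarith [show 0 ≤ (K - 1) ^ 2 / K by positivity]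
    constructor
    · nlinarith [norm_nonneg (A (a - b))]
    · rw [← inv_mul_le_iff₀ hK0]
      linarith
  · refine fun h ↦ Asymptotics.isLittleO_iff.2 fun c hc ↦ ?_
    obtain ⟨U, hU, hUU⟩ := eventually_smallSets.1 (h (1 + c) (by linarith))
    filter_upwards [prod_mem_prod hU hU] with p hp
    obtain ⟨hup, hlow⟩ := hUU U Subset.rfl p.1 hp.1 p.2 hp.2
    rw [norm_norm, Real.norm_eq_abs, abs_le]
    constructor
    · by_cases hle : dist (Ψ p.1) (Ψ p.2) ≤ ‖A (p.1 - p.2)‖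
      · nlinarith
      · nlinarith [norm_nonneg (A (p.1 - p.2))]
    · linarith

namespace HasMetricDerivWithinAt

variable {Ψ : V → X} {A : V →L[ℝ] F} {S : Set V} {z : V}

theorem mono {T : Set V} (h : HasMetricDerivWithinAt Ψ A S z) (hT : T ⊆ S) :
    HasMetricDerivWithinAt Ψ A T z :=
  Asymptotics.IsLittleO.mono h (prod_mono (nhdsWithin_mono z hT) (nhdsWithin_mono z hT))

theorem congr_norm {F' : Type*} [NormedAddCommGroup F'] [NormedSpace ℝ F'] {A' : V →L[ℝ] F'}
    (h : HasMetricDerivWithinAt Ψ A S z) (hA : ∀ v, ‖A' v‖ = ‖A v‖) :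
    HasMetricDerivWithinAt Ψ A' S z := by
  simpa only [HasMetricDerivWithinAt, hA] using h

theorem continuousWithinAt (h : HasMetricDerivWithinAt Ψ A S z) (hz : z ∈ S) :
    ContinuousWithinAt Ψ S z := by
  obtain ⟨U, hU, hUU⟩ := eventually_smallSets.1 (hasMetricDerivWithinAt_iff.1 h 2 one_lt_two)
  have hlim : Tendsto (fun a ↦ 2 * ‖A (a - z)‖) (𝓝[S] z) (𝓝 0) := by
    have hc : Continuous fun a ↦ 2 * ‖A (a - z)‖ := by fun_prop
    simpa using (hc.tendsto z).mono_left nhdsWithin_le_nhds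
  rw [ContinuousWithinAt, tendsto_iff_dist_tendsto_zero]
  refine squeeze_zero' (Eventually.of_forall fun _ ↦ dist_nonneg) ?_ hlim
  filter_upwards [hU] with a ha
  exact (hUU U Subset.rfl a ha z (mem_of_mem_nhdsWithin hz hU)).1

theorem comp_hasStrictFDerivAt {W : Type*} [NormedAddCommGroup W] [NormedSpace ℝ W]
    [FiniteDimensional ℝ W] {f : W → V} {f' : W →L[ℝ] V} {T : Set W} {x : W}
    (h : HasMetricDerivWithinAt Ψ A S (f x)) (hf : HasStrictFDerivAt f f' x)
    (hinj : Function.Injective (A ∘L f')) (hmaps : MapsTo f T S) :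
    HasMetricDerivWithinAt (Ψ ∘ f) (A ∘L f') T x := by
  have hf_tendsto : Tendsto f (𝓝[T] x) (𝓝[S] f x) :=
    hf.continuousAt.continuousWithinAt.tendsto_nhdsWithin hmaps
  have hle : 𝓝[T] x ×ˢ 𝓝[T] x ≤ 𝓝 (x, x) :=
    (Filter.prod_mono nhdsWithin_le_nhds nhdsWithin_le_nhds).trans_eq nhds_prod_eq.symm
  obtain ⟨c, -, hc⟩ := (A ∘L f').toLinearMap.exists_antilipschitzWith (LinearMap.ker_eq_bot.2 hinj)
  have hbig : (fun p : W × W ↦ p.1 - p.2) =O[𝓝[T] x ×ˢ 𝓝[T] x]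
      fun p ↦ ‖(A ∘L f') (p.1 - p.2)‖ :=
    Asymptotics.IsBigO.of_bound c (Eventually.of_forall fun p ↦ by
      simpa [dist_eq_norm] using hc.le_mul_dist (p.1 - p.2) 0)
  have hlin : (fun p : W × W ↦ A (f p.1 - f p.2) - (A ∘L f') (p.1 - p.2))
      =o[𝓝[T] x ×ˢ 𝓝[T] x] fun p ↦ ‖(A ∘L f') (p.1 - p.2)‖ := by
    refine Asymptotics.IsLittleO.trans_isBigO ?_ hbig
    simpa only [map_sub, ContinuousLinearMap.comp_apply] using
      (A.isBigO_comp _ _).trans_isLittleO (hf.isLittleO.mono hle)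
  have hnorm : (fun p : W × W ↦ ‖A (f p.1 - f p.2)‖ - ‖(A ∘L f') (p.1 - p.2)‖)
      =o[𝓝[T] x ×ˢ 𝓝[T] x] fun p ↦ ‖(A ∘L f') (p.1 - p.2)‖ :=
    (Asymptotics.IsBigO.of_norm_le fun _ ↦ abs_norm_sub_norm_le _ _).trans_isLittleO hlin.norm_left
  have hcomp := (Asymptotics.IsLittleO.comp_tendsto h (hf_tendsto.prodMap hf_tendsto)).trans_isBigO
    (hnorm.isBigO.add (Asymptotics.isBigO_refl _ _) |>.congr_left fun _ ↦ sub_add_cancel _ _)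
  exact (hcomp.add hnorm).congr_left fun _ ↦ sub_add_sub_cancel _ _ _

end HasMetricDerivWithinAt

end MetricDerivative

section AreaFormula

theorem eventually_lintegral_bounds_of_continuousOn {V : Type*} [TopologicalSpace V]
    [MeasurableSpace V] {μ : Measure V} {J : V → ℝ} {S : Set V} (hJ : ContinuousOn J S) {z : V}
    (hz : z ∈ S) (hJz : 0 < J z) {K : NNReal} (hK : 1 < K) :
    ∀ᶠ B in (𝓝[S] z).smallSets, MeasurableSet B →
      ENNReal.ofReal (J z) * μ B ≤ K * ∫⁻ a in B, ENNReal.ofReal (J a) ∂μ ∧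
      ∫⁻ a in B, ENNReal.ofReal (J a) ∂μ ≤ K * (ENNReal.ofReal (J z) * μ B) := by
  have hJz_lt : J z < K * J z := lt_mul_of_one_lt_left hJz hK
  have hle : ∀ᶠ a in 𝓝[S] z, ENNReal.ofReal (J z) ≤ K * ENNReal.ofReal (J a) ∧
      ENNReal.ofReal (J a) ≤ K * ENNReal.ofReal (J z) := by
    filter_upwards [(hJ z hz).eventually_lt continuousWithinAt_const hJz_lt,
      continuousWithinAt_const.eventually_lt ((hJ z hz).const_smul (K : ℝ)) hJz_lt] with a h₁ h₂
    simp only [← ENNReal.ofReal_coe_nnreal, ← ENNReal.ofReal_mul K.coe_nonneg]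
    exact ⟨ENNReal.ofReal_le_ofReal h₂.le, ENNReal.ofReal_le_ofReal h₁.le⟩
  filter_upwards [hle.smallSets] with B hB hBm
  rw [← lintegral_const_mul' _ _ ENNReal.coe_ne_top, ← setLIntegral_const,
    ← lintegral_const_mul' _ _ ENNReal.coe_ne_top]
  exact ⟨setLIntegral_mono' hBm fun a ha ↦ (hB a ha).1,
    setLIntegral_mono' hBm fun a ha ↦ (hB a ha).2⟩

variable {m : ℕ} {X : Type*} [MetricSpace X]
  {Ψ : EuclideanSpace ℝ (Fin m) → X} {S : Set (EuclideanSpace ℝ (Fin m))}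
  {J : EuclideanSpace ℝ (Fin m) → ℝ}

/-- The hypotheses of the area formula: `Ψ` is injective on the measurable set `S`, on which it has
metric derivatives with continuous, positive Jacobian `J`. -/
structure HasMetricJacobian (Ψ : EuclideanSpace ℝ (Fin m) → X) (S : Set (EuclideanSpace ℝ (Fin m)))
    (J : EuclideanSpace ℝ (Fin m) → ℝ) : Prop where
  measurableSet : MeasurableSet S
  injOn : InjOn Ψ S
  continuousOn_jacobian : ContinuousOn J S
  jacobian_pos : ∀ z ∈ S, 0 < J z
  exists_deriv : ∀ z ∈ S, ∃ A : EuclideanSpace ℝ (Fin m) →L[ℝ] EuclideanSpace ℝ (Fin m),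
    |A.det| = J z ∧ HasMetricDerivWithinAt Ψ A S z

namespace HasMetricJacobian

theorem continuousOn (h : HasMetricJacobian Ψ S J) : ContinuousOn Ψ S := fun z hz ↦
  let ⟨_, _, hA⟩ := h.exists_deriv z hz
  hA.continuousWithinAt hz

theorem aemeasurable (h : HasMetricJacobian Ψ S J) :
    AEMeasurable (fun a ↦ (J a).toNNReal) (volume.restrict S) :=
  (h.continuousOn_jacobian.aemeasurable h.measurableSet).real_toNNReal

theorem toNNReal_smul (h : HasMetricJacobian Ψ S J) {a : EuclideanSpace ℝ (Fin m)} (ha : a ∈ S)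
    (c : ℝ) : (J a).toNNReal • c = J a * c := by
  rw [NNReal.smul_def, Real.coe_toNNReal _ (h.jacobian_pos a ha).le, smul_eq_mul]

variable [MeasurableSpace X] [BorelSpace X]

theorem measurableEmbedding (h : HasMetricJacobian Ψ S J) :
    MeasurableEmbedding (S.domRestrict Ψ) :=
  h.continuousOn.measurableEmbedding h.measurableSet h.injOn

theorem eventually_measure_image_bounds (h : HasMetricJacobian Ψ S J)
    {z : EuclideanSpace ℝ (Fin m)} (hz : z ∈ S) {K : NNReal} (hK : 1 < K) :
    ∀ᶠ B in (𝓝[S] z).smallSets, MeasurableSet B →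
      μHE[m] (Ψ '' B) ≤ (K : ENNReal) ^ (m + 1) * ∫⁻ a in B, ENNReal.ofReal (J a) ∧
      ∫⁻ a in B, ENNReal.ofReal (J a) ≤ (K : ENNReal) ^ (m + 1) * μHE[m] (Ψ '' B) := by
  obtain ⟨A, hdet, hA⟩ := h.exists_deriv z hz
  have hvol : ∀ B, μHE[m] (A '' B) = ENNReal.ofReal (J z) * volume B := fun B ↦ by
    rw [EuclideanSpace.euclideanHausdorffMeasure_eq_volume,
      Measure.addHaar_image_continuousLinearMap, hdet]
  filter_upwards [hasMetricDerivWithinAt_iff.1 hA K (NNReal.coe_lt_coe.2 hK),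
    eventually_lintegral_bounds_of_continuousOn (μ := volume) h.continuousOn_jacobian hz
      (h.jacobian_pos z hz) hK] with B hdist hint hBm
  simp only [map_sub, ← dist_eq_norm] at hdist
  have hup := euclideanHausdorffMeasure_image_le_of_dist_le
    (fun a ha b hb ↦ (hdist a ha b hb).1) m
  have hlow := euclideanHausdorffMeasure_image_le_of_dist_le
    (fun a ha b hb ↦ (hdist a ha b hb).2) m
  rw [hvol] at hup hlow
  rw [pow_succ, mul_assoc, mul_assoc]
  refine ⟨hup.trans (mul_le_mul_right (hint hBm).1 _), ?_⟩
  rw [mul_left_comm]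
  exact (hint hBm).2.trans (mul_le_mul_right hlow _)

/-- The Hausdorff measure of the image under `Ψ`, as a measure on the parameter domain. -/
noncomputable def pullbackHausdorff (Ψ : EuclideanSpace ℝ (Fin m) → X)
    (S : Set (EuclideanSpace ℝ (Fin m))) : Measure (EuclideanSpace ℝ (Fin m)) :=
  (Measure.comap (S.domRestrict Ψ) μHE[m]).map Subtype.val

theorem pullbackHausdorff_apply (h : HasMetricJacobian Ψ S J)
    {B : Set (EuclideanSpace ℝ (Fin m))} (hB : MeasurableSet B) (hBS : B ⊆ S) :
    pullbackHausdorff Ψ S B = μHE[m] (Ψ '' B) := by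
  rw [pullbackHausdorff, Measure.map_apply measurable_subtype_coe hB,
    h.measurableEmbedding.comap_apply, domRestrict_eq, image_comp, Subtype.image_preimage_coe,
    inter_eq_right.2 hBS]

theorem measure_image (h : HasMetricJacobian Ψ S J)
    {B : Set (EuclideanSpace ℝ (Fin m))} (hB : MeasurableSet B) (hBS : B ⊆ S) :
    μHE[m] (Ψ '' B) = ∫⁻ a in B, ENNReal.ofReal (J a) := by
  have hlocal : ∀ K : NNReal, 1 < K → ∀ z ∈ S, ∀ᶠ B in (𝓝[S] z).smallSets, MeasurableSet B →
      pullbackHausdorff Ψ S B ≤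
        (K : ENNReal) ^ (m + 1) * volume.withDensity (fun a ↦ ENNReal.ofReal (J a)) B ∧
      volume.withDensity (fun a ↦ ENNReal.ofReal (J a)) B ≤
        (K : ENNReal) ^ (m + 1) * pullbackHausdorff Ψ S B := by
    intro K hK z hz
    filter_upwards [h.eventually_measure_image_bounds hz hK,
      eventually_smallSets_subset.2 self_mem_nhdsWithin] with B hB hBS hBm
    rw [h.pullbackHausdorff_apply hBm hBS, withDensity_apply _ hBm]
    exact hB hBm
  rw [← h.pullbackHausdorff_apply hB hBS, ← withDensity_apply _ hB]
  exact le_antisymm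
    (measure_le_of_locally_le_pow_mul (m + 1)
      (fun K hK z hz ↦ (hlocal K hK z hz).mono fun _ hB hBm ↦ (hB hBm).1) hB hBS)
    (measure_le_of_locally_le_pow_mul (m + 1)
      (fun K hK z hz ↦ (hlocal K hK z hz).mono fun _ hB hBm ↦ (hB hBm).2) hB hBS)

theorem map_eq (h : HasMetricJacobian Ψ S J) :
    Measure.map (S.domRestrict Ψ)
      (Measure.comap (↑) (volume.withDensity fun a ↦ ENNReal.ofReal (J a))) =
      μHE[m].restrict (Ψ '' S) := by
  have he := h.measurableEmbedding
  have hcoe := MeasurableEmbedding.subtype_coe h.measurableSet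
  ext B hB
  have hBm := hcoe.measurableSet_image.2 (he.measurable hB)
  rw [Measure.map_apply he.measurable hB, hcoe.comap_apply, Measure.restrict_apply hB,
    withDensity_apply _ hBm, ← h.measure_image hBm (Subtype.coe_image_subset _ _),
    ← image_comp, ← domRestrict_eq, image_preimage_eq_inter_range, range_domRestrict]

theorem integral_image (h : HasMetricJacobian Ψ S J) (g : X → ℝ) :
    ∫ x in Ψ '' S, g x ∂μHE[m] = ∫ a in S, J a * g (Ψ a) := by
  rw [← h.map_eq, h.measurableEmbedding.integral_map]
  simp only [domRestrict_apply, ENNReal.ofReal]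
  rw [← (MeasurableEmbedding.subtype_coe h.measurableSet).integral_map (g := fun a ↦ g (Ψ a)),
    map_comap_subtype_coe h.measurableSet,
    setIntegral_withDensity_eq_setIntegral_smul₀ h.aemeasurable _ h.measurableSet]
  exact setIntegral_congr_fun h.measurableSet fun a ha ↦ h.toNNReal_smul ha _

theorem integrableOn_image (h : HasMetricJacobian Ψ S J) (g : X → ℝ) :
    IntegrableOn g (Ψ '' S) μHE[m] ↔ IntegrableOn (fun a ↦ J a * g (Ψ a)) S := by
  rw [IntegrableOn, ← h.map_eq, h.measurableEmbedding.integrable_map_iff]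
  simp only [domRestrict_eq, ENNReal.ofReal]
  rw [← Function.comp_assoc,
    ← (MeasurableEmbedding.subtype_coe h.measurableSet).integrable_map_iff,
    map_comap_subtype_coe h.measurableSet, restrict_withDensity h.measurableSet,
    integrable_withDensity_iff_integrable_smul₀ h.aemeasurable]
  exact integrableOn_congr_fun (fun a ha ↦ h.toNNReal_smul ha _) h.measurableSet

end HasMetricJacobian

theorem exists_clm_norm_eq_and_abs_det_eq_sqrt_gram {T : Type*} [NormedAddCommGroup T]
    [InnerProductSpace ℝ T] {D : EuclideanSpace ℝ (Fin m) →L[ℝ] T} (hD : Function.Injective D)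
    {G : Matrix (Fin m) (Fin m) ℝ}
    (hG : ∀ i j, G i j =
      inner ℝ (D (EuclideanSpace.single i 1)) (D (EuclideanSpace.single j 1))) :
    0 < G.det ∧ ∃ A : EuclideanSpace ℝ (Fin m) →L[ℝ] EuclideanSpace ℝ (Fin m),
      |A.det| = √G.det ∧ ∀ v, ‖A v‖ = ‖D v‖ := by
  let R := LinearMap.range D.toLinearMap
  have hrank : Module.finrank ℝ R = m := by
    rw [LinearMap.finrank_range_of_inj hD, finrank_euclideanSpace_fin]
  let b : OrthonormalBasis (Fin m) ℝ R := (stdOrthonormalBasis ℝ R).reindex (finCongr hrank)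
  let A : EuclideanSpace ℝ (Fin m) →ₗ[ℝ] EuclideanSpace ℝ (Fin m) :=
    b.repr.toLinearEquiv.toLinearMap ∘ₗ D.toLinearMap.rangeRestrict
  have hnorm : ∀ v, ‖A v‖ = ‖D v‖ := fun v ↦ b.repr.norm_map _
  have hinner : ∀ v w, inner ℝ (A v) (A w) = inner ℝ (D v) (D w) := fun v w ↦
    b.repr.inner_map_map _ _
  let B := LinearMap.toMatrix (EuclideanSpace.basisFun (Fin m) ℝ).toBasis
    (EuclideanSpace.basisFun (Fin m) ℝ).toBasis A
  have hGB : G = B.transpose * B := by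
    ext i j
    rw [hG, ← hinner, Matrix.mul_apply, PiLp.inner_apply]
    simp [B, LinearMap.toMatrix_apply, mul_comm]
  have hdet : G.det = LinearMap.det A ^ 2 := by
    rw [hGB, Matrix.det_mul, Matrix.det_transpose, LinearMap.det_toMatrix, sq]
  have hinj : LinearMap.ker A = ⊥ := by
    refine LinearMap.ker_eq_bot'.2 fun v hv ↦ hD ?_
    rw [map_zero, ← norm_eq_zero, ← hnorm, hv, norm_zero]
  have hdet_ne : LinearMap.det A ≠ 0 :=
    (((LinearMap.isUnit_iff_ker_eq_bot A).2 hinj).map LinearMap.det).ne_zero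
  refine ⟨by rw [hdet]; positivity, LinearMap.toContinuousLinearMap A, ?_, hnorm⟩
  rw [hdet, Real.sqrt_sq_eq_abs, LinearMap.det_toContinuousLinearMap]

end AreaFormula

section ChartDistance

variable {E H M : Type*} [NormedAddCommGroup E] [NormedSpace ℝ E] [TopologicalSpace H]
  {I : ModelWithCorners ℝ E H} [TopologicalSpace M] [ChartedSpace H M] {p : M}

variable (I) in
/-- The derivative at `y` of the inverse of the preferred chart at `p`. -/
noncomputable abbrev chartDeriv (p : M) (y : E) :
    E →L[ℝ] TangentSpace I ((extChartAt I p).symm y) :=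
  mfderivWithin 𝓘(ℝ, E) I (extChartAt I p).symm (range I) y

theorem chartDeriv_injective [IsManifold I 1 M] {y : E} (hy : y ∈ (extChartAt I p).target) :
    Function.Injective (chartDeriv I p y) :=
  (isInvertible_mfderivWithin_extChartAt_symm hy).injective

theorem chartDeriv_mfderiv_extChartAt [IsManifold I 1 M] {y : E}
    (hy : y ∈ (extChartAt I p).target) (w : TangentSpace I ((extChartAt I p).symm y)) :
    chartDeriv I p y (mfderiv I 𝓘(ℝ, E) (extChartAt I p) ((extChartAt I p).symm y) w) = w :=
  congrArg (fun L ↦ L w) (mfderivWithin_extChartAt_symm_comp_mfderiv_extChartAt hy)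

theorem extChartAt_symm_mem_chartAt_source {y : E} (hy : y ∈ (extChartAt I p).target) :
    (extChartAt I p).symm y ∈ (chartAt H p).source :=
  extChartAt_source I p ▸ (extChartAt I p).map_target hy

theorem chartDeriv_eq_trivializationAt_symm [IsManifold I 1 M] {y : E}
    (hy : y ∈ (extChartAt I p).target) (v : E) :
    chartDeriv I p y v =
      (trivializationAt E (TangentSpace I) p).symm ((extChartAt I p).symm y) v := by
  have hbase := extChartAt_symm_mem_chartAt_source hy
  have hsymmL := TangentBundle.symmL_trivializationAt (I := I) hbase
  rw [(extChartAt I p).right_inv hy] at hsymmL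
  exact (congrArg (fun L ↦ L v) hsymmL).symm.trans (Trivialization.symmL_apply _ hbase v)

theorem contMDiffOn_chartDeriv_section [IsManifold I ∞ M] (p : M) :
    ContMDiffOn (𝓘(ℝ, E).prod 𝓘(ℝ, E)) (I.prod 𝓘(ℝ, E)) ∞
      (fun q : E × E ↦ (⟨(extChartAt I p).symm q.1, chartDeriv I p q.1 q.2⟩ :
        TotalSpace E (TangentSpace I : M → Type _)))
      ((extChartAt I p).target ×ˢ univ) := by
  have hbase : ∀ q ∈ (extChartAt I p).target ×ˢ (univ : Set E),
      (extChartAt I p).symm q.1 ∈ (trivializationAt E (TangentSpace I) p).baseSet := fun q hq ↦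
    extChartAt_symm_mem_chartAt_source hq.1
  rw [Trivialization.contMDiffOn_iff (e := trivializationAt E (TangentSpace I) p)
    fun q hq ↦ (Trivialization.mem_source _).2 (hbase q hq)]
  refine ⟨(contMDiffOn_extChartAt_symm p).comp contMDiffOn_fst fun q hq ↦ hq.1,
    contMDiffOn_snd.congr fun q hq ↦ ?_⟩
  rw [chartDeriv_eq_trivializationAt_symm hq.1]
  exact congrArg Prod.snd (Trivialization.apply_mk_symm _ (hbase q hq) q.2)

theorem derivWithin_clm_comp_extChartAt_comp [IsManifold I 1 M] {F : Type*} [NormedAddCommGroup F]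
    [NormedSpace ℝ F] (L : E →L[ℝ] F) {γ : ℝ → M} {s : Set ℝ} {t : ℝ}
    (hγ : MDifferentiableWithinAt 𝓘(ℝ, ℝ) I γ s t) (hs : UniqueDiffWithinAt ℝ s t)
    (ht : γ t ∈ (extChartAt I p).source) :
    derivWithin (fun t ↦ L (extChartAt I p (γ t))) s t =
      L (mfderiv I 𝓘(ℝ, E) (extChartAt I p) (γ t) (mfderivWithin 𝓘(ℝ, ℝ) I γ s t (1 : ℝ))) := by
  have hφ : MDifferentiableAt I 𝓘(ℝ, E) (extChartAt I p) (γ t) :=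
    mdifferentiableAt_extChartAt (extChartAt_source I p ▸ ht)
  have hcomp := (hφ.hasMFDerivAt.comp_hasMFDerivWithinAt t hγ.hasMFDerivWithinAt).hasFDerivWithinAt
  exact (L.hasFDerivAt.comp_hasFDerivWithinAt t hcomp).hasDerivWithinAt.derivWithin hs

variable [RiemannianBundle (fun x : M ↦ TangentSpace I x)]

theorem continuousOn_norm_chartDeriv [IsManifold I ∞ M]
    [IsContinuousRiemannianBundle E (fun x : M ↦ TangentSpace I x)] (p : M) :
    ContinuousOn (fun q : E × E ↦ ‖chartDeriv I p q.1 q.2‖) ((extChartAt I p).target ×ˢ univ) := by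
  have hsection := (contMDiffOn_chartDeriv_section (I := I) p).continuousOn
  simpa only [norm_eq_sqrt_real_inner] using (hsection.inner_bundle hsection).sqrt

theorem eventually_norm_chartDeriv_le [IsManifold I ∞ M] [FiniteDimensional ℝ E]
    [IsContinuousRiemannianBundle E (fun x : M ↦ TangentSpace I x)] {y₀ : E}
    (hy₀ : y₀ ∈ (extChartAt I p).target) {K : ℝ} (hK : 1 < K) :
    ∀ᶠ y in 𝓝[range I] y₀, ∀ v, ‖chartDeriv I p y v‖ ≤ K * ‖chartDeriv I p y₀ v‖ ∧
      ‖chartDeriv I p y₀ v‖ ≤ K * ‖chartDeriv I p y v‖ := by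
  have hsphere : ∀ᶠ y in 𝓝 y₀, ∀ v ∈ Metric.sphere (0 : E) 1, y ∈ (extChartAt I p).target →
      ‖chartDeriv I p y v‖ < K * ‖chartDeriv I p y₀ v‖ ∧
        ‖chartDeriv I p y₀ v‖ < K * ‖chartDeriv I p y v‖ := by
    refine (isCompact_sphere (0 : E) 1).eventually_forall_of_forall_eventually fun v hv ↦ ?_
    have hlt : ‖chartDeriv I p y₀ v‖ < K * ‖chartDeriv I p y₀ v‖ := by
      refine lt_mul_of_one_lt_left (norm_pos_iff.2 fun h0 ↦ ?_) hK
      have hv0 : v = 0 := chartDeriv_injective hy₀ (h0.trans (map_zero _).symm)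
      simp [hv0] at hv
    have hcont := continuousOn_norm_chartDeriv (I := I) p (y₀, v) ⟨hy₀, mem_univ v⟩
    have hcont₀ : ContinuousWithinAt (fun q : E × E ↦ ‖chartDeriv I p y₀ q.2‖)
        ((extChartAt I p).target ×ˢ univ) (y₀, v) :=
      ContinuousWithinAt.comp (t := (extChartAt I p).target ×ˢ univ)
        (g := fun q : E × E ↦ ‖chartDeriv I p q.1 q.2‖) (f := fun q : E × E ↦ (y₀, q.2)) hcont
        (by fun_prop) fun q _ ↦ ⟨hy₀, mem_univ _⟩
    filter_upwards [eventually_nhdsWithin_iff.1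
      ((hcont.eventually_lt (hcont₀.const_smul K) hlt).and
        (hcont₀.eventually_lt (hcont.const_smul K) hlt))] with q hq hq_mem
    exact hq ⟨hq_mem, mem_univ _⟩
  rw [← nhdsWithin_extChartAt_target_eq_of_mem hy₀]
  filter_upwards [nhdsWithin_le_nhds hsphere, self_mem_nhdsWithin] with y hy hy_mem v
  rcases eq_or_ne v 0 with rfl | hv
  · rw [map_zero, map_zero, norm_zero, norm_zero, mul_zero, and_self]
  have hv' : 0 < ‖v‖ := norm_pos_iff.2 hv
  obtain ⟨h₁, h₂⟩ := hy (‖v‖⁻¹ • v) (by simp [norm_smul, hv'.ne']) hy_mem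
  simp only [map_smul, norm_smul, norm_inv, norm_norm, mul_left_comm K] at h₁ h₂
  exact ⟨(lt_of_mul_lt_mul_left h₁ (by positivity)).le,
    (lt_of_mul_lt_mul_left h₂ (by positivity)).le⟩

theorem enorm_map_mfderiv_extChartAt_le [IsManifold I 1 M] {F : Type*} [NormedAddCommGroup F]
    [NormedSpace ℝ F] {L : E →L[ℝ] F} {K : NNReal} {x : M} (hx : x ∈ (extChartAt I p).source)
    (hL : ∀ v, ‖L v‖ ≤ K * ‖chartDeriv I p (extChartAt I p x) v‖) (w : TangentSpace I x) :
    ‖L (mfderiv I 𝓘(ℝ, E) (extChartAt I p) x w)‖ₑ ≤ K * ‖w‖ₑ := by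
  obtain ⟨y, hy, rfl⟩ : ∃ y ∈ (extChartAt I p).target, x = (extChartAt I p).symm y :=
    ⟨_, (extChartAt I p).map_source hx, ((extChartAt I p).left_inv hx).symm⟩
  rw [(extChartAt I p).right_inv hy] at hL
  have hw := hL (mfderiv I 𝓘(ℝ, E) (extChartAt I p) ((extChartAt I p).symm y) w)
  rw [chartDeriv_mfderiv_extChartAt hy] at hw
  rw [enorm_eq_nnnorm, enorm_eq_nnnorm, ← ENNReal.coe_mul, ENNReal.coe_le_coe]
  exact NNReal.coe_le_coe.1 hw

theorem enorm_sub_le_mul_pathELength [IsManifold I 1 M] {F : Type*} [NormedAddCommGroup F]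
    [NormedSpace ℝ F] {L : E →L[ℝ] F} {K : NNReal} {γ : ℝ → M}
    (hγ : ContMDiff 𝓘(ℝ, ℝ) I 1 γ)
    (hL : ∀ t ∈ Icc (0 : ℝ) 1, γ t ∈ (extChartAt I p).source ∧
      ∀ v, ‖L v‖ ≤ K * ‖chartDeriv I p (extChartAt I p (γ t)) v‖) :
    ‖L (extChartAt I p (γ 1) - extChartAt I p (γ 0))‖ₑ ≤ K * pathELength I γ 0 1 := by
  have hsmooth : ContDiffOn ℝ 1 (fun t ↦ L (extChartAt I p (γ t))) (Icc 0 1) :=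
    L.contDiff.comp_contDiffOn (contMDiffOn_iff_contDiffOn.1
      (contMDiffOn_extChartAt.comp hγ.contMDiffOn fun t ht ↦ extChartAt_source I p ▸ (hL t ht).1))
  rw [map_sub]
  refine (enorm_sub_le_lintegral_derivWithin_Icc_of_contDiffOn_Icc hsmooth zero_le_one).trans ?_
  rw [pathELength_eq_lintegral_mfderivWithin_Icc, ← lintegral_const_mul' _ _ ENNReal.coe_ne_top]
  refine setLIntegral_mono' measurableSet_Icc fun t ht ↦ ?_
  rw [derivWithin_clm_comp_extChartAt_comp L ((hγ.mdifferentiable one_ne_zero).mdifferentiableOn t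
    (mem_univ t) |>.mono (subset_univ _)) (uniqueDiffOn_Icc zero_lt_one t ht) (hL t ht).1]
  exact enorm_map_mfderiv_extChartAt_le (hL t ht).1 (hL t ht).2 _

theorem riemannianEDist_extChartAt_symm_le [IsManifold I 1 M] {a b : E} {c : NNReal}
    (hc : ∀ y ∈ segment ℝ a b, y ∈ (extChartAt I p).target ∧
      ‖chartDeriv I p y (b - a)‖ ≤ c) :
    riemannianEDist I ((extChartAt I p).symm a) ((extChartAt I p).symm b) ≤ c := by
  let η : ℝ → E := AffineMap.lineMap a b
  have hη : ∀ t, HasDerivAt η (b - a) t := fun t ↦ AffineMap.hasDerivAt_lineMap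
  have hη_smooth : ContMDiffOn 𝓘(ℝ, ℝ) 𝓘(ℝ, E) 1 η (Icc 0 1) :=
    (contMDiff_iff_contDiff.2 (ContinuousAffineMap.lineMap (R := ℝ) a b).contDiff).contMDiffOn
  have hη_mem : MapsTo η (Icc 0 1) (segment ℝ a b) := fun t ht ↦
    segment_eq_image_lineMap ℝ a b ▸ mem_image_of_mem _ ht
  have hderiv : ∀ t ∈ Icc (0 : ℝ) 1,
      mfderivWithin 𝓘(ℝ, ℝ) I ((extChartAt I p).symm ∘ η) (Icc 0 1) t (1 : ℝ) =
        chartDeriv I p (η t) (b - a) := by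
    intro t ht
    have hcomp := (mdifferentiableWithinAt_extChartAt_symm
      (hc _ (hη_mem ht)).1).hasMFDerivWithinAt.comp t
        (hη t).hasFDerivAt.hasFDerivWithinAt.hasMFDerivWithinAt
        fun s hs ↦ extChartAt_target_subset_range p (hc _ (hη_mem hs)).1
    rw [hcomp.mfderivWithin (uniqueDiffOn_Icc zero_lt_one t ht).uniqueMDiffWithinAt]
    exact congrArg (chartDeriv I p (η t)) (one_smul ℝ (b - a))
  calc riemannianEDist I ((extChartAt I p).symm a) ((extChartAt I p).symm b)
      ≤ pathELength I ((extChartAt I p).symm ∘ η) 0 1 :=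
        riemannianEDist_le_pathELength
          ((contMDiffOn_extChartAt_symm p).comp hη_smooth fun t ht ↦ (hc _ (hη_mem ht)).1)
          (by simp [η]) (by simp [η]) zero_le_one
    _ ≤ ∫⁻ _ in Icc (0 : ℝ) 1, (c : ENNReal) := by
        rw [pathELength_eq_lintegral_mfderivWithin_Icc]
        refine setLIntegral_mono' measurableSet_Icc fun t ht ↦ ?_
        refine (congrArg enorm (hderiv t ht)).le.trans ?_
        rw [enorm_eq_nnnorm, ENNReal.coe_le_coe]
        exact NNReal.coe_le_coe.1 (hc _ (hη_mem ht)).2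
    _ = c := by simp

end ChartDistance

section ChartMetricDeriv

variable {E H M : Type*} [NormedAddCommGroup E] [NormedSpace ℝ E] [TopologicalSpace H]
  {I : ModelWithCorners ℝ E H} [MetricSpace M] [ChartedSpace H M]
  [RiemannianBundle (fun x : M ↦ TangentSpace I x)] {p : M}

theorem edist_le_pathELength [IsRiemannianManifold I M] {γ : ℝ → M} (hγ : ContMDiff 𝓘(ℝ, ℝ) I 1 γ)
    {t : ℝ} (ht : t ∈ Icc (0 : ℝ) 1) : edist (γ 0) (γ t) ≤ pathELength I γ 0 1 := by
  rw [IsRiemannianManifold.out (I := I)]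
  exact (riemannianEDist_le_pathELength hγ.contMDiffOn rfl rfl ht.1).trans
    (pathELength_mono le_rfl ht.2)

theorem enorm_sub_le_mul_edist [IsManifold I 1 M] [IsRiemannianManifold I M] {F : Type*}
    [NormedAddCommGroup F] [NormedSpace ℝ F] {L : E →L[ℝ] F} {K : NNReal} {x x' : M} {r : ENNReal}
    (hr : edist x x' < r) (hL : ∀ z, edist x z < r → z ∈ (extChartAt I p).source ∧
      ∀ v, ‖L v‖ ≤ K * ‖chartDeriv I p (extChartAt I p z) v‖) :
    ‖L (extChartAt I p x' - extChartAt I p x)‖ₑ ≤ K * edist x x' := by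
  have hle : ∀ c, edist x x' < c → c ≤ r →
      ‖L (extChartAt I p x' - extChartAt I p x)‖ₑ ≤ K * c := by
    intro c hc hcr
    rw [IsRiemannianManifold.out (I := I)] at hc
    obtain ⟨γ, rfl, rfl, hγ, hlength, -⟩ :=
      exists_lt_locally_constant_of_riemannianEDist_lt hc zero_lt_one
    refine (enorm_sub_le_mul_pathELength hγ fun t ht ↦ hL _ ?_).trans (by gcongr)
    exact ((edist_le_pathELength hγ ht).trans_lt hlength).trans_le hcr
  have : (𝓝[>] edist x x').NeBot := nhdsGT_neBot_of_exists_gt ⟨r, hr⟩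
  have hlim : Tendsto (fun c ↦ (K : ENNReal) * c) (𝓝[>] edist x x') (𝓝 (K * edist x x')) :=
    (ENNReal.Tendsto.const_mul tendsto_id (Or.inr ENNReal.coe_ne_top)).mono_left
      nhdsWithin_le_nhds
  refine ge_of_tendsto hlim ?_
  filter_upwards [Ioc_mem_nhdsGT hr] with c hc using hle c hc.1 hc.2

theorem eventually_norm_sub_le_mul_dist [IsManifold I 1 M] [IsRiemannianManifold I M] {F : Type*}
    [NormedAddCommGroup F] [NormedSpace ℝ F] {L : E →L[ℝ] F} {K : NNReal} {y₀ : E}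
    (hy₀ : y₀ ∈ (extChartAt I p).target)
    (hL : ∀ᶠ y in 𝓝[range I] y₀, ∀ v, ‖L v‖ ≤ K * ‖chartDeriv I p y v‖) :
    ∀ᶠ B in (𝓝[range I] y₀).smallSets, ∀ a ∈ B, ∀ b ∈ B,
      ‖L (a - b)‖ ≤ K * dist ((extChartAt I p).symm a) ((extChartAt I p).symm b) := by
  have hsource : (extChartAt I p).symm y₀ ∈ (extChartAt I p).source :=
    (extChartAt I p).map_target hy₀
  have hchart : Tendsto (extChartAt I p) (𝓝 ((extChartAt I p).symm y₀)) (𝓝[range I] y₀) := by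
    refine tendsto_nhdsWithin_iff.2 ⟨?_, Eventually.of_forall fun x ↦ ?_⟩
    · simpa only [ContinuousAt, (extChartAt I p).right_inv hy₀] using
        continuousAt_extChartAt' hsource
    · exact mem_range_self _
  obtain ⟨r, hr, hball⟩ := EMetric.mem_nhds_iff.1 (show {x | x ∈ (extChartAt I p).source ∧
      ∀ v, ‖L v‖ ≤ K * ‖chartDeriv I p (extChartAt I p x) v‖} ∈ 𝓝 ((extChartAt I p).symm y₀) from
    inter_mem ((isOpen_extChartAt_source p).mem_nhds hsource) (hchart hL))
  have hr3 : 0 < r / 3 := ENNReal.div_pos hr.ne' (by simp)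
  have hnear : ∀ᶠ y in 𝓝[range I] y₀, y ∈ (extChartAt I p).target ∧
      edist ((extChartAt I p).symm y) ((extChartAt I p).symm y₀) < r / 3 :=
    inter_mem (extChartAt_target_mem_nhdsWithin_of_mem hy₀) (nhdsWithin_le_nhds
      ((continuousAt_extChartAt_symm'' hy₀).preimage_mem_nhds (Metric.eball_mem_nhds _ hr3)))
  refine eventually_smallSets.2 ⟨_, hnear, fun B hB a ha b hb ↦ ?_⟩
  obtain ⟨⟨ha, har⟩, hb, hbr⟩ := hB ha, hB hb
  have hba : edist ((extChartAt I p).symm b) ((extChartAt I p).symm a) < r / 3 + r / 3 :=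
    (edist_triangle_right _ _ _).trans_lt (ENNReal.add_lt_add hbr har)
  have hmain := enorm_sub_le_mul_edist (p := p) (L := L) (K := K) hba fun z hz ↦ hball <|
    calc edist z ((extChartAt I p).symm y₀)
        ≤ edist ((extChartAt I p).symm b) z +
          edist ((extChartAt I p).symm b) ((extChartAt I p).symm y₀) := edist_triangle_left _ _ _
      _ < r / 3 + r / 3 + r / 3 := ENNReal.add_lt_add hz hbr
      _ = r := ENNReal.add_thirds r
  rw [(extChartAt I p).right_inv ha, (extChartAt I p).right_inv hb, edist_comm, edist_nndist,
    enorm_eq_nnnorm, ← ENNReal.coe_mul, ENNReal.coe_le_coe] at hmain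
  exact NNReal.coe_le_coe.2 hmain

theorem eventually_dist_le_norm_sub [IsManifold I 1 M] [IsRiemannianManifold I M] {y₀ : E}
    (hy₀ : y₀ ∈ (extChartAt I p).target) {K : ℝ}
    (hK : ∀ᶠ y in 𝓝[range I] y₀, ∀ v, ‖chartDeriv I p y v‖ ≤ K * ‖chartDeriv I p y₀ v‖) :
    ∀ᶠ B in (𝓝[range I] y₀).smallSets, ∀ a ∈ B, ∀ b ∈ B,
      dist ((extChartAt I p).symm a) ((extChartAt I p).symm b) ≤
        K * ‖chartDeriv I p y₀ (a - b)‖ := by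
  obtain ⟨r, hr, hball⟩ := Metric.mem_nhdsWithin_iff.1
    (inter_mem (extChartAt_target_mem_nhdsWithin_of_mem hy₀) hK)
  refine eventually_smallSets.2 ⟨Metric.ball y₀ r ∩ range I, ?_, fun B hB a ha b hb ↦ ?_⟩
  · exact inter_mem (nhdsWithin_le_nhds (Metric.ball_mem_nhds _ hr)) self_mem_nhdsWithin
  have hsegment : segment ℝ b a ⊆ Metric.ball y₀ r ∩ range I :=
    ((convex_ball _ _).inter I.convex_range).segment_subset (hB hb) (hB ha)
  obtain ⟨c, hc⟩ : ∃ c : NNReal, (c : ℝ) = K * ‖chartDeriv I p y₀ (a - b)‖ :=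
    CanLift.prf _ ((norm_nonneg _).trans ((hball (hB ha)).2 (a - b)))
  have hle := riemannianEDist_extChartAt_symm_le (p := p) (c := c) fun y hy ↦
    ⟨(hball (hsegment hy)).1, hc ▸ (hball (hsegment hy)).2 (a - b)⟩
  rw [← IsRiemannianManifold.out (I := I), edist_comm, edist_nndist, ENNReal.coe_le_coe] at hle
  exact hc ▸ NNReal.coe_le_coe.2 hle

theorem hasMetricDerivWithinAt_extChartAt_symm [IsManifold I ∞ M] [IsRiemannianManifold I M]
    [FiniteDimensional ℝ E] [IsContinuousRiemannianBundle E (fun x : M ↦ TangentSpace I x)] {y₀ : E}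
    (hy₀ : y₀ ∈ (extChartAt I p).target) :
    HasMetricDerivWithinAt (extChartAt I p).symm (chartDeriv I p y₀) (range I) y₀ := by
  refine hasMetricDerivWithinAt_iff.2 fun K hK ↦ ?_
  have : IsManifold I 1 M := .of_le (n := ∞) (by simp)
  lift K to NNReal using (zero_lt_one.trans hK).le
  have hnear := eventually_norm_chartDeriv_le hy₀ hK
  filter_upwards [eventually_dist_le_norm_sub hy₀ (hnear.mono fun y hy v ↦ (hy v).1),
    eventually_norm_sub_le_mul_dist hy₀ (hnear.mono fun y hy v ↦ (hy v).2)] with B hle hge a ha b hb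
  exact ⟨hle a ha b hb, hge a ha b hb⟩

end ChartMetricDeriv

section GramMatrix

theorem contDiffOn_matrix_det {V : Type*} [NormedAddCommGroup V] [NormedSpace ℝ V] {n : Type*}
    [Fintype n] [DecidableEq n] {k : WithTop ℕ∞} {s : Set V} {A : V → Matrix n n ℝ}
    (hA : ∀ i j, ContDiffOn ℝ k (fun y ↦ A y i j) s) : ContDiffOn ℝ k (fun y ↦ (A y).det) s := by
  simp only [Matrix.det_apply]
  exact ContDiffOn.sum fun σ _ ↦ (contDiffOn_prod fun i _ ↦ hA _ _).const_smul _

theorem contDiffOn_matrix_inv {V : Type*} [NormedAddCommGroup V] [NormedSpace ℝ V] {n : Type*}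
    [Fintype n] [DecidableEq n] {k : WithTop ℕ∞} {s : Set V} {A : V → Matrix n n ℝ}
    (hA : ∀ i j, ContDiffOn ℝ k (fun y ↦ A y i j) s) (hdet : ∀ y ∈ s, (A y).det ≠ 0)
    (i j : n) : ContDiffOn ℝ k (fun y ↦ (A y)⁻¹ i j) s := by
  simp only [Matrix.inv_def, Matrix.smul_apply, smul_eq_mul, Ring.inverse_eq_inv',
    Matrix.adjugate_apply]
  refine ((contDiffOn_matrix_det hA).inv hdet).mul (contDiffOn_matrix_det fun a b ↦ ?_)
  rcases eq_or_ne a j with rfl | h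
  · simpa only [Matrix.updateRow_self] using contDiffOn_const
  · simpa only [Matrix.updateRow_ne h] using hA a b

theorem inner_eq_sum_gram_inv {n : ℕ} {T : Type*} [NormedAddCommGroup T] [InnerProductSpace ℝ T]
    {D : EuclideanSpace ℝ (Fin n) →L[ℝ] T} (hD : Function.Surjective D)
    {G : Matrix (Fin n) (Fin n) ℝ} (hdet : G.det ≠ 0)
    (hG : ∀ i j, G i j = inner ℝ (D (EuclideanSpace.single i 1)) (D (EuclideanSpace.single j 1)))
    (P Q : T) :
    inner ℝ P Q = ∑ i, ∑ j, inner ℝ P (D (EuclideanSpace.single i 1)) * G⁻¹ i j *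
      inner ℝ Q (D (EuclideanSpace.single j 1)) := by
  obtain ⟨c, rfl⟩ := hD Q
  have hc : D c = ∑ i, c i • D (EuclideanSpace.single i 1) := by
    conv_lhs => rw [← (EuclideanSpace.basisFun (Fin n) ℝ).sum_repr c]
    simp only [EuclideanSpace.basisFun_repr, EuclideanSpace.basisFun_apply, map_sum, map_smul]
  have hcovariant : ∀ j, inner ℝ (D c) (D (EuclideanSpace.single j 1)) = (G.mulVec c) j := by
    intro j
    conv_lhs => rw [hc]
    rw [sum_inner, Matrix.mulVec, dotProduct]
    refine Finset.sum_congr rfl fun i _ ↦ ?_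
    rw [real_inner_smul_left, hG, real_inner_comm, mul_comm]
  have hinv : ∀ i, ∑ j, G⁻¹ i j * (G.mulVec c) j = c i := congrFun <| by
    change G⁻¹.mulVec (G.mulVec c) = c
    rw [Matrix.mulVec_mulVec, Matrix.nonsing_inv_mul _ (isUnit_iff_ne_zero.2 hdet),
      Matrix.one_mulVec]
  simp only [hcovariant, mul_assoc, ← Finset.mul_sum, hinv]
  conv_lhs => rw [hc]
  rw [inner_sum]
  exact Finset.sum_congr rfl fun i _ ↦ by rw [real_inner_smul_right, mul_comm]

end GramMatrix

section ChartDomain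

variable {M : Type*} [TopologicalSpace M] [ChartedSpace (EuclideanHalfSpace 3) M] {p : M}

/-- The parametrization of `M` inverse to the preferred chart at `p`. -/
noncomputable abbrev chartParam (p : M) : E3 → M := (extChartAt (𝓡∂ 3) p).symm

/-- The domain of `chartParam p`. -/
abbrev chartDom (p : M) : Set E3 := (extChartAt (𝓡∂ 3) p).target

/-- The closed half-space on which charts are modelled. -/
abbrev halfSpace3 : Set E3 := range (𝓡∂ 3)

theorem mem_halfSpace3 {y : E3} : y ∈ halfSpace3 ↔ 0 ≤ y 0 := by
  rw [halfSpace3, range_modelWithCornersEuclideanHalfSpace]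
  rfl

theorem chartDom_subset (p : M) : chartDom p ⊆ halfSpace3 := extChartAt_target_subset_range p

theorem chartParam_image (p : M) : chartParam p '' chartDom p = (extChartAt (𝓡∂ 3) p).source :=
  (extChartAt (𝓡∂ 3) p).symm_image_target_eq_source

theorem chartDom_mem_nhdsWithin {y : E3} (hy : y ∈ chartDom p) : chartDom p ∈ 𝓝[halfSpace3] y :=
  extChartAt_target_mem_nhdsWithin_of_mem hy

theorem exists_isOpen_chartDom_eq_inter (p : M) :
    ∃ O : Set E3, IsOpen O ∧ chartDom p = O ∩ halfSpace3 :=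
  ⟨(𝓡∂ 3).symm ⁻¹' (chartAt (EuclideanHalfSpace 3) p).target,
    (chartAt (EuclideanHalfSpace 3) p).open_target.preimage (𝓡∂ 3).continuous_symm,
    extChartAt_target (I := 𝓡∂ 3) p⟩

theorem fderivWithin_chartDom {F : Type*} [NormedAddCommGroup F] [NormedSpace ℝ F] {y : E3}
    (hy : y ∈ chartDom p) (h : E3 → F) :
    fderivWithin ℝ h (chartDom p) y = fderivWithin ℝ h halfSpace3 y := by
  obtain ⟨O, hO, heq⟩ := exists_isOpen_chartDom_eq_inter p
  rw [heq] at hy ⊢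
  rw [inter_comm, fderivWithin_inter (hO.mem_nhds hy.1)]

theorem measurableSet_halfSpace3 : MeasurableSet halfSpace3 := (𝓡∂ 3).isClosed_range.measurableSet

theorem measurableSet_chartDom (p : M) : MeasurableSet (chartDom p) := by
  obtain ⟨O, hO, h⟩ := exists_isOpen_chartDom_eq_inter p
  exact h ▸ hO.measurableSet.inter measurableSet_halfSpace3

theorem mem_interior_chartDom [IsManifold (𝓡∂ 3) ∞ M] {x : M}
    (hx : x ∈ (extChartAt (𝓡∂ 3) p).source) (hb : x ∉ (𝓡∂ 3).boundary M) :
    extChartAt (𝓡∂ 3) p x ∈ interior (chartDom p) := by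
  rw [extChartAt_source] at hx
  exact ((𝓡∂ 3).isInteriorPoint_iff_of_mem_atlas (n := ∞) (by simp) (chart_mem_atlas _ p) hx).1
    ((ModelWithCorners.isInteriorPoint_iff_not_isBoundaryPoint x).2 hb)

variable [IsManifold (𝓡∂ 3) ∞ M] {k : WithTop ℕ∞} {f : M → ℝ}

theorem contDiffOn_comp_chartParam (hk : k ≤ ∞) (hf : ContMDiff (𝓡∂ 3) 𝓘(ℝ, ℝ) k f) (p : M) :
    ContDiffOn ℝ k (f ∘ chartParam p) (chartDom p) :=
  contMDiffOn_iff_contDiffOn.1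
    (hf.comp_contMDiffOn ((contMDiffOn_extChartAt_symm (n := ∞) p).of_le hk))

theorem contMDiff_of_chartParam (hk : k ≤ ∞)
    (hf : ∀ p, ContDiffOn ℝ k (f ∘ chartParam p) (chartDom p)) :
    ContMDiff (𝓡∂ 3) 𝓘(ℝ, ℝ) k f := by
  intro p
  have hchart : ContMDiffOn (𝓡∂ 3) 𝓘(ℝ, E3) k (extChartAt (𝓡∂ 3) p)
      (chartAt (EuclideanHalfSpace 3) p).source := (contMDiffOn_extChartAt (n := ∞)).of_le hk
  have hcomp := (contMDiffOn_iff_contDiffOn.2 (hf p)).comp hchart fun x hx ↦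
    (extChartAt (𝓡∂ 3) p).map_source (by rwa [extChartAt_source])
  have hsource := chart_source_mem_nhds (EuclideanHalfSpace 3) p
  refine (hcomp.contMDiffAt hsource).congr_of_eventuallyEq ?_
  filter_upwards [hsource] with x hx
  exact congrArg f ((extChartAt (𝓡∂ 3) p).left_inv (by rwa [extChartAt_source])).symm

/-- The `i`-th partial derivative of `f` in the preferred chart at `p`. -/
noncomputable def chartPartial (p : M) (f : M → ℝ) (i : Fin 3) (y : E3) : ℝ :=
  fderivWithin ℝ (f ∘ chartParam p) halfSpace3 y (stdVec i)

theorem contDiffOn_chartPartial {m : ℕ∞} (hf : ContMDiff (𝓡∂ 3) 𝓘(ℝ, ℝ) (m + 1) f)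
    (p : M) (i : Fin 3) :
    ContDiffOn ℝ m (chartPartial p f i) (chartDom p) := by
  have hderiv := (contDiffOn_comp_chartParam (mod_cast le_top) hf p).fderivWithin
    (uniqueDiffOn_extChartAt_target p) le_rfl
  refine (hderiv.clm_apply (contDiffOn_const (c := stdVec i))).congr fun y hy ↦ ?_
  rw [chartPartial, fderivWithin_chartDom hy]

theorem mfderiv_chartDeriv {y : E3} (hy : y ∈ chartDom p)
    (hf : MDifferentiableAt (𝓡∂ 3) 𝓘(ℝ, ℝ) f (chartParam p y)) (v : E3) :
    mfderiv (𝓡∂ 3) 𝓘(ℝ, ℝ) f (chartParam p y) (chartDeriv (𝓡∂ 3) p y v) =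
      fderivWithin ℝ (f ∘ chartParam p) halfSpace3 y v := by
  have hcomp := mfderiv_comp_mfderivWithin (I := 𝓘(ℝ, E3)) (I' := 𝓡∂ 3) (I'' := 𝓘(ℝ, ℝ)) y hf
    (mdifferentiableWithinAt_extChartAt_symm hy)
    ((𝓡∂ 3).uniqueDiffOn y (chartDom_subset p hy)).uniqueMDiffWithinAt
  rw [mfderivWithin_eq_fderivWithin] at hcomp
  exact (congrArg (fun L : E3 →L[ℝ] ℝ ↦ L v) hcomp).symm

end ChartDomain

section ChartMetric

variable {M : Type*} [MetricSpace M] [ChartedSpace (EuclideanHalfSpace 3) M]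
  [RiemannianBundle (fun x : M ↦ TangentSpace (𝓡∂ 3) x)] {p : M} {y : E3}

/-- The matrix of metric coefficients in the preferred chart at `p`. -/
noncomputable abbrev chartMetric (p : M) (y : E3) : Matrix (Fin 3) (Fin 3) ℝ :=
  metricCoeff (chartParam p) halfSpace3 y

/-- The density of the Riemannian volume in the preferred chart at `p`. -/
noncomputable def chartDensity (p : M) (y : E3) : ℝ := √(chartMetric p y).det

variable [IsManifold (𝓡∂ 3) ∞ M]

theorem chartMetric_det_pos (hy : y ∈ chartDom p) : 0 < (chartMetric p y).det :=
  (exists_clm_norm_eq_and_abs_det_eq_sqrt_gram (D := chartDeriv (𝓡∂ 3) p y)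
    (chartDeriv_injective hy) fun _ _ ↦ rfl).1

theorem exists_abs_det_eq_chartDensity (hy : y ∈ chartDom p) :
    ∃ A : E3 →L[ℝ] E3, |A.det| = chartDensity p y ∧
      ∀ v, ‖A v‖ = ‖chartDeriv (𝓡∂ 3) p y v‖ :=
  (exists_clm_norm_eq_and_abs_det_eq_sqrt_gram (D := chartDeriv (𝓡∂ 3) p y)
    (chartDeriv_injective hy) fun _ _ ↦ rfl).2

theorem chartDensity_pos (hy : y ∈ chartDom p) : 0 < chartDensity p y :=
  Real.sqrt_pos.2 (chartMetric_det_pos hy)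

variable [IsContMDiffRiemannianBundle (𝓡∂ 3) ∞ E3 (fun x : M ↦ TangentSpace (𝓡∂ 3) x)]

theorem contDiffOn_chartMetric (p : M) (i j : Fin 3) :
    ContDiffOn ℝ ∞ (fun y ↦ chartMetric p y i j) (chartDom p) := by
  have hsection : ∀ v : E3, ContMDiffOn 𝓘(ℝ, E3) ((𝓡∂ 3).prod 𝓘(ℝ, E3)) ∞
      (fun y ↦ (⟨chartParam p y, chartDeriv (𝓡∂ 3) p y v⟩ :
        TotalSpace E3 (TangentSpace (𝓡∂ 3) : M → Type _))) (chartDom p) := fun v ↦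
    (contMDiffOn_chartDeriv_section p).comp (contMDiffOn_id.prodMk contMDiffOn_const)
      fun y hy ↦ ⟨hy, mem_univ v⟩
  exact contMDiffOn_iff_contDiffOn.1 ((hsection (stdVec i)).inner_bundle (hsection (stdVec j)))

theorem contDiffOn_chartMetric_inv (p : M) (i j : Fin 3) :
    ContDiffOn ℝ ∞ (fun y ↦ (chartMetric p y)⁻¹ i j) (chartDom p) :=
  contDiffOn_matrix_inv (contDiffOn_chartMetric p) (fun _ hy ↦ (chartMetric_det_pos hy).ne') i j

theorem contDiffOn_chartDensity (p : M) : ContDiffOn ℝ ∞ (chartDensity p) (chartDom p) :=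
  (contDiffOn_matrix_det (contDiffOn_chartMetric p)).sqrt fun _ hy ↦ (chartMetric_det_pos hy).ne'

end ChartMetric

section GradPair

variable {M : Type*} [MetricSpace M] [ChartedSpace (EuclideanHalfSpace 3) M]
  [RiemannianBundle (fun x : M ↦ TangentSpace (𝓡∂ 3) x)] {f f' g : M → ℝ} {x p : M}

/-- The pairing `⟨∇f, ∇g⟩`. -/
noncomputable def gradPair (f g : M → ℝ) (x : M) : ℝ :=
  inner ℝ (riemGradient f x) (riemGradient g x)

theorem gradPair_self (f : M → ℝ) (x : M) : gradPair f f x = ‖riemGradient f x‖ ^ 2 :=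
  real_inner_self_eq_norm_sq _

theorem gradPair_self_nonneg (f : M → ℝ) (x : M) : 0 ≤ gradPair f f x := real_inner_self_nonneg

theorem norm_riemGradient (f : M → ℝ) (x : M) : ‖riemGradient f x‖ = √(gradPair f f x) := by
  rw [gradPair_self, Real.sqrt_sq (norm_nonneg _)]

variable [IsManifold (𝓡∂ 3) ∞ M]

theorem gradPair_eq_mfderiv (f g : M → ℝ) (x : M) :
    gradPair f g x = mfderiv (𝓡∂ 3) 𝓘(ℝ, ℝ) f x (riemGradient g x) :=
  inner_riemGradient f x _

theorem gradPair_eq_of_hasMFDerivAt {f' : TangentSpace (𝓡∂ 3) x →L[ℝ] ℝ}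
    (hf : HasMFDerivAt (𝓡∂ 3) 𝓘(ℝ, ℝ) f x f') (g : M → ℝ) :
    gradPair f g x = f' (riemGradient g x) :=
  (gradPair_eq_mfderiv f g x).trans (congrArg (fun L ↦ L (riemGradient g x)) hf.mfderiv)

theorem gradPair_mul (hf : MDifferentiableAt (𝓡∂ 3) 𝓘(ℝ, ℝ) f x)
    (hf' : MDifferentiableAt (𝓡∂ 3) 𝓘(ℝ, ℝ) f' x) :
    gradPair (fun x ↦ f x * f' x) g x = f x * gradPair f' g x + f' x * gradPair f g x := by
  rw [gradPair_eq_mfderiv f', gradPair_eq_mfderiv f]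
  exact gradPair_eq_of_hasMFDerivAt (hf.hasMFDerivAt.mul hf'.hasMFDerivAt) g

theorem gradPair_comp {Φ : ℝ → ℝ} {c : ℝ} (hΦ : HasDerivAt Φ c (f x))
    (hf : MDifferentiableAt (𝓡∂ 3) 𝓘(ℝ, ℝ) f x) :
    gradPair (fun x ↦ Φ (f x)) g x = c * gradPair f g x := by
  rw [gradPair_eq_mfderiv f]
  exact (gradPair_eq_of_hasMFDerivAt (HasMFDerivAt.comp x hΦ.hasFDerivAt.hasMFDerivAt
    hf.hasMFDerivAt) g).trans (mul_comm (G := ℝ) _ _)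

theorem gradPair_add (hf : MDifferentiableAt (𝓡∂ 3) 𝓘(ℝ, ℝ) f x)
    (hf' : MDifferentiableAt (𝓡∂ 3) 𝓘(ℝ, ℝ) f' x) :
    gradPair (fun x ↦ f x + f' x) g x = gradPair f g x + gradPair f' g x := by
  rw [gradPair_eq_mfderiv f, gradPair_eq_mfderiv f']
  exact gradPair_eq_of_hasMFDerivAt (hf.hasMFDerivAt.add hf'.hasMFDerivAt) g

theorem gradPair_sum {ι : Type*} {t : Finset ι} {f : ι → M → ℝ}
    (hf : ∀ i ∈ t, MDifferentiableAt (𝓡∂ 3) 𝓘(ℝ, ℝ) (f i) x) (g : M → ℝ) :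
    gradPair (fun x ↦ ∑ i ∈ t, f i x) g x = ∑ i ∈ t, gradPair (f i) g x := by
  classical
  suffices MDifferentiableAt (𝓡∂ 3) 𝓘(ℝ, ℝ) (fun x ↦ ∑ i ∈ t, f i x) x ∧
      gradPair (fun x ↦ ∑ i ∈ t, f i x) g x = ∑ i ∈ t, gradPair (f i) g x from this.2
  induction t using Finset.induction_on with
  | empty =>
    exact ⟨mdifferentiableAt_const, gradPair_eq_of_hasMFDerivAt (hasMFDerivAt_const 0 x) g⟩
  | insert i t hi ih =>
    obtain ⟨hdiff, hsum⟩ := ih fun j hj ↦ hf j (Finset.mem_insert_of_mem hj)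
    have hfi := hf i (Finset.mem_insert_self i t)
    simp only [Finset.sum_insert hi]
    exact ⟨hfi.add hdiff, by rw [gradPair_add hfi hdiff, hsum]⟩

theorem gradPair_congr (h : f =ᶠ[𝓝 x] f') : gradPair f g x = gradPair f' g x := by
  simp only [gradPair_eq_mfderiv]
  rw [h.mfderiv_eq]
  rfl

theorem gradPair_eq_zero_of_notMem_tsupport (h : x ∉ tsupport f) : gradPair f g x = 0 :=
  (gradPair_congr (notMem_tsupport_iff_eventuallyEq.1 h)).trans
    (gradPair_eq_of_hasMFDerivAt (hasMFDerivAt_const 0 x) g)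

theorem inner_riemGradient_chartDeriv {y : E3} (hy : y ∈ chartDom p)
    (hf : MDifferentiableAt (𝓡∂ 3) 𝓘(ℝ, ℝ) f (chartParam p y)) (i : Fin 3) :
    inner ℝ (riemGradient f (chartParam p y)) (chartDeriv (𝓡∂ 3) p y (stdVec i)) =
      chartPartial p f i y :=
  (inner_riemGradient f _ _).trans (mfderiv_chartDeriv hy hf _)

theorem gradPair_chartParam {y : E3} (hy : y ∈ chartDom p)
    (hf : MDifferentiableAt (𝓡∂ 3) 𝓘(ℝ, ℝ) f (chartParam p y))
    (hg : MDifferentiableAt (𝓡∂ 3) 𝓘(ℝ, ℝ) g (chartParam p y)) :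
    gradPair f g (chartParam p y) = ∑ i, ∑ j, chartPartial p f i y * (chartMetric p y)⁻¹ i j *
      chartPartial p g j y := by
  have hsum := inner_eq_sum_gram_inv (D := chartDeriv (𝓡∂ 3) p y)
    (isInvertible_mfderivWithin_extChartAt_symm hy).surjective
    (chartMetric_det_pos hy).ne' (fun _ _ ↦ rfl)
    (riemGradient f (chartParam p y)) (riemGradient g (chartParam p y))
  refine hsum.trans (Finset.sum_congr rfl fun i _ ↦ Finset.sum_congr rfl fun j _ ↦ ?_)
  exact congrArg₂ (fun a b ↦ a * (chartMetric p y)⁻¹ i j * b)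
    (inner_riemGradient_chartDeriv hy hf i) (inner_riemGradient_chartDeriv hy hg j)

variable [IsContMDiffRiemannianBundle (𝓡∂ 3) ∞ E3 (fun x : M ↦ TangentSpace (𝓡∂ 3) x)]

theorem contMDiff_gradPair {m : ℕ∞} (hf : ContMDiff (𝓡∂ 3) 𝓘(ℝ, ℝ) (m + 1) f)
    (hg : ContMDiff (𝓡∂ 3) 𝓘(ℝ, ℝ) (m + 1) g) :
    ContMDiff (𝓡∂ 3) 𝓘(ℝ, ℝ) m (gradPair f g) := by
  have hm : (m : WithTop ℕ∞) ≤ ∞ := mod_cast le_top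
  have hm0 : (m : WithTop ℕ∞) + 1 ≠ 0 := (zero_lt_one.trans_le le_add_self).ne'
  refine contMDiff_of_chartParam hm fun p ↦ ContDiffOn.congr
    (f := fun y ↦ ∑ i, ∑ j, chartPartial p f i y * (chartMetric p y)⁻¹ i j * chartPartial p g j y)
    (ContDiffOn.sum fun i _ ↦ ContDiffOn.sum fun j _ ↦ ?_) fun y hy ↦
      gradPair_chartParam hy (hf.mdifferentiable hm0 _) (hg.mdifferentiable hm0 _)
  exact ((contDiffOn_chartPartial hf p i).mul ((contDiffOn_chartMetric_inv p i j).of_le hm)).mul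
    (contDiffOn_chartPartial hg p j)

theorem continuous_gradPair (hf : ContMDiff (𝓡∂ 3) 𝓘(ℝ, ℝ) 1 f)
    (hg : ContMDiff (𝓡∂ 3) 𝓘(ℝ, ℝ) 1 g) : Continuous (gradPair f g) :=
  (contMDiff_gradPair (m := 0) (by simpa using hf) (by simpa using hg)).continuous

end GradPair

section Divergence

variable {E : Type*} [NormedAddCommGroup E] [NormedSpace ℝ E] {F : E → ℝ} {K O : Set E}

theorem contDiff_indicator_of_eq_zero {k : WithTop ℕ∞} (hO : IsOpen O) (hK : IsClosed K)
    (hKO : K ⊆ O) (hF : ContDiffOn ℝ k F O) (hzero : ∀ y ∈ O \ K, F y = 0) :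
    ContDiff ℝ k (O.indicator F) := by
  refine contDiff_iff_contDiffAt.2 fun y ↦ ?_
  by_cases hy : y ∈ K
  · refine (hF.contDiffAt (hO.mem_nhds (hKO hy))).congr_of_eventuallyEq ?_
    filter_upwards [hO.mem_nhds (hKO hy)] with z hz using indicator_of_mem hz F
  · refine contDiffAt_const (c := (0 : ℝ)) |>.congr_of_eventuallyEq ?_
    filter_upwards [hK.isOpen_compl.mem_nhds hy] with z hz
    exact indicator_apply_eq_zero.2 fun hzO ↦ hzero z ⟨hzO, hz⟩

variable [FiniteDimensional ℝ E] [MeasurableSpace E] [BorelSpace E] {μ : Measure E}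
  [μ.IsAddHaarMeasure]

theorem integrable_fderiv_and_integral_eq_zero (hF : ContDiff ℝ 1 F) (hFc : HasCompactSupport F)
    (v : E) : Integrable (fun y ↦ fderiv ℝ F y v) μ ∧ ∫ y, fderiv ℝ F y v ∂μ = 0 := by
  have hint : Integrable (fun y ↦ fderiv ℝ F y v) μ :=
    ((hF.continuous_fderiv one_ne_zero).clm_apply
      continuous_const).integrable_of_hasCompactSupport (hFc.fderiv_apply ℝ v)
  have hparts := integral_bilinear_hasLineDerivAt_right_eq_neg_left_of_integrable (μ := μ)
    (f := fun _ ↦ (1 : ℝ)) (f' := 0) (g := F) (g' := fun y ↦ fderiv ℝ F y v) (v := v)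
    (B := ContinuousLinearMap.mul ℝ ℝ) (by simp) (by simpa using hint)
    (by simpa using hF.continuous.integrable_of_hasCompactSupport hFc)
    (fun y _ ↦ by simpa using! (hasFDerivAt_const (1 : ℝ) y).hasLineDerivAt v)
    (fun y _ ↦ (hF.differentiable one_ne_zero y).hasFDerivAt.hasLineDerivAt v)
  exact ⟨hint, by simpa using hparts⟩

theorem integrableOn_fderiv_and_setIntegral_eq_zero (hO : IsOpen O) (hK : IsCompact K)
    (hKO : K ⊆ O) (hF : ContDiffOn ℝ 1 F O) (hzero : ∀ y ∈ O \ K, F y = 0) (v : E) :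
    IntegrableOn (fun y ↦ fderiv ℝ F y v) O μ ∧ ∫ y in O, fderiv ℝ F y v ∂μ = 0 := by
  have hcongr : EqOn (fun y ↦ fderiv ℝ (O.indicator F) y v) (fun y ↦ fderiv ℝ F y v) O :=
    fun y hy ↦ by
      have heq : O.indicator F =ᶠ[𝓝 y] F := by
        filter_upwards [hO.mem_nhds hy] with z hz using indicator_of_mem hz F
      simp only [heq.fderiv_eq]
  have hsupp : ∀ y ∉ K, O.indicator F y = 0 := fun y hy ↦
    indicator_apply_eq_zero.2 fun hyO ↦ hzero y ⟨hyO, hy⟩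
  have hout : ∀ y ∉ O, fderiv ℝ (O.indicator F) y v = 0 := fun y hy ↦ by
    have heq : O.indicator F =ᶠ[𝓝 y] fun _ ↦ 0 := by
      filter_upwards [hK.isClosed.isOpen_compl.mem_nhds fun hyK ↦ hy (hKO hyK)] with z hz
        using hsupp z hz
    rw [heq.fderiv_eq, fderiv_const_apply]
    rfl
  obtain ⟨hint, hzero⟩ := integrable_fderiv_and_integral_eq_zero (μ := μ)
    (contDiff_indicator_of_eq_zero hO hK.isClosed hKO hF hzero) (HasCompactSupport.intro hK hsupp) v
  refine ⟨hint.integrableOn.congr_fun hcongr hO.measurableSet, ?_⟩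
  rw [← setIntegral_congr_fun hO.measurableSet hcongr,
    setIntegral_eq_integral_of_forall_compl_eq_zero hout, hzero]

end Divergence

section HarmonicFlux

variable {M : Type*} [MetricSpace M] [ChartedSpace (EuclideanHalfSpace 3) M]
  [RiemannianBundle (fun x : M ↦ TangentSpace (𝓡∂ 3) x)] {p : M} {y : E3} {f u : M → ℝ}

/-- The components of the vector density `√(det g) ∇u` in the preferred chart at `p`. -/
noncomputable def fluxField (p : M) (u : M → ℝ) (i : Fin 3) (y : E3) : ℝ :=
  chartDensity p y * ∑ j, (chartMetric p y)⁻¹ i j * chartPartial p u j y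

variable [IsManifold (𝓡∂ 3) ∞ M]

theorem chartDensity_mul_gradPair (hy : y ∈ chartDom p)
    (hf : MDifferentiableAt (𝓡∂ 3) 𝓘(ℝ, ℝ) f (chartParam p y))
    (hu : MDifferentiableAt (𝓡∂ 3) 𝓘(ℝ, ℝ) u (chartParam p y)) :
    chartDensity p y * gradPair f u (chartParam p y) =
      ∑ i, fluxField p u i y * chartPartial p f i y := by
  simp only [gradPair_chartParam hy hf hu, fluxField, Finset.mul_sum, Finset.sum_mul]
  exact Finset.sum_congr rfl fun i _ ↦ Finset.sum_congr rfl fun j _ ↦ by ring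

theorem sum_fderivWithin_fluxField (hu : IsHarmonic u) (hy : y ∈ chartDom p) :
    ∑ i, fderivWithin ℝ (fluxField p u i) halfSpace3 y (stdVec i) = 0 := by
  have hlap := hu.2 (chartAt (EuclideanHalfSpace 3) p) (IsManifold.chart_mem_maximalAtlas p)
    (chartParam p y) (extChartAt_symm_mem_chartAt_source hy)
  have hright : (chartAt (EuclideanHalfSpace 3) p).extend (𝓡∂ 3) (chartParam p y) = y :=
    (extChartAt (𝓡∂ 3) p).right_inv hy
  rw [hright, coordLaplacian] at hlap
  exact (mul_eq_zero.1 hlap).resolve_left (inv_ne_zero (chartDensity_pos hy).ne')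

variable [IsContMDiffRiemannianBundle (𝓡∂ 3) ∞ E3 (fun x : M ↦ TangentSpace (𝓡∂ 3) x)]

theorem contDiffOn_fluxField (hu : ContMDiff (𝓡∂ 3) 𝓘(ℝ, ℝ) 2 u) (p : M) (i : Fin 3) :
    ContDiffOn ℝ 1 (fluxField p u i) (chartDom p) :=
  ((contDiffOn_chartDensity p).of_le (by simp)).mul <| ContDiffOn.sum fun j _ ↦
    ((contDiffOn_chartMetric_inv p i j).of_le (by simp)).mul
      (contDiffOn_chartPartial (m := 1) (by exact hu) p j)

theorem sum_fderiv_fluxField_mul (hu : IsHarmonic u) (hf : ContMDiff (𝓡∂ 3) 𝓘(ℝ, ℝ) 1 f)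
    (hy : y ∈ interior (chartDom p)) :
    ∑ i, fderiv ℝ (fun z ↦ fluxField p u i z * f (chartParam p z)) y (stdVec i) =
      chartDensity p y * gradPair f u (chartParam p y) := by
  have hdom : chartDom p ∈ 𝓝 y := mem_interior_iff_mem_nhds.1 hy
  have hhalf : halfSpace3 ∈ 𝓝 y := mem_of_superset hdom (chartDom_subset p)
  have hfd : DifferentiableAt ℝ (f ∘ chartParam p) y :=
    ((contDiffOn_comp_chartParam (by simp) hf p).contDiffAt hdom).differentiableAt one_ne_zero
  have hterm : ∀ i, fderiv ℝ (fun z ↦ fluxField p u i z * f (chartParam p z)) y (stdVec i) =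
      fluxField p u i y * chartPartial p f i y +
        f (chartParam p y) * fderivWithin ℝ (fluxField p u i) halfSpace3 y (stdVec i) := by
    intro i
    rw [chartPartial, fderivWithin_of_mem_nhds hhalf, fderivWithin_of_mem_nhds hhalf]
    exact congrArg (fun L : E3 →L[ℝ] ℝ ↦ L (stdVec i)) <| fderiv_fun_mul
      (((contDiffOn_fluxField hu.1 p i).contDiffAt hdom).differentiableAt one_ne_zero) hfd
  rw [chartDensity_mul_gradPair (interior_subset hy) (hf.mdifferentiable one_ne_zero _)
    (hu.1.mdifferentiable two_ne_zero _)]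
  simp only [hterm, Finset.sum_add_distrib, ← Finset.mul_sum,
    sum_fderivWithin_fluxField hu (interior_subset hy), mul_zero, add_zero]

end HarmonicFlux

section Volume

theorem volume_ne_zero_of_mem_nhdsWithin_halfSpace3 {y : E3} (hy : y ∈ halfSpace3) {s : Set E3}
    (hs : s ∈ 𝓝[halfSpace3] y) : volume s ≠ 0 := by
  obtain ⟨O, hO, hyO, hOs⟩ := mem_nhdsWithin.1 hs
  have hpos := (hO.inter isOpen_interior).measure_pos volume
    (mem_closure_iff.1 ((𝓡∂ 3).range_subset_closure_interior hy) O hO hyO)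
  exact (hpos.trans_le (measure_mono ((inter_subset_inter_right O interior_subset).trans hOs))).ne'

variable {M : Type*} [MetricSpace M] [ChartedSpace (EuclideanHalfSpace 3) M]
  [IsManifold (𝓡∂ 3) ∞ M] [RiemannianBundle (fun x : M ↦ TangentSpace (𝓡∂ 3) x)]
  [IsContMDiffRiemannianBundle (𝓡∂ 3) ∞ E3 (fun x : M ↦ TangentSpace (𝓡∂ 3) x)]

instance isContinuousRiemannianBundle_tangentSpace :
    IsContinuousRiemannianBundle E3 (fun x : M ↦ TangentSpace (𝓡∂ 3) x) := by
  obtain ⟨g, hg, hinner⟩ := IsContMDiffRiemannianBundle.exists_contMDiff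
    (IB := 𝓡∂ 3) (n := ∞) (F := E3) (E := fun x : M ↦ TangentSpace (𝓡∂ 3) x)
  exact ⟨g, hg.continuous, hinner⟩

variable [IsRiemannianManifold (𝓡∂ 3) M]

theorem hasMetricJacobian_chartParam (p : M) :
    HasMetricJacobian (chartParam p) (chartDom p) (chartDensity p) where
  measurableSet := measurableSet_chartDom p
  injOn := (extChartAt (𝓡∂ 3) p).symm.injOn
  continuousOn_jacobian := (contDiffOn_chartDensity p).continuousOn
  jacobian_pos _ hy := chartDensity_pos hy
  exists_deriv y hy := by
    obtain ⟨A, hdet, hA⟩ := exists_abs_det_eq_chartDensity hy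
    exact ⟨A, hdet, ((hasMetricDerivWithinAt_extChartAt_symm hy).mono
      (chartDom_subset p)).congr_norm hA⟩

variable [MeasurableSpace M] [BorelSpace M]

theorem setIntegral_chart (p : M) (g : M → ℝ) :
    ∫ x in (extChartAt (𝓡∂ 3) p).source, g x ∂μHE[3] =
      ∫ y in chartDom p, chartDensity p y * g (chartParam p y) := by
  rw [← chartParam_image, (hasMetricJacobian_chartParam p).integral_image]

instance isLocallyFiniteMeasure_euclideanHausdorffMeasure :
    IsLocallyFiniteMeasure (μHE[3] : Measure M) := by
  refine ⟨fun p ↦ ?_⟩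
  have hy : extChartAt (𝓡∂ 3) p p ∈ chartDom p := mem_extChartAt_target p
  obtain ⟨s, hs, hint⟩ := (contDiffOn_chartDensity p).continuousOn.integrableAt_nhdsWithin
    (μ := volume) (measurableSet_chartDom p) hy
  obtain ⟨O, hO, hyO, hOs⟩ := mem_nhdsWithin.1 hs
  refine ⟨chartParam p '' (O ∩ chartDom p), ?_, ?_⟩
  · rw [← map_extChartAt_symm_nhdsWithin_range (I := 𝓡∂ 3) p]
    exact image_mem_map (inter_mem (mem_nhdsWithin_of_mem_nhds (hO.mem_nhds hyO))
      (chartDom_mem_nhdsWithin hy))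
  · rw [(hasMetricJacobian_chartParam p).measure_image
      (hO.measurableSet.inter (measurableSet_chartDom p)) inter_subset_right]
    exact (hint.mono_set hOs).lintegral_lt_top

instance isOpenPosMeasure_euclideanHausdorffMeasure :
    Measure.IsOpenPosMeasure (μHE[3] : Measure M) := by
  refine ⟨fun U hU ⟨p, hp⟩ hzero ↦ ?_⟩
  have hjac := hasMetricJacobian_chartParam p
  have hy : extChartAt (𝓡∂ 3) p p ∈ chartDom p := mem_extChartAt_target p
  have hB : MeasurableSet (chartParam p ⁻¹' U ∩ chartDom p) := by
    obtain ⟨O, hO, hOB⟩ := continuousOn_iff'.1 hjac.continuousOn U hU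
    exact hOB.symm ▸ hO.measurableSet.inter (measurableSet_chartDom p)
  have hBy : chartParam p ⁻¹' U ∩ chartDom p ∈ 𝓝[halfSpace3] extChartAt (𝓡∂ 3) p p :=
    inter_mem (by
      rw [← Filter.mem_map, map_extChartAt_symm_nhdsWithin_range]
      exact hU.mem_nhds hp) (chartDom_mem_nhdsWithin hy)
  have hlintegral :
      ∫⁻ y in chartParam p ⁻¹' U ∩ chartDom p, ENNReal.ofReal (chartDensity p y) = 0 := by
    rw [← hjac.measure_image hB inter_subset_right]
    exact measure_mono_null (image_subset_iff.2 inter_subset_left) hzero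
  have hae := (setLIntegral_eq_zero_iff' hB
    ((hjac.continuousOn_jacobian.mono inter_subset_right).aemeasurable
      hB).ennreal_ofReal).1 hlintegral
  refine volume_ne_zero_of_mem_nhdsWithin_halfSpace3 (chartDom_subset p hy) hBy
    (measure_mono_null (fun y hyB ↦ ?_) (ae_iff.1 hae))
  exact fun hy0 ↦ (ENNReal.ofReal_pos.2 (chartDensity_pos hyB.2)).ne' (hy0 hyB)

theorem integrable_gradPair {f g : M → ℝ} (hf : ContMDiff (𝓡∂ 3) 𝓘(ℝ, ℝ) 1 f)
    (hfc : HasCompactSupport f) (hg : ContMDiff (𝓡∂ 3) 𝓘(ℝ, ℝ) 1 g) :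
    Integrable (gradPair f g) μHE[3] :=
  (continuous_gradPair hf hg).integrable_of_hasCompactSupport
    (HasCompactSupport.intro hfc fun _ hx ↦ gradPair_eq_zero_of_notMem_tsupport hx)

end Volume

section WeakHarmonicity

variable {M : Type*} [MetricSpace M] [ChartedSpace (EuclideanHalfSpace 3) M]
  [IsManifold (𝓡∂ 3) ∞ M]

theorem exists_finite_partition_of_unity {K : Set M} (hK : IsCompact K) {U : M → Set M}
    (hU : ∀ p ∈ K, U p ∈ 𝓝 p) :
    ∃ (t : Finset M) (ρ : M → M → ℝ), (∀ p ∈ t, p ∈ K ∧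
      ContMDiff (𝓡∂ 3) 𝓘(ℝ, ℝ) ∞ (ρ p) ∧ tsupport (ρ p) ⊆ U p) ∧
      ∀ x ∈ K, ∑ p ∈ t, ρ p x = 1 := by
  have hbump : ∀ p ∈ K, ∃ ψ : M → ℝ, ContMDiff (𝓡∂ 3) 𝓘(ℝ, ℝ) ∞ ψ ∧ tsupport ψ ⊆ U p ∧
      ψ ⁻¹' {1} ∈ 𝓝 p := fun p hp ↦
    let ⟨ψ, _, hψ⟩ := (SmoothBumpFunction.nhds_basis_tsupport (I := 𝓡∂ 3) p).mem_iff.1 (hU p hp)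
    ⟨ψ, ψ.contMDiff, hψ, ψ.eventuallyEq_one⟩
  choose! ψ hψ_smooth hψU hψ_one using hbump
  obtain ⟨t, htK, ht⟩ := hK.elim_nhds_subcover _ hψ_one
  let _ : LinearOrder M := IsWellOrder.linearOrder WellOrderingRel
  refine ⟨t, fun p x ↦ ψ p x * ∏ q ∈ t with q < p, (1 - ψ q x), fun p hp ↦ ⟨htK p hp, ?_, ?_⟩,
    fun x hx ↦ ?_⟩
  · exact (hψ_smooth p (htK p hp)).mul <| contMDiff_finsetProd fun q hq ↦
      contMDiff_const.sub (hψ_smooth q (htK q (Finset.mem_filter.1 hq).1))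
  · exact tsupport_mul_subset_left.trans (hψU p (htK p hp))
  · obtain ⟨p, hp, hpx⟩ := mem_iUnion₂.1 (ht hx)
    have hprod : ∏ p ∈ t, (1 - ψ p x) = 0 := Finset.prod_eq_zero hp (sub_eq_zero.2 hpx.symm)
    rw [Finset.prod_one_sub_ordered] at hprod
    exact (sub_eq_zero.1 hprod).symm

variable [RiemannianBundle (fun x : M ↦ TangentSpace (𝓡∂ 3) x)]
  [IsContMDiffRiemannianBundle (𝓡∂ 3) ∞ E3 (fun x : M ↦ TangentSpace (𝓡∂ 3) x)]
  [IsRiemannianManifold (𝓡∂ 3) M] [MeasurableSpace M] [BorelSpace M] {u ζ : M → ℝ}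

theorem integral_gradPair_eq_zero_of_chart (hu : IsHarmonic u)
    (hζ : ContMDiff (𝓡∂ 3) 𝓘(ℝ, ℝ) 1 ζ) (hζc : HasCompactSupport ζ) {p : M}
    (hsupp : tsupport ζ ⊆ (extChartAt (𝓡∂ 3) p).source)
    (hbd : Disjoint (tsupport ζ) ((𝓡∂ 3).boundary M)) :
    ∫ x, gradPair ζ u x ∂μHE[3] = 0 := by
  set K : Set E3 := extChartAt (𝓡∂ 3) p '' tsupport ζ
  set O : Set E3 := interior (chartDom p)
  have hK : IsCompact K := hζc.isCompact.image_of_continuousOn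
    ((continuousOn_extChartAt p).mono hsupp)
  have hKO : K ⊆ O := image_subset_iff.2 fun x hx ↦
    mem_interior_chartDom (hsupp hx) (disjoint_left.1 hbd hx)
  have hnotMem : ∀ y ∈ chartDom p, y ∉ K → chartParam p y ∉ tsupport ζ := fun y hy hyK hmem ↦
    hyK ⟨_, hmem, (extChartAt (𝓡∂ 3) p).right_inv hy⟩
  have hdiv := fun i ↦ integrableOn_fderiv_and_setIntegral_eq_zero (μ := volume)
    (F := fun z ↦ fluxField p u i z * ζ (chartParam p z)) isOpen_interior hK
    hKO (((contDiffOn_fluxField hu.1 p i).mul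
      (contDiffOn_comp_chartParam (f := ζ) (by simp) hζ p)).mono interior_subset)
    (fun y hy ↦ mul_eq_zero_of_right _
      (image_eq_zero_of_notMem_tsupport (f := ζ) (hnotMem y (interior_subset hy.1) hy.2)))
    (stdVec i)
  calc ∫ x, gradPair ζ u x ∂μHE[3]
      = ∫ x in (extChartAt (𝓡∂ 3) p).source, gradPair ζ u x ∂μHE[3] :=
        (setIntegral_eq_integral_of_forall_compl_eq_zero fun x hx ↦
          gradPair_eq_zero_of_notMem_tsupport fun hmem ↦ hx (hsupp hmem)).symm
    _ = ∫ y in chartDom p, chartDensity p y * gradPair ζ u (chartParam p y) :=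
        setIntegral_chart p _
    _ = ∫ y in O, chartDensity p y * gradPair ζ u (chartParam p y) :=
        setIntegral_eq_of_subset_of_forall_sdiff_eq_zero
          (f := fun y ↦ chartDensity p y * gradPair ζ u (chartParam p y))
          (measurableSet_chartDom p) interior_subset fun y hy ↦ mul_eq_zero_of_right _ <|
          gradPair_eq_zero_of_notMem_tsupport <| hnotMem y hy.1 (notMem_subset hKO hy.2)
    _ = ∫ y in O, ∑ i, fderiv ℝ (fun z ↦ fluxField p u i z * ζ (chartParam p z)) y (stdVec i) :=
        setIntegral_congr_fun isOpen_interior.measurableSet fun y hy ↦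
          (sum_fderiv_fluxField_mul hu hζ hy).symm
    _ = 0 := by
        rw [integral_finsetSum _ fun i _ ↦ (hdiv i).1]
        exact Finset.sum_eq_zero fun i _ ↦ (hdiv i).2

theorem integral_gradPair_eq_zero (hu : IsHarmonic u) (hζ : ContMDiff (𝓡∂ 3) 𝓘(ℝ, ℝ) 1 ζ)
    (hζc : HasCompactSupport ζ) (hbd : Disjoint (tsupport ζ) ((𝓡∂ 3).boundary M)) :
    ∫ x, gradPair ζ u x ∂μHE[3] = 0 := by
  obtain ⟨t, ρ, hρ, hρ_sum⟩ := exists_finite_partition_of_unity hζc.isCompact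
    (U := fun p ↦ (extChartAt (𝓡∂ 3) p).source) fun p _ ↦ extChartAt_source_mem_nhds p
  have hsplit : ζ = fun x ↦ ∑ p ∈ t, ρ p x * ζ x := by
    ext x
    by_cases hx : x ∈ tsupport ζ
    · rw [← Finset.sum_mul, hρ_sum x hx, one_mul]
    · simp only [image_eq_zero_of_notMem_tsupport hx, mul_zero, Finset.sum_const_zero]
  have hsmooth : ∀ p ∈ t, ContMDiff (𝓡∂ 3) 𝓘(ℝ, ℝ) 1 fun x ↦ ρ p x * ζ x := fun p hp ↦
    ((hρ p hp).2.1.of_le (by simp)).mul hζ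
  have hgrad : gradPair ζ u = fun x ↦ ∑ p ∈ t, gradPair (fun x ↦ ρ p x * ζ x) u x := by
    ext x
    conv_lhs => rw [hsplit]
    exact gradPair_sum (fun p hp ↦ (hsmooth p hp).mdifferentiable one_ne_zero x) u
  rw [hgrad, integral_finsetSum _ fun p hp ↦
    integrable_gradPair (hsmooth p hp) hζc.mul_left (hu.1.of_le one_le_two)]
  exact Finset.sum_eq_zero fun p hp ↦ integral_gradPair_eq_zero_of_chart hu (hsmooth p hp)
    hζc.mul_left (tsupport_mul_subset_left.trans (hρ p hp).2.2)
    (hbd.mono_left tsupport_mul_subset_right)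

end WeakHarmonicity

section MaximumPrinciple

theorem isCompact_preimage_of_tendsto_cocompact {X Y : Type*} [TopologicalSpace X]
    [TopologicalSpace Y] {f : X → Y} {b : Y} {s : Set Y} (hf : Continuous f)
    (hlim : Tendsto f (cocompact X) (𝓝 b)) (hs : IsClosed s) (hb : b ∉ s) :
    IsCompact (f ⁻¹' s) := by
  obtain ⟨K, hK, hKs⟩ := mem_cocompact.1 (hlim (hs.isOpen_compl.mem_nhds hb))
  exact hK.of_isClosed_subset (hs.preimage hf) (compl_subset_compl.1 hKs)

theorem hasDerivAt_intervalIntegral {φ : ℝ → ℝ} (hφ : Continuous φ) (a s : ℝ) :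
    HasDerivAt (fun s ↦ ∫ r in a..s, φ r) (φ s) s :=
  intervalIntegral.integral_hasDerivAt_right (hφ.intervalIntegrable _ _)
    hφ.aestronglyMeasurable.stronglyMeasurableAtFilter hφ.continuousAt

theorem contDiff_one_intervalIntegral {φ : ℝ → ℝ} (hφ : Continuous φ) (a : ℝ) :
    ContDiff ℝ 1 fun s ↦ ∫ r in a..s, φ r := by
  refine contDiff_one_iff_deriv.2
    ⟨fun s ↦ (hasDerivAt_intervalIntegral hφ a s).differentiableAt, ?_⟩
  rwa [funext fun s ↦ (hasDerivAt_intervalIntegral hφ a s).deriv]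

variable {M : Type*} [MetricSpace M] [ChartedSpace (EuclideanHalfSpace 3) M]
  [IsManifold (𝓡∂ 3) ∞ M] [RiemannianBundle (fun x : M ↦ TangentSpace (𝓡∂ 3) x)]
  {u : M → ℝ} {x p : M}

theorem gradPair_self_eq_zero_of_fderivWithin_eq_zero
    (hu : MDifferentiableAt (𝓡∂ 3) 𝓘(ℝ, ℝ) u p)
    (hzero : fderivWithin ℝ (u ∘ chartParam p) halfSpace3 (extChartAt (𝓡∂ 3) p p) = 0) :
    gradPair u u p = 0 := by
  have hparam : chartParam p (extChartAt (𝓡∂ 3) p p) = p := extChartAt_to_inv p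
  have hgrad := gradPair_chartParam (f := u) (g := u) (mem_extChartAt_target (I := 𝓡∂ 3) p)
    (by rwa [hparam]) (by rwa [hparam])
  rw [hparam] at hgrad
  rw [hgrad]
  simp only [chartPartial, hzero, zero_apply, mul_zero, Finset.sum_const_zero]

variable [IsContMDiffRiemannianBundle (𝓡∂ 3) ∞ E3 (fun x : M ↦ TangentSpace (𝓡∂ 3) x)]
  [IsRiemannianManifold (𝓡∂ 3) M] [MeasurableSpace M] [BorelSpace M]

theorem deriv_mul_gradPair_self_eq_zero (hu : IsHarmonic u) {Φ : ℝ → ℝ} (hΦ : ContDiff ℝ 1 Φ)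
    (hmono : Monotone Φ) (hc : HasCompactSupport (Φ ∘ u))
    (hbd : Disjoint (tsupport (Φ ∘ u)) ((𝓡∂ 3).boundary M)) (x : M) :
    deriv Φ (u x) * gradPair u u x = 0 := by
  have hu₁ : ContMDiff (𝓡∂ 3) 𝓘(ℝ, ℝ) 1 u := hu.1.of_le one_le_two
  have hΦu : ContMDiff (𝓡∂ 3) 𝓘(ℝ, ℝ) 1 (Φ ∘ u) := hΦ.contMDiff.comp hu₁
  have hgrad : ∀ x, gradPair (Φ ∘ u) u x = deriv Φ (u x) * gradPair u u x := fun x ↦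
    gradPair_comp (hΦ.differentiable one_ne_zero _).hasDerivAt (hu₁.mdifferentiable one_ne_zero x)
  rw [← hgrad]
  by_contra hne
  refine (Continuous.integral_pos_of_hasCompactSupport_nonneg_nonzero (μ := μHE[3])
    (continuous_gradPair hΦu hu₁)
    (HasCompactSupport.intro hc fun x hx ↦ gradPair_eq_zero_of_notMem_tsupport hx) (fun x ↦ ?_)
    hne).ne' (integral_gradPair_eq_zero hu hΦu hc hbd)
  exact (hgrad x).symm ▸ mul_nonneg hmono.deriv_nonneg (gradPair_self_nonneg u x)

theorem gradPair_self_eq_zero_of_lt_abs_sub (hu : IsHarmonic u) {l m r : ℝ}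
    (hub : ∀ x ∈ (𝓡∂ 3).boundary M, |u x - m| ≤ r) (hinf : Tendsto u (cocompact M) (𝓝 l))
    (hl : |l - m| ≤ r) (hx : r < |u x - m|) : gradPair u u x = 0 := by
  obtain ⟨c, hrc, hcx⟩ := exists_between hx
  set φ : ℝ → ℝ := fun s ↦ max (|s - m| - c) 0
  have hφ : Continuous φ := by fun_prop
  set Φ : ℝ → ℝ := fun s ↦ ∫ t in m..s, φ t
  have hderiv : ∀ s, HasDerivAt Φ (φ s) s := hasDerivAt_intervalIntegral hφ m
  set C : Set M := u ⁻¹' {s | c ≤ |s - m|}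
  have hC : IsCompact C := isCompact_preimage_of_tendsto_cocompact hu.1.continuous hinf
    (isClosed_le continuous_const (by fun_prop)) (hl.trans_lt hrc).not_ge
  have hsupp : ∀ y ∉ C, (Φ ∘ u) y = 0 := fun y hy ↦
    intervalIntegral.integral_zero_ae <| Eventually.of_forall fun t ht ↦ max_eq_right <|
      sub_nonpos.2 <| (abs_sub_left_of_mem_uIcc (uIoc_subset_uIcc ht)).trans (not_le.1 hy).le
  have htsupp : tsupport (Φ ∘ u) ⊆ C :=
    closure_minimal (fun y hy ↦ not_not.1 fun h ↦ hy (hsupp y h)) hC.isClosed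
  have hzero := deriv_mul_gradPair_self_eq_zero hu (contDiff_one_intervalIntegral hφ m)
    (monotone_of_deriv_nonneg (fun s ↦ (hderiv s).differentiableAt)
      fun s ↦ (hderiv s).deriv.symm ▸ le_max_right _ _)
    (HasCompactSupport.intro hC hsupp)
    (disjoint_left.2 fun y hy hyb ↦ ((hub y hyb).trans_lt hrc).not_ge (htsupp hy)) x
  rw [(hderiv _).deriv] at hzero
  exact (mul_eq_zero.1 hzero).resolve_left (lt_max_of_lt_left (sub_pos.2 hcx)).ne'

theorem mem_Icc_of_gradPair_self_ne_zero (hu : IsHarmonic u)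
    (hub : ∀ x ∈ (𝓡∂ 3).boundary M, u x = 1) (hinf : Tendsto u (cocompact M) (𝓝 0))
    (hx : gradPair u u x ≠ 0) : u x ∈ Icc 0 1 := by
  have habs : |u x - 1 / 2| ≤ 1 / 2 := not_lt.1 fun h ↦ hx <|
    gradPair_self_eq_zero_of_lt_abs_sub hu (fun y hy ↦ by rw [hub y hy]; norm_num [abs_of_pos]) hinf
      (by norm_num [abs_of_neg]) h
  constructor <;> linarith [abs_le.1 habs]

theorem isLocalMaxOn_comp_chartParam (hu : IsHarmonic u)
    (hub : ∀ x ∈ (𝓡∂ 3).boundary M, u x = 1) (hinf : Tendsto u (cocompact M) (𝓝 0))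
    (hp : gradPair u u p ≠ 0) (hone : u p = 1) :
    IsLocalMaxOn (u ∘ chartParam p) halfSpace3 (extChartAt (𝓡∂ 3) p p) := by
  have hu₁ : ContMDiff (𝓡∂ 3) 𝓘(ℝ, ℝ) 1 u := hu.1.of_le one_le_two
  have hregular : ∀ᶠ x in 𝓝 p, u x ≤ u p :=
    ((continuous_gradPair hu₁ hu₁).continuousAt.eventually_ne hp).mono fun x hx ↦
      (mem_Icc_of_gradPair_self_ne_zero hu hub hinf hx).2.trans_eq hone.symm
  rw [← map_extChartAt_symm_nhdsWithin_range (I := 𝓡∂ 3) p, eventually_map] at hregular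
  filter_upwards [hregular] with y hy
  exact hy.trans_eq (congrArg u (extChartAt_to_inv p).symm)

theorem lt_one_of_gradPair_self_ne_zero (hu : IsHarmonic u)
    (hub : ∀ x ∈ (𝓡∂ 3).boundary M, u x = 1) (hinf : Tendsto u (cocompact M) (𝓝 0))
    (hp : gradPair u u p ≠ 0) (hpb : p ∉ (𝓡∂ 3).boundary M) : u p < 1 := by
  refine (mem_Icc_of_gradPair_self_ne_zero hu hub hinf hp).2.lt_of_ne fun hone ↦ hp <|
    gradPair_self_eq_zero_of_fderivWithin_eq_zero (hu.1.mdifferentiable two_ne_zero p) ?_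
  have hhalf : halfSpace3 ∈ 𝓝 (extChartAt (𝓡∂ 3) p p) := mem_of_superset
    (mem_interior_iff_mem_nhds.1 (mem_interior_chartDom (mem_extChartAt_source p) hpb))
    (chartDom_subset p)
  rw [fderivWithin_of_mem_nhds hhalf]
  exact ((isLocalMaxOn_comp_chartParam hu hub hinf hp hone).isLocalMax hhalf).fderiv_eq_zero

end MaximumPrinciple

section Extension

variable {E G : Type*} [NormedAddCommGroup E] [NormedSpace ℝ E] [NormedAddCommGroup G]
  [NormedSpace ℝ G]

theorem contDiffAt_one_of_isClosed_union {f : E → G} {f' : E → E →L[ℝ] G} {A B U : Set E} {a : E}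
    (hU : U ∈ 𝓝 a) (hA : IsClosed A) (hB : IsClosed B) (hAB : A ∪ B = univ)
    (hfA : ∀ y ∈ U ∩ A, HasFDerivWithinAt f (f' y) A y)
    (hfB : ∀ y ∈ U ∩ B, HasFDerivWithinAt f (f' y) B y)
    (hcA : ContinuousOn f' (U ∩ A)) (hcB : ContinuousOn f' (U ∩ B)) : ContDiffAt ℝ 1 f a := by
  refine contDiffAt_one_iff.2 ⟨f', U, hU, fun y hy ↦ ?_, fun y hy ↦ ?_⟩
  · have hcontinuous : ∀ {S : Set E}, IsClosed S → ContinuousOn f' (U ∩ S) →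
        ContinuousWithinAt f' (U ∩ S) y := fun {S} hS hc ↦ by
      by_cases hyS : y ∈ S
      · exact hc y ⟨hy, hyS⟩
      · exact continuousWithinAt_of_notMem_closure fun h ↦
          hyS (closure_minimal inter_subset_right hS h)
    rw [← inter_univ U, ← hAB, inter_union_distrib_left]
    exact (hcontinuous hA hcA).union (hcontinuous hB hcB)
  · have hderiv : ∀ {S : Set E}, IsClosed S → (∀ y ∈ U ∩ S, HasFDerivWithinAt f (f' y) S y) →
        HasFDerivWithinAt f (f' y) S y := fun {S} hS hf ↦ by
      by_cases hyS : y ∈ S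
      · exact hf y ⟨hy, hyS⟩
      · exact .of_notMem_closure (hS.closure_eq.symm ▸ hyS)
    rw [← hasFDerivWithinAt_univ, ← hAB]
    exact (hderiv hA hfA).union (hderiv hB hfB)

theorem contDiffAt_one_piecewise {f g : E → G} {f' g' : E → E →L[ℝ] G} {A B U : Set E} {a : E}
    [DecidablePred (· ∈ A)] (hU : U ∈ 𝓝 a) (hA : IsClosed A) (hB : IsClosed B)
    (hAB : A ∪ B = univ) (hf : ∀ y ∈ U ∩ A, HasFDerivWithinAt f (f' y) A y)
    (hg : ∀ y ∈ U ∩ B, HasFDerivWithinAt g (g' y) B y) (hf' : ContinuousOn f' (U ∩ A))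
    (hg' : ContinuousOn g' (U ∩ B)) (hfg : EqOn f g (A ∩ B)) (hfg' : EqOn f' g' (A ∩ B)) :
    ContDiffAt ℝ 1 (A.piecewise f g) a := by
  have heq : EqOn (A.piecewise f g) g B := fun y hy ↦ by
    by_cases hyA : y ∈ A
    · rw [piecewise_eq_of_mem _ _ _ hyA, hfg ⟨hyA, hy⟩]
    · exact piecewise_eq_of_notMem _ _ _ hyA
  have heq' : EqOn (A.piecewise f' g') g' B := fun y hy ↦ by
    by_cases hyA : y ∈ A
    · rw [piecewise_eq_of_mem _ _ _ hyA, hfg' ⟨hyA, hy⟩]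
    · exact piecewise_eq_of_notMem _ _ _ hyA
  refine contDiffAt_one_of_isClosed_union (f' := A.piecewise f' g') hU hA hB hAB
    (fun y hy ↦ ?_) (fun y hy ↦ ?_) (hf'.congr ((piecewise_eqOn _ _ _).mono inter_subset_right))
    (hg'.congr (heq'.mono inter_subset_right))
  · rw [piecewise_eq_of_mem _ _ _ hy.2]
    exact (hf y hy).congr' (piecewise_eqOn _ _ _) hy.2
  · rw [heq' hy.2]
    exact (hg y hy).congr' heq hy.2

variable {ℓ : E →L[ℝ] ℝ} {e a : E}

theorem uniqueDiffOn_halfSpace (he : ℓ e = 1) : UniqueDiffOn ℝ {y | 0 ≤ ℓ y} := by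
  refine uniqueDiffOn_convex (convex_halfSpace_ge ℓ.isLinear 0) ⟨e, ?_⟩
  exact interior_mono (fun y (hy : 0 < ℓ y) ↦ hy.le)
    ((isOpen_lt continuous_const ℓ.continuous).interior_eq.symm ▸ (he ▸ one_pos : 0 < ℓ e))

-- With `P` the projection to the hyperplane along `e` and `R = 2 P - id` the reflection in it, the
-- extension is `2 f (P y) - f (R y)` below the hyperplane.
theorem exists_contDiffAt_extension_halfSpace {f : E → G} {U : Set E} (he : ℓ e = 1)
    (hU : IsOpen U) (haU : a ∈ U) (ha : ℓ a = 0) (hf : ContDiffOn ℝ 1 f (U ∩ {y | 0 ≤ ℓ y})) :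
    ∃ F : E → G, ContDiffAt ℝ 1 F a ∧ EqOn F f {y | 0 ≤ ℓ y} := by
  classical
  set H : Set E := {y | 0 ≤ ℓ y}
  set P : E →L[ℝ] E := .id ℝ E - ℓ.smulRight e
  set R : E →L[ℝ] E := .id ℝ E - (2 : ℝ) • ℓ.smulRight e
  have hPapply : ∀ y, P y = y - ℓ y • e := fun y ↦ rfl
  have hRapply : ∀ y, R y = y - (2 : ℝ) • ℓ y • e := fun y ↦ rfl
  have hP : ∀ y, P y ∈ H := fun y ↦ by simp [H, hPapply, he]
  have hR : ∀ y, ℓ y ≤ 0 → R y ∈ H := fun y hy ↦ by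
    simp only [H, mem_ofPred_eq, hRapply, map_sub, map_smul, he, smul_eq_mul]; linarith
  have hPfix : ∀ y, ℓ y = 0 → P y = y := fun y hy ↦ by simp [hPapply, hy]
  have hRfix : ∀ y, ℓ y = 0 → R y = y := fun y hy ↦ by simp [hRapply, hy]
  set D : E → E →L[ℝ] G := fderivWithin ℝ f (U ∩ H)
  have hderiv : ∀ y ∈ U ∩ H, HasFDerivWithinAt f (D y) H y := fun y hy ↦ by
    rw [← hasFDerivWithinAt_inter (hU.mem_nhds hy.1), inter_comm]
    exact (hf.differentiableOn one_ne_zero y hy).hasFDerivWithinAt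
  have hD : ContinuousOn D (U ∩ H) := hf.continuousOn_fderivWithin
    (inter_comm U H ▸ (uniqueDiffOn_halfSpace he).inter hU) le_rfl
  refine ⟨H.piecewise f fun y ↦ (2 : ℝ) • f (P y) - f (R y),
    contDiffAt_one_piecewise (f' := D) (g' := fun y ↦ (2 : ℝ) • D (P y) ∘L P - D (R y) ∘L R)
      (U := U ∩ (P ⁻¹' U ∩ R ⁻¹' U)) ?_ (isClosed_le continuous_const ℓ.continuous)
      (isClosed_le ℓ.continuous continuous_const) (eq_univ_of_forall fun y ↦ le_total 0 (ℓ y))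
      (fun y hy ↦ hderiv y ⟨hy.1.1, hy.2⟩) (fun y hy ↦ ?_)
      (hD.mono (inter_subset_inter_left _ inter_subset_left)) ?_ (fun y hy ↦ ?_) (fun y hy ↦ ?_),
    piecewise_eqOn _ _ _⟩
  · exact (hU.inter ((hU.preimage P.continuous).inter (hU.preimage R.continuous))).mem_nhds
      ⟨haU, mem_preimage.2 ((hPfix a ha).symm ▸ haU), mem_preimage.2 ((hRfix a ha).symm ▸ haU)⟩
  · exact (((hderiv _ ⟨hy.1.2.1, hP y⟩).comp y P.hasFDerivWithinAt fun z _ ↦ hP z).const_smul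
      (2 : ℝ)).sub ((hderiv _ ⟨hy.1.2.2, hR y hy.2⟩).comp y R.hasFDerivWithinAt hR)
  · exact (((hD.comp P.continuous.continuousOn fun y hy ↦ ⟨hy.1.2.1, hP y⟩).clm_comp
      continuousOn_const).const_smul (2 : ℝ)).sub
      ((hD.comp R.continuous.continuousOn fun y hy ↦ ⟨hy.1.2.2, hR y hy.2⟩).clm_comp
        continuousOn_const)
  · have hy₀ : ℓ y = 0 := le_antisymm hy.2 hy.1
    simp only [hPfix y hy₀, hRfix y hy₀]
    module
  · have hy₀ : ℓ y = 0 := le_antisymm hy.2 hy.1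
    ext v
    simp only [hPfix y hy₀, hRfix y hy₀, sub_apply, smul_apply, ContinuousLinearMap.comp_apply]
    rw [← map_smul, ← map_sub, hPapply v, hRapply v]
    congr 1
    module

theorem neg_of_isLocalMaxOn_halfSpace {F : E → ℝ} {F' : E →L[ℝ] ℝ} (he : ℓ e = 1) (ha : ℓ a = 0)
    (hmax : IsLocalMaxOn F {y | 0 ≤ ℓ y} a) (hF : HasFDerivAt F F' a) (hF' : F' ≠ 0) :
    F' e < 0 := by
  have hnonpos : ∀ v, 0 ≤ ℓ v → F' v ≤ 0 := fun v hv ↦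
    hmax.hasFDerivWithinAt_nonpos hF.hasFDerivWithinAt <| mem_posTangentConeAt_of_segment_subset <|
      (convex_halfSpace_ge ℓ.isLinear 0).segment_subset ha.ge (by simpa [ha] using hv)
  refine (hnonpos e (he ▸ zero_le_one)).lt_of_ne fun hzero ↦ hF' ?_
  ext v
  have htangent : ℓ (v - ℓ v • e) = 0 := by simp [he]
  have hle := hnonpos _ htangent.ge
  have hge := hnonpos (-(v - ℓ v • e)) (by rw [map_neg, htangent, neg_zero])
  simp only [map_sub, map_neg, map_smul, hzero, smul_zero, sub_zero] at hle hge
  exact le_antisymm hle (by simpa using hge)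

theorem eventually_nonneg_iff_le_of_contDiffAt {F : E → ℝ} {c : ℝ} (he : ℓ e = 1) (ha : ℓ a = 0)
    (hF : ContDiffAt ℝ 1 F a) (hneg : fderiv ℝ F a e < 0)
    (hlevel : ∀ᶠ y in 𝓝 a, ℓ y = 0 → F y = c) : ∀ᶠ y in 𝓝 a, (0 ≤ ℓ y ↔ F y ≤ c) := by
  have hnegNear : ∀ᶠ y in 𝓝 a, fderiv ℝ F y e < 0 :=
    ((hF.continuousAt_fderiv one_ne_zero).clm_apply continuousAt_const).eventually
      (gt_mem_nhds hneg)
  obtain ⟨r, hr, hball⟩ := Metric.eventually_nhds_iff_ball.1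
    (hnegNear.and ((hF.eventually (by simp)).and hlevel))
  have hproj : Tendsto (fun y ↦ y - ℓ y • e) (𝓝 a) (𝓝 a) := by
    have : ContinuousAt (fun y ↦ y - ℓ y • e) a := by fun_prop
    simpa [ContinuousAt, ha] using this
  filter_upwards [Metric.ball_mem_nhds a hr, hproj (Metric.ball_mem_nhds a hr)] with y hy hPy
  obtain ⟨z, hz, hmean⟩ := domain_mvt
    (fun x hx ↦ ((hball x hx).2.1.differentiableAt one_ne_zero).hasFDerivAt.hasFDerivWithinAt)
    (convex_ball a r) hPy hy
  have hzneg := (hball z ((convex_ball a r).segment_subset hPy hy hz)).1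
  rw [(hball _ hPy).2.2 (by simp [he]), sub_sub_cancel, map_smul, smul_eq_mul] at hmean
  rw [← sub_nonpos (a := F y), hmean]
  exact ⟨fun h ↦ mul_nonpos_of_nonneg_of_nonpos h hzneg.le, fun h ↦
    not_lt.1 fun hlt ↦ (mul_pos_of_neg_of_neg hlt hzneg).not_ge h⟩

end Extension

section Straightening

theorem exists_openPartialHomeomorph_apply_eq {ι : Type*} [Fintype ι] [DecidableEq ι]
    {F : EuclideanSpace ℝ ι → ℝ} {a : EuclideanSpace ℝ ι} {j : ι} {O : Set (EuclideanSpace ℝ ι)}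
    (hF : ContDiffAt ℝ 1 F a) (hj : fderiv ℝ F a (EuclideanSpace.single j 1) ≠ 0) (hO : O ∈ 𝓝 a) :
    ∃ e : OpenPartialHomeomorph (EuclideanSpace ℝ ι) (EuclideanSpace ℝ ι),
      a ∈ e.source ∧ e.source ⊆ O ∧ ContDiffOn ℝ 1 e e.source ∧ ContDiffOn ℝ 1 e.symm e.target ∧
        ∀ y, e y j = F y := by
  set v : EuclideanSpace ℝ ι := EuclideanSpace.single j 1
  set proj : EuclideanSpace ℝ ι →L[ℝ] ℝ := EuclideanSpace.proj j
  have hv : proj v = 1 := by simp [proj, v]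
  set θ : EuclideanSpace ℝ ι → EuclideanSpace ℝ ι := fun y ↦ y + (F y - proj y) • v
  have hθ : ContDiffAt ℝ 1 θ a :=
    contDiffAt_id.add ((hF.sub proj.contDiff.contDiffAt).smul contDiffAt_const)
  set L := ContinuousLinearMap.id ℝ (EuclideanSpace ℝ ι) + (fderiv ℝ F a - proj).smulRight v
  have hL : HasFDerivAt θ L a := (hasFDerivAt_id a).add
    (((hF.differentiableAt one_ne_zero).hasFDerivAt.sub proj.hasFDerivAt).smul_const v)
  have hLinj : Function.Injective L := (injective_iff_map_eq_zero L).2 fun w hw ↦ by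
    replace hw : w + (fderiv ℝ F a w - proj w) • v = 0 := hw
    have hFw : fderiv ℝ F a w = 0 := by simpa [hv] using congrArg proj hw
    have hwv : w = proj w • v := by
      rw [hFw] at hw
      exact sub_eq_zero.1 (by rw [← hw]; module)
    rw [hwv, map_smul, smul_eq_mul] at hFw
    rw [hwv, (mul_eq_zero.1 hFw).resolve_right hj, zero_smul]
  set L' := (LinearEquiv.ofInjectiveEndo L.toLinearMap hLinj).toContinuousLinearEquiv
  have hL' : HasFDerivAt θ (L' : EuclideanSpace ℝ ι →L[ℝ] EuclideanSpace ℝ ι) a := hL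
  set e := hθ.toOpenPartialHomeomorph θ hL' one_ne_zero
  have ha : a ∈ e.source := hθ.mem_toOpenPartialHomeomorph_source hL' one_ne_zero
  have hsymm : ContDiffAt ℝ 1 e.symm (e a) := hθ.to_localInverse hL' one_ne_zero
  set e₁ := (e.restrContDiff ℝ 1 (by simp)).restrOpen (interior O) isOpen_interior
  refine ⟨e₁, ⟨⟨ha, hθ, hsymm⟩, mem_interior_iff_mem_nhds.2 hO⟩,
    fun y hy ↦ interior_subset hy.2,
    (e.contDiffOn_restrContDiff_source ℝ (by simp)).mono inter_subset_left,
    (e.contDiffOn_restrContDiff_target ℝ (by simp)).mono inter_subset_left, fun y ↦ ?_⟩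
  change proj (θ y) = F y
  simp [θ, hv]

variable {M : Type*} [MetricSpace M] [ChartedSpace (EuclideanHalfSpace 3) M]

theorem apply_zero_eq_zero_of_mem_boundary {p : M} (hp : p ∈ (𝓡∂ 3).boundary M) :
    extChartAt (𝓡∂ 3) p p 0 = 0 := by
  have hfrontier : extChartAt (𝓡∂ 3) p p ∈ frontier (range (𝓡∂ 3)) := hp
  rw [frontier_range_modelWithCornersEuclideanHalfSpace] at hfrontier
  exact (show 0 = extChartAt (𝓡∂ 3) p p 0 from hfrontier).symm

variable [IsManifold (𝓡∂ 3) ∞ M] {u : M → ℝ} {p : M}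

theorem chartParam_mem_boundary {y : E3} (hy : y ∈ chartDom p) (hzero : y 0 = 0) :
    chartParam p y ∈ (𝓡∂ 3).boundary M := by
  by_contra hboundary
  have hinterior := mem_interior_chartDom ((extChartAt (𝓡∂ 3) p).map_target hy) hboundary
  rw [(extChartAt (𝓡∂ 3) p).right_inv hy] at hinterior
  have hpos := interior_mono (chartDom_subset p) hinterior
  rw [interior_range_modelWithCornersEuclideanHalfSpace] at hpos
  exact (show 0 < y 0 from hpos).ne' hzero

/-- The change of coordinates `e`, in the preferred chart at `p`, makes `u` the `j`-th coordinate
and the half-space the set `{z | z j ≤ 1}`. -/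
structure IsStraightening (u : M → ℝ) (p : M) (j : Fin 3) (e : OpenPartialHomeomorph E3 E3) :
    Prop where
  source_subset : e.source ∩ halfSpace3 ⊆ chartDom p
  contDiffOn : ContDiffOn ℝ 1 e e.source
  contDiffOn_symm : ContDiffOn ℝ 1 e.symm e.target
  mem_iff : ∀ y ∈ e.source, (y ∈ halfSpace3 ↔ e y j ≤ 1)
  eq_coord : ∀ y ∈ e.source ∩ halfSpace3, u (chartParam p y) = e y j

variable [RiemannianBundle (fun x : M ↦ TangentSpace (𝓡∂ 3) x)]

theorem fderiv_ne_zero_of_eventuallyEq_comp_chartParam {F : E3 → ℝ}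
    (hu : MDifferentiableAt (𝓡∂ 3) 𝓘(ℝ, ℝ) u p)
    (hF : DifferentiableAt ℝ F (extChartAt (𝓡∂ 3) p p))
    (hFu : F =ᶠ[𝓝[halfSpace3] extChartAt (𝓡∂ 3) p p] u ∘ chartParam p)
    (hp : gradPair u u p ≠ 0) : fderiv ℝ F (extChartAt (𝓡∂ 3) p p) ≠ 0 := fun hzero ↦ by
  have hmem : extChartAt (𝓡∂ 3) p p ∈ halfSpace3 := chartDom_subset p (mem_extChartAt_target p)
  refine hp (gradPair_self_eq_zero_of_fderivWithin_eq_zero hu ?_)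
  rw [← hFu.fderivWithin_eq (hFu.eq_of_nhdsWithin hmem),
    fderivWithin_eq_fderiv ((𝓡∂ 3).uniqueDiffOn _ hmem) hF, hzero]

variable [IsContMDiffRiemannianBundle (𝓡∂ 3) ∞ E3 (fun x : M ↦ TangentSpace (𝓡∂ 3) x)]
  [IsRiemannianManifold (𝓡∂ 3) M] [MeasurableSpace M] [BorelSpace M]

theorem exists_level_extension_of_mem_boundary (hu : IsHarmonic u)
    (hub : ∀ x ∈ (𝓡∂ 3).boundary M, u x = 1) (hinf : Tendsto u (cocompact M) (𝓝 0))
    (hp : gradPair u u p ≠ 0) (hpb : p ∈ (𝓡∂ 3).boundary M) :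
    ∃ F : E3 → ℝ, ContDiffAt ℝ 1 F (extChartAt (𝓡∂ 3) p p) ∧
      F =ᶠ[𝓝[halfSpace3] extChartAt (𝓡∂ 3) p p] u ∘ chartParam p ∧
      ∀ᶠ y in 𝓝 (extChartAt (𝓡∂ 3) p p), (y ∈ halfSpace3 ↔ F y ≤ 1) := by
  set y₀ := extChartAt (𝓡∂ 3) p p
  set ℓ : E3 →L[ℝ] ℝ := EuclideanSpace.proj 0
  have hℓ : ℓ (stdVec 0) = 1 := by simp [ℓ, stdVec]
  have hhalf : halfSpace3 = {y | 0 ≤ ℓ y} := ext fun y ↦ mem_halfSpace3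
  have hy₀ : ℓ y₀ = 0 := apply_zero_eq_zero_of_mem_boundary hpb
  have hdom : ∀ᶠ y in 𝓝 y₀, y ∈ halfSpace3 → y ∈ chartDom p :=
    eventually_nhdsWithin_iff.1 (chartDom_mem_nhdsWithin (mem_extChartAt_target p))
  obtain ⟨O, hO, hOdom⟩ := exists_isOpen_chartDom_eq_inter p
  have hy₀O : y₀ ∈ O := (hOdom ▸ mem_extChartAt_target p : y₀ ∈ O ∩ halfSpace3).1
  obtain ⟨F, hF, hFu⟩ := exists_contDiffAt_extension_halfSpace hℓ hO hy₀O hy₀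
    (hhalf ▸ hOdom ▸ contDiffOn_comp_chartParam (by simp) (hu.1.of_le one_le_two) p)
  have hFu' : F =ᶠ[𝓝[halfSpace3] y₀] u ∘ chartParam p :=
    (hhalf ▸ hFu).eventuallyEq_nhdsWithin
  have hFd := hF.differentiableAt one_ne_zero
  have hmax : IsLocalMaxOn F {y | 0 ≤ ℓ y} y₀ :=
    hhalf ▸ (isLocalMaxOn_comp_chartParam hu hub hinf hp (hub p hpb)).congr hFu'.symm
      (hhalf ▸ hy₀.ge)
  have hneg := neg_of_isLocalMaxOn_halfSpace hℓ hy₀ hmax hFd.hasFDerivAt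
    (fderiv_ne_zero_of_eventuallyEq_comp_chartParam (hu.1.mdifferentiable two_ne_zero p) hFd hFu'
      hp)
  refine ⟨F, hF, hFu', hhalf ▸ eventually_nonneg_iff_le_of_contDiffAt hℓ hy₀ hF hneg ?_⟩
  filter_upwards [hdom] with y hy hyzero
  rw [hFu hyzero.ge]
  exact hub _ (chartParam_mem_boundary (hy (mem_halfSpace3.2 hyzero.ge)) hyzero)

theorem exists_level_extension (hu : IsHarmonic u) (hub : ∀ x ∈ (𝓡∂ 3).boundary M, u x = 1)
    (hinf : Tendsto u (cocompact M) (𝓝 0)) (hp : gradPair u u p ≠ 0) :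
    ∃ F : E3 → ℝ, ContDiffAt ℝ 1 F (extChartAt (𝓡∂ 3) p p) ∧
      F =ᶠ[𝓝[halfSpace3] extChartAt (𝓡∂ 3) p p] u ∘ chartParam p ∧
      ∀ᶠ y in 𝓝 (extChartAt (𝓡∂ 3) p p), (y ∈ halfSpace3 ↔ F y ≤ 1) := by
  by_cases hpb : p ∈ (𝓡∂ 3).boundary M
  · exact exists_level_extension_of_mem_boundary hu hub hinf hp hpb
  have hdom : chartDom p ∈ 𝓝 (extChartAt (𝓡∂ 3) p p) :=
    mem_interior_iff_mem_nhds.1 (mem_interior_chartDom (mem_extChartAt_source p) hpb)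
  have hF : ContDiffAt ℝ 1 (u ∘ chartParam p) (extChartAt (𝓡∂ 3) p p) :=
    (contDiffOn_comp_chartParam (by simp) (hu.1.of_le one_le_two) p).contDiffAt hdom
  have hlt : (u ∘ chartParam p) (extChartAt (𝓡∂ 3) p p) < 1 :=
    (congrArg u (extChartAt_to_inv p)).trans_lt
      (lt_one_of_gradPair_self_ne_zero hu hub hinf hp hpb)
  refine ⟨_, hF, .rfl, ?_⟩
  filter_upwards [hdom, hF.continuousAt.eventually (gt_mem_nhds hlt)] with y hy hylt
  exact iff_of_true (chartDom_subset p hy) hylt.le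

theorem exists_isStraightening (hu : IsHarmonic u) (hub : ∀ x ∈ (𝓡∂ 3).boundary M, u x = 1)
    (hinf : Tendsto u (cocompact M) (𝓝 0)) (hp : gradPair u u p ≠ 0) :
    ∃ j e, IsStraightening u p j e ∧ extChartAt (𝓡∂ 3) p p ∈ e.source := by
  obtain ⟨F, hF, hFu, hFhalf⟩ := exists_level_extension hu hub hinf hp
  obtain ⟨j, hj⟩ : ∃ j, fderiv ℝ F (extChartAt (𝓡∂ 3) p p) (stdVec j) ≠ 0 := by
    by_contra! hzero
    refine fderiv_ne_zero_of_eventuallyEq_comp_chartParam (hu.1.mdifferentiable two_ne_zero p)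
      (hF.differentiableAt one_ne_zero) hFu hp ?_
    exact ContinuousLinearMap.coe_injective ((EuclideanSpace.basisFun (Fin 3) ℝ).toBasis.ext
      fun j ↦ by simpa [stdVec] using hzero j)
  obtain ⟨e, hpe, hsource, he, hesymm, heF⟩ := exists_openPartialHomeomorph_apply_eq hF hj
    ((eventually_nhdsWithin_iff.1 hFu).and (hFhalf.and (eventually_nhdsWithin_iff.1
      (chartDom_mem_nhdsWithin (mem_extChartAt_target p)))))
  exact ⟨j, e, ⟨fun y hy ↦ (hsource hy.1).2.2 hy.2, he, hesymm,
    fun y hy ↦ heF y ▸ (hsource hy).2.1,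
    fun y hy ↦ (heF y ▸ (hsource hy.1).1 hy.2).symm⟩, hpe⟩

end Straightening

section Slices

variable {n : ℕ}

/-- The inclusion of `ℝⁿ` in `ℝⁿ⁺¹` as the hyperplane orthogonal to the `j`-th coordinate axis. -/
noncomputable def sliceLin (j : Fin (n + 1)) :
    EuclideanSpace ℝ (Fin n) →L[ℝ] EuclideanSpace ℝ (Fin (n + 1)) :=
  LinearMap.toContinuousLinearMap
    { toFun := fun v ↦ WithLp.toLp 2 (j.insertNth 0 v.ofLp)
      map_add' := fun v w ↦ by
        ext i
        refine Fin.succAboveCases j ?_ (fun a ↦ ?_) i <;> simp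
      map_smul' := fun c v ↦ by
        ext i
        refine Fin.succAboveCases j ?_ (fun a ↦ ?_) i <;> simp }

theorem sliceLin_same (j : Fin (n + 1)) (v : EuclideanSpace ℝ (Fin n)) : sliceLin j v j = 0 := by
  simp [sliceLin]

theorem sliceLin_succAbove (j : Fin (n + 1)) (v : EuclideanSpace ℝ (Fin n)) (a : Fin n) :
    sliceLin j v (j.succAbove a) = v a := by
  simp [sliceLin]

theorem sliceLin_single (j : Fin (n + 1)) (a : Fin n) :
    sliceLin j (EuclideanSpace.single a 1) = EuclideanSpace.single (j.succAbove a) 1 := by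
  ext i
  refine Fin.succAboveCases j ?_ (fun b ↦ ?_) i
  · rw [sliceLin_same]
    simp [Fin.ne_succAbove]
  · rw [sliceLin_succAbove]
    simp

theorem sliceLin_injective (j : Fin (n + 1)) : Function.Injective (sliceLin j) := by
  intro v w h
  ext a
  rw [← sliceLin_succAbove j v, h, sliceLin_succAbove]

/-- The parametrization of the hyperplane `{z | z j = s}` by the remaining coordinates. -/
noncomputable def slice (j : Fin (n + 1)) (s : ℝ) (v : EuclideanSpace ℝ (Fin n)) :
    EuclideanSpace ℝ (Fin (n + 1)) :=
  sliceLin j v + s • EuclideanSpace.single j 1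

theorem slice_same (j : Fin (n + 1)) (s : ℝ) (v : EuclideanSpace ℝ (Fin n)) :
    slice j s v j = s := by
  simp [slice, sliceLin_same]

theorem slice_succAbove (j : Fin (n + 1)) (s : ℝ) (v : EuclideanSpace ℝ (Fin n)) (a : Fin n) :
    slice j s v (j.succAbove a) = v a := by
  simp [slice, sliceLin_succAbove]

/-- The orthogonal projection along the `j`-th coordinate axis. -/
def sliceProj (j : Fin (n + 1)) (z : EuclideanSpace ℝ (Fin (n + 1))) : EuclideanSpace ℝ (Fin n) :=
  WithLp.toLp 2 fun a ↦ z (j.succAbove a)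

theorem continuous_sliceProj (j : Fin (n + 1)) : Continuous (sliceProj j) := by
  unfold sliceProj
  fun_prop

theorem sliceProj_slice (j : Fin (n + 1)) (s : ℝ) (v : EuclideanSpace ℝ (Fin n)) :
    sliceProj j (slice j s v) = v := by
  ext a
  simp only [sliceProj, slice_succAbove]

theorem slice_sliceProj (j : Fin (n + 1)) (z : EuclideanSpace ℝ (Fin (n + 1))) :
    slice j (z j) (sliceProj j z) = z := by
  ext i
  refine Fin.succAboveCases j ?_ (fun a ↦ ?_) i
  · rw [slice_same]
  · rw [slice_succAbove, sliceProj]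

theorem slice_injective (j : Fin (n + 1)) (s : ℝ) : Function.Injective (slice j s) :=
  Function.LeftInverse.injective (sliceProj_slice j s)

theorem continuous_slice (j : Fin (n + 1)) :
    Continuous fun q : ℝ × EuclideanSpace ℝ (Fin n) ↦ slice j q.1 q.2 := by
  unfold slice
  fun_prop

theorem hasStrictFDerivAt_slice (j : Fin (n + 1)) (s : ℝ) (v : EuclideanSpace ℝ (Fin n)) :
    HasStrictFDerivAt (slice j s) (sliceLin j) v :=
  (sliceLin j).hasStrictFDerivAt.add_const _

/-- `ℝⁿ⁺¹` as the product of the `j`-th coordinate axis and its orthogonal hyperplane. -/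
def sliceEquiv (j : Fin (n + 1)) :
    ℝ × EuclideanSpace ℝ (Fin n) ≃ᵐ EuclideanSpace ℝ (Fin (n + 1)) :=
  (((MeasurableEquiv.refl ℝ).prodCongr (MeasurableEquiv.toLp 2 (Fin n → ℝ)).symm).trans
    (MeasurableEquiv.piFinSuccAbove (fun _ ↦ ℝ) j).symm).trans
      (MeasurableEquiv.toLp 2 (Fin (n + 1) → ℝ))

theorem sliceEquiv_apply (j : Fin (n + 1)) (q : ℝ × EuclideanSpace ℝ (Fin n)) :
    sliceEquiv j q = slice j q.1 q.2 := by
  have hinsert : sliceEquiv j q = WithLp.toLp 2 (j.insertNth (α := fun _ ↦ ℝ) q.1 q.2.ofLp) := rfl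
  rw [hinsert]
  ext i
  refine Fin.succAboveCases j ?_ (fun a ↦ ?_) i
  · simp [slice_same]
  · simp [slice_succAbove]

theorem measurePreserving_sliceEquiv (j : Fin (n + 1)) : MeasurePreserving (sliceEquiv j) :=
  (PiLp.volume_preserving_toLp (Fin (n + 1))).comp
    (((volume_preserving_piFinSuccAbove (fun _ ↦ ℝ) j).symm _).comp
      ((MeasurePreserving.id volume).prod (PiLp.volume_preserving_ofLp (Fin n))))

theorem integral_eq_integral_slice (j : Fin (n + 1)) {f : EuclideanSpace ℝ (Fin (n + 1)) → ℝ}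
    (hf : Integrable f) : ∫ z, f z = ∫ s, ∫ v, f (slice j s v) := by
  have hsplit := measurePreserving_sliceEquiv j
  rw [← hsplit.integral_comp (sliceEquiv j).measurableEmbedding, Measure.volume_eq_prod,
    integral_prod]
  · simp only [sliceEquiv_apply]
  · rw [← Measure.volume_eq_prod]
    exact (hsplit.integrable_comp_emb (sliceEquiv j).measurableEmbedding).2 hf

theorem integrable_integral_slice (j : Fin (n + 1)) {f : EuclideanSpace ℝ (Fin (n + 1)) → ℝ}
    (hf : Integrable f) : Integrable fun s ↦ ∫ v, f (slice j s v) := by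
  have hprod := ((measurePreserving_sliceEquiv j).integrable_comp_emb
    (sliceEquiv j).measurableEmbedding).2 hf
  rw [Measure.volume_eq_prod] at hprod
  simpa only [Function.comp_apply, sliceEquiv_apply] using hprod.integral_prod_left

theorem integrable_of_continuousOn_of_eq_zero {X : Type*} [TopologicalSpace X] [T2Space X]
    [MeasurableSpace X] [OpensMeasurableSpace X] {μ : Measure X} [IsFiniteMeasureOnCompacts μ]
    {f : X → ℝ} {K : Set X} (hK : IsCompact K) (hf : ContinuousOn f K) (hf0 : ∀ x ∉ K, f x = 0) :
    Integrable f μ :=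
  (integrableOn_iff_integrable_of_support_subset fun x hx ↦ by
    contrapose! hx
    exact Function.notMem_support.2 (hf0 x hx)).1 (hf.integrableOn_compact hK)

variable {f : EuclideanSpace ℝ (Fin (n + 1)) → ℝ} {K : Set (EuclideanSpace ℝ (Fin (n + 1)))}

theorem integrable_comp_slice (j : Fin (n + 1)) (hK : IsCompact K) (hf : ContinuousOn f K)
    (hf0 : ∀ z ∉ K, f z = 0) (s : ℝ) : Integrable fun v ↦ f (slice j s v) := by
  have hslice : Continuous (slice j s) := (continuous_slice j).comp (.prodMk_right s)
  have hemb : Topology.IsClosedEmbedding (slice j s) :=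
    Function.LeftInverse.isClosedEmbedding (sliceProj_slice j s) (continuous_sliceProj j) hslice
  exact integrable_of_continuousOn_of_eq_zero (hemb.isCompact_preimage hK)
    (hf.comp hslice.continuousOn (mapsTo_preimage _ _)) fun v hv ↦ hf0 _ hv

theorem continuousOn_integral_slice {j : Fin (n + 1)} {b : ℝ} (hK : IsCompact K)
    (hf : ContinuousOn f {z | z j ≤ b}) (hf0 : ∀ z ∉ K, f z = 0) :
    ContinuousOn (fun s ↦ ∫ v, f (slice j s v)) (Iic b) := by
  refine continuousOn_integral_of_compact_support (hK.image (continuous_sliceProj j)) ?_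
    fun s v _ hv ↦ hf0 _ fun hvK ↦ hv ⟨_, hvK, sliceProj_slice j s v⟩
  exact hf.comp (continuous_slice j).continuousOn fun q hq ↦ (slice_same j q.1 q.2).trans_le hq.1

end Slices

section Pullback

theorem inv_self_mul_det_eq_det_submatrix {K : Type*} [Field K] {n : ℕ}
    {G : Matrix (Fin (n + 1)) (Fin (n + 1)) K} (hG : G.det ≠ 0) (j : Fin (n + 1)) :
    G⁻¹ j j * G.det = (G.submatrix j.succAbove j.succAbove).det := by
  rw [Matrix.inv_def, Matrix.smul_apply, Ring.inverse_eq_inv', smul_eq_mul,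
    Matrix.adjugate_fin_succ_eq_det_submatrix, Even.neg_one_pow ⟨(j : ℕ), rfl⟩, one_mul]
  field_simp

variable {M : Type*} [MetricSpace M] [ChartedSpace (EuclideanHalfSpace 3) M]
  [RiemannianBundle (fun x : M ↦ TangentSpace (𝓡∂ 3) x)] {m : ℕ} {p : M} {y : E3}
  {L : EuclideanSpace ℝ (Fin m) →L[ℝ] E3}

/-- The Gram matrix of the linear map `L`, with respect to the metric in the preferred chart at `p`,
at the point `y`. -/
noncomputable def pullGram (p : M) (y : E3) (L : EuclideanSpace ℝ (Fin m) →L[ℝ] E3) :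
    Matrix (Fin m) (Fin m) ℝ :=
  fun a b ↦ inner ℝ (chartDeriv (𝓡∂ 3) p y (L (EuclideanSpace.single a 1)))
    (chartDeriv (𝓡∂ 3) p y (L (EuclideanSpace.single b 1)))

theorem pullGram_comp_sliceLin (p : M) (y : E3) (L : EuclideanSpace ℝ (Fin (m + 1)) →L[ℝ] E3)
    (j : Fin (m + 1)) :
    pullGram p y (L ∘L sliceLin j) = (pullGram p y L).submatrix j.succAbove j.succAbove := by
  ext a b
  simp only [pullGram, Matrix.submatrix_apply, ContinuousLinearMap.comp_apply, sliceLin_single]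

theorem pullGram_eq_sum (p : M) (y : E3) (L : EuclideanSpace ℝ (Fin m) →L[ℝ] E3) (a b : Fin m) :
    pullGram p y L a b = ∑ k, ∑ l, L (EuclideanSpace.single a 1) k *
      L (EuclideanSpace.single b 1) l * chartMetric p y k l := by
  have hsum : ∀ v : E3, chartDeriv (𝓡∂ 3) p y v =
      ∑ k, v k • chartDeriv (𝓡∂ 3) p y (stdVec k) := fun v ↦ by
    conv_lhs => rw [← (EuclideanSpace.basisFun (Fin 3) ℝ).sum_repr v]
    simp only [EuclideanSpace.basisFun_repr, EuclideanSpace.basisFun_apply, map_sum, map_smul,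
      stdVec]
  simp only [pullGram, hsum (L _), sum_inner, inner_sum, real_inner_smul_left,
    real_inner_smul_right]
  rw [Finset.sum_comm]
  refine Finset.sum_congr rfl fun k _ ↦ Finset.sum_congr rfl fun l _ ↦ ?_
  rw [mul_left_comm, mul_assoc]
  rfl

variable [IsManifold (𝓡∂ 3) ∞ M]

theorem pullGram_det_pos (hy : y ∈ chartDom p) (hL : Function.Injective L) :
    0 < (pullGram p y L).det :=
  (exists_clm_norm_eq_and_abs_det_eq_sqrt_gram (D := chartDeriv (𝓡∂ 3) p y ∘L L)
    ((chartDeriv_injective hy).comp hL) fun _ _ ↦ rfl).1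

variable [IsContMDiffRiemannianBundle (𝓡∂ 3) ∞ E3 (fun x : M ↦ TangentSpace (𝓡∂ 3) x)] {n : ℕ}
  {T : EuclideanSpace ℝ (Fin n) → E3}
  {T' : EuclideanSpace ℝ (Fin n) → EuclideanSpace ℝ (Fin m) →L[ℝ] E3}
  {S : Set (EuclideanSpace ℝ (Fin n))}

theorem continuousOn_sqrt_det_pullGram (hS : MapsTo T S (chartDom p)) (hT : ContinuousOn T S)
    (hT' : ContinuousOn T' S) : ContinuousOn (fun z ↦ √(pullGram p (T z) (T' z)).det) S := by
  have hcoord : ∀ (a : Fin m) (k : Fin 3),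
      ContinuousOn (fun z ↦ T' z (EuclideanSpace.single a 1) k) S := fun a k ↦
    (EuclideanSpace.proj k : E3 →L[ℝ] ℝ).continuous.comp_continuousOn
      (hT'.clm_apply continuousOn_const)
  have hentry : ∀ a b, ContinuousOn (fun z ↦ pullGram p (T z) (T' z) a b) S := fun a b ↦ by
    simp only [pullGram_eq_sum]
    refine continuousOn_finsetSum _ fun k _ ↦ continuousOn_finsetSum _ fun l _ ↦ ?_
    exact ((hcoord a k).mul (hcoord b l)).mul
      ((contDiffOn_chartMetric p k l).continuousOn.comp hT hS)
  exact (contDiffOn_zero.1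
    (contDiffOn_matrix_det (k := 0) fun a b ↦ contDiffOn_zero.2 (hentry a b))).sqrt

variable [IsRiemannianManifold (𝓡∂ 3) M] {T : EuclideanSpace ℝ (Fin m) → E3}
  {T' : EuclideanSpace ℝ (Fin m) → EuclideanSpace ℝ (Fin m) →L[ℝ] E3}
  {S : Set (EuclideanSpace ℝ (Fin m))}

theorem hasMetricJacobian_chartParam_comp (hSm : MeasurableSet S) (hS : MapsTo T S (chartDom p))
    (hT : ∀ z ∈ S, HasStrictFDerivAt T (T' z) z) (hT' : ContinuousOn T' S)
    (hT'_inj : ∀ z ∈ S, Function.Injective (T' z)) (hT_inj : InjOn T S) :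
    HasMetricJacobian (chartParam p ∘ T) S (fun z ↦ √(pullGram p (T z) (T' z)).det) where
  measurableSet := hSm
  injOn := (extChartAt (𝓡∂ 3) p).symm.injOn.comp hT_inj hS
  continuousOn_jacobian := continuousOn_sqrt_det_pullGram hS
    (fun z hz ↦ (hT z hz).continuousAt.continuousWithinAt) hT'
  jacobian_pos z hz := Real.sqrt_pos.2 (pullGram_det_pos (hS hz) (hT'_inj z hz))
  exists_deriv z hz := by
    have hinj : Function.Injective (chartDeriv (𝓡∂ 3) p (T z) ∘L T' z) :=
      (chartDeriv_injective (hS hz)).comp (hT'_inj z hz)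
    obtain ⟨A, hdet, hA⟩ := (exists_clm_norm_eq_and_abs_det_eq_sqrt_gram hinj
      (G := pullGram p (T z) (T' z)) fun _ _ ↦ rfl).2
    exact ⟨A, hdet, (((hasMetricDerivWithinAt_extChartAt_symm (hS hz)).mono
      (chartDom_subset p)).comp_hasStrictFDerivAt (hT z hz) hinj hS).congr_norm hA⟩

end Pullback

section Straightened

variable {M : Type*} [MetricSpace M] [ChartedSpace (EuclideanHalfSpace 3) M]
  {u : M → ℝ} {p : M} {j : Fin 3} {e : OpenPartialHomeomorph E3 E3} {z : E3}

/-- The domain of the straightened coordinates. -/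
def straightDom (j : Fin 3) (e : OpenPartialHomeomorph E3 E3) : Set E3 := e.target ∩ {z | z j ≤ 1}

theorem measurableSet_straightDom (j : Fin 3) (e : OpenPartialHomeomorph E3 E3) :
    MeasurableSet (straightDom j e) :=
  e.open_target.measurableSet.inter
    (isClosed_le (by fun_prop) continuous_const).measurableSet

namespace IsStraightening

theorem symm_mem (h : IsStraightening u p j e) (hz : z ∈ straightDom j e) :
    e.symm z ∈ e.source ∩ halfSpace3 := by
  have hsource := e.map_target hz.1
  exact ⟨hsource, (h.mem_iff _ hsource).2 (by rw [e.right_inv hz.1]; exact hz.2)⟩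

theorem mapsTo (h : IsStraightening u p j e) : MapsTo e.symm (straightDom j e) (chartDom p) :=
  fun _ hz ↦ h.source_subset (h.symm_mem hz)

theorem apply_symm (h : IsStraightening u p j e) (hz : z ∈ straightDom j e) :
    u (chartParam p (e.symm z)) = z j := by
  rw [h.eq_coord _ (h.symm_mem hz), e.right_inv hz.1]

theorem hasStrictFDerivAt_symm (h : IsStraightening u p j e) (hz : z ∈ e.target) :
    HasStrictFDerivAt e.symm (fderiv ℝ e.symm z) z :=
  (h.contDiffOn_symm.contDiffAt (e.open_target.mem_nhds hz)).hasStrictFDerivAt one_ne_zero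

theorem hasFDerivAt (h : IsStraightening u p j e) {y : E3} (hy : y ∈ e.source) :
    HasFDerivAt e (fderiv ℝ e y) y :=
  ((h.contDiffOn.contDiffAt (e.open_source.mem_nhds hy)).differentiableAt one_ne_zero).hasFDerivAt

theorem continuousOn_fderiv_symm (h : IsStraightening u p j e) :
    ContinuousOn (fderiv ℝ e.symm) e.target :=
  h.contDiffOn_symm.continuousOn_fderiv_of_isOpen e.open_target le_rfl

theorem fderiv_fderiv_symm (h : IsStraightening u p j e) (hz : z ∈ e.target) (v : E3) :
    fderiv ℝ e (e.symm z) (fderiv ℝ e.symm z v) = v := by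
  have hcomp := (h.hasFDerivAt (e.map_target hz)).comp z (h.hasStrictFDerivAt_symm hz).hasFDerivAt
  have hid : e ∘ e.symm =ᶠ[𝓝 z] id := by
    filter_upwards [e.open_target.mem_nhds hz] with w hw
    exact e.right_inv hw
  exact congrArg (fun L : E3 →L[ℝ] E3 ↦ L v)
    (hcomp.unique ((hasFDerivAt_id z).congr_of_eventuallyEq hid))

theorem fderiv_symm_injective (h : IsStraightening u p j e) (hz : z ∈ e.target) :
    Function.Injective (fderiv ℝ e.symm z) :=
  Function.LeftInverse.injective (h.fderiv_fderiv_symm hz)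

theorem fderivWithin_fderiv_symm (h : IsStraightening u p j e) (hz : z ∈ straightDom j e)
    (v : E3) :
    fderivWithin ℝ (u ∘ chartParam p) halfSpace3 (e.symm z) (fderiv ℝ e.symm z v) = v j := by
  obtain ⟨hsource, hhalf⟩ := h.symm_mem hz
  have hderiv : HasFDerivWithinAt (u ∘ chartParam p)
      ((EuclideanSpace.proj j : E3 →L[ℝ] ℝ) ∘L fderiv ℝ e (e.symm z)) halfSpace3 (e.symm z) := by
    refine ((EuclideanSpace.proj j : E3 →L[ℝ] ℝ).hasFDerivAt.comp (e.symm z)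
      (h.hasFDerivAt hsource)).hasFDerivWithinAt.congr_of_eventuallyEq ?_
      (h.eq_coord _ ⟨hsource, hhalf⟩)
    filter_upwards [self_mem_nhdsWithin,
      mem_nhdsWithin_of_mem_nhds (e.open_source.mem_nhds hsource)] with y hy hys
    exact h.eq_coord y ⟨hys, hy⟩
  rw [hderiv.fderivWithin ((𝓡∂ 3).uniqueDiffOn _ hhalf)]
  simp [h.fderiv_fderiv_symm hz.1]

theorem image_eq (h : IsStraightening u p j e) :
    (chartParam p ∘ e.symm) '' straightDom j e =
      (extChartAt (𝓡∂ 3) p).source ∩ extChartAt (𝓡∂ 3) p ⁻¹' e.source := by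
  ext x
  constructor
  · rintro ⟨z, hz, rfl⟩
    refine ⟨(extChartAt (𝓡∂ 3) p).map_target (h.mapsTo hz), ?_⟩
    rw [mem_preimage, Function.comp_apply, (extChartAt (𝓡∂ 3) p).right_inv (h.mapsTo hz)]
    exact (h.symm_mem hz).1
  · rintro ⟨hx, hxe⟩
    have hhalf : extChartAt (𝓡∂ 3) p x ∈ halfSpace3 :=
      chartDom_subset p ((extChartAt (𝓡∂ 3) p).map_source hx)
    refine ⟨e (extChartAt (𝓡∂ 3) p x), ⟨e.map_source hxe, (h.mem_iff _ hxe).1 hhalf⟩, ?_⟩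
    rw [Function.comp_apply, e.left_inv hxe]
    exact (extChartAt (𝓡∂ 3) p).left_inv hx

theorem isOpen_image (h : IsStraightening u p j e) :
    IsOpen ((chartParam p ∘ e.symm) '' straightDom j e) := by
  rw [h.image_eq]
  exact isOpen_extChartAt_preimage' p e.open_source

theorem image_slice (h : IsStraightening u p j e) (s : ℝ) :
    (chartParam p ∘ e.symm ∘ slice j s) '' (slice j s ⁻¹' straightDom j e) =
      {x | u x = s} ∩ (chartParam p ∘ e.symm) '' straightDom j e := by
  ext x
  constructor
  · rintro ⟨v, hv, rfl⟩
    exact ⟨(h.apply_symm hv).trans (slice_same j s v), slice j s v, hv, rfl⟩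
  · rintro ⟨hx, z, hz, rfl⟩
    have hzs : slice j s (sliceProj j z) = z := by
      rw [← (h.apply_symm hz).symm.trans hx, slice_sliceProj]
    exact ⟨sliceProj j z, by rw [mem_preimage, hzs]; exact hz, by simp [hzs]⟩

variable [RiemannianBundle (fun x : M ↦ TangentSpace (𝓡∂ 3) x)] [IsManifold (𝓡∂ 3) ∞ M]

theorem gradPair_eq_inv_pullGram (h : IsStraightening u p j e)
    (hu : ContMDiff (𝓡∂ 3) 𝓘(ℝ, ℝ) 1 u) (hz : z ∈ straightDom j e) :
    gradPair u u (chartParam p (e.symm z)) =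
      (pullGram p (e.symm z) (fderiv ℝ e.symm z))⁻¹ j j := by
  have hy := h.mapsTo hz
  have hinj := h.fderiv_symm_injective hz.1
  have hsurj : Function.Surjective (chartDeriv (𝓡∂ 3) p (e.symm z) ∘L fderiv ℝ e.symm z) :=
    (isInvertible_mfderivWithin_extChartAt_symm hy).surjective.comp
      (LinearMap.injective_iff_surjective (f := (fderiv ℝ e.symm z).toLinearMap).1 hinj)
  have hdual : ∀ i, inner ℝ (riemGradient u (chartParam p (e.symm z)))
      ((chartDeriv (𝓡∂ 3) p (e.symm z) ∘L fderiv ℝ e.symm z) (EuclideanSpace.single i 1)) =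
        if j = i then 1 else 0 := fun i ↦
    (inner_riemGradient u _ _).trans <|
      (mfderiv_chartDeriv hy (hu.mdifferentiable one_ne_zero _) _).trans <|
        (h.fderivWithin_fderiv_symm hz _).trans (by simp)
  refine (inner_eq_sum_gram_inv hsurj (pullGram_det_pos hy hinj).ne' (fun _ _ ↦ rfl) _ _).trans ?_
  simp only [hdual]
  simp

theorem norm_riemGradient_mul_sqrt_det (h : IsStraightening u p j e)
    (hu : ContMDiff (𝓡∂ 3) 𝓘(ℝ, ℝ) 1 u) (hz : z ∈ straightDom j e) :
    ‖riemGradient u (chartParam p (e.symm z))‖ *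
        √(pullGram p (e.symm z) (fderiv ℝ e.symm z)).det =
      √(pullGram p (e.symm z) (fderiv ℝ e.symm z ∘L sliceLin j)).det := by
  rw [norm_riemGradient, ← Real.sqrt_mul (gradPair_self_nonneg u _),
    h.gradPair_eq_inv_pullGram hu hz, pullGram_comp_sliceLin, inv_self_mul_det_eq_det_submatrix
      (pullGram_det_pos (h.mapsTo hz) (h.fderiv_symm_injective hz.1)).ne']

variable [IsContMDiffRiemannianBundle (𝓡∂ 3) ∞ E3 (fun x : M ↦ TangentSpace (𝓡∂ 3) x)]
  [IsRiemannianManifold (𝓡∂ 3) M]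

theorem hasMetricJacobian (h : IsStraightening u p j e) :
    HasMetricJacobian (chartParam p ∘ e.symm) (straightDom j e)
      (fun z ↦ √(pullGram p (e.symm z) (fderiv ℝ e.symm z)).det) :=
  hasMetricJacobian_chartParam_comp (measurableSet_straightDom j e) h.mapsTo
    (fun _ hz ↦ h.hasStrictFDerivAt_symm hz.1) (h.continuousOn_fderiv_symm.mono inter_subset_left)
    (fun _ hz ↦ h.fderiv_symm_injective hz.1) (e.symm.injOn.mono inter_subset_left)

theorem hasMetricJacobian_slice (h : IsStraightening u p j e) (s : ℝ) :
    HasMetricJacobian (chartParam p ∘ e.symm ∘ slice j s) (slice j s ⁻¹' straightDom j e)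
      (fun v ↦ √(pullGram p (e.symm (slice j s v))
        (fderiv ℝ e.symm (slice j s v) ∘L sliceLin j)).det) := by
  have hslice : Continuous (slice j s) := (continuous_slice j).comp (.prodMk_right s)
  refine hasMetricJacobian_chartParam_comp (T := e.symm ∘ slice j s)
    (T' := fun v ↦ fderiv ℝ e.symm (slice j s v) ∘L sliceLin j)
    (hslice.measurable (measurableSet_straightDom j e)) (fun v hv ↦ h.mapsTo hv)
    (fun v hv ↦ (h.hasStrictFDerivAt_symm hv.1).comp v (hasStrictFDerivAt_slice j s v)) ?_
    (fun v hv ↦ (h.fderiv_symm_injective hv.1).comp (sliceLin_injective j))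
    (fun v hv w hw hvw ↦ slice_injective j s (e.symm.injOn hv.1 hw.1 hvw))
  exact (h.continuousOn_fderiv_symm.comp hslice.continuousOn fun v hv ↦ hv.1).clm_comp
    continuousOn_const

end IsStraightening

end Straightened

section Coarea

variable {M : Type*} [MetricSpace M] [ChartedSpace (EuclideanHalfSpace 3) M]
  [RiemannianBundle (fun x : M ↦ TangentSpace (𝓡∂ 3) x)] [MeasurableSpace M] [BorelSpace M]
  {u χ : M → ℝ} {p : M} {j : Fin 3} {e : OpenPartialHomeomorph E3 E3} {z : E3}

/-- The flux of `∇u` through the level set `{u = s}`, with the weight `χ`. -/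
noncomputable def levelFlux (u χ : M → ℝ) (s : ℝ) : ℝ :=
  ∫ x in {x | u x = s}, χ x * ‖riemGradient u x‖ ∂μHE[2]

/-- The weighted fluxes through the level sets of `u` exist, depend continuously on the level up to
the level `1`, and satisfy the coarea formula. -/
structure HasCoarea (u χ : M → ℝ) : Prop where
  integrableOn : ∀ s, IntegrableOn (fun x ↦ χ x * ‖riemGradient u x‖) {x | u x = s} μHE[2]
  continuousOn : ContinuousOn (levelFlux u χ) (Iic 1)
  coarea : ∀ φ : ℝ → ℝ, Continuous φ →
    ∫ x, φ (u x) * (χ x * gradPair u u x) ∂μHE[3] = ∫ s, φ s * levelFlux u χ s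
  integrable : ∀ φ : ℝ → ℝ, Continuous φ →
    Integrable (fun x ↦ φ (u x) * (χ x * gradPair u u x)) μHE[3]
  integrable_levelFlux : ∀ φ : ℝ → ℝ, Continuous φ → Integrable (fun s ↦ φ s * levelFlux u χ s)

theorem HasCoarea.sum {ι : Type*} {t : Finset ι} {χ : ι → M → ℝ}
    (h : ∀ i ∈ t, HasCoarea u (χ i)) : HasCoarea u (fun x ↦ ∑ i ∈ t, χ i x) := by
  have hflux : levelFlux u (fun x ↦ ∑ i ∈ t, χ i x) = fun s ↦ ∑ i ∈ t, levelFlux u (χ i) s := by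
    ext s
    simp only [levelFlux, Finset.sum_mul]
    exact integral_finsetSum _ fun i hi ↦ (h i hi).integrableOn s
  refine ⟨fun s ↦ ?_, ?_, fun φ hφ ↦ ?_, fun φ hφ ↦ ?_, fun φ hφ ↦ ?_⟩
  · simp only [Finset.sum_mul]
    exact integrable_finsetSum _ fun i hi ↦ (h i hi).integrableOn s
  · rw [hflux]
    exact continuousOn_finsetSum _ fun i hi ↦ (h i hi).continuousOn
  · simp only [hflux, Finset.sum_mul, Finset.mul_sum]
    rw [integral_finsetSum _ fun i hi ↦ (h i hi).integrable φ hφ,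
      integral_finsetSum _ fun i hi ↦ (h i hi).integrable_levelFlux φ hφ]
    exact Finset.sum_congr rfl fun i hi ↦ (h i hi).coarea φ hφ
  · simp only [Finset.sum_mul, Finset.mul_sum]
    exact integrable_finsetSum _ fun i hi ↦ (h i hi).integrable φ hφ
  · simp only [hflux, Finset.mul_sum]
    exact integrable_finsetSum _ fun i hi ↦ (h i hi).integrable_levelFlux φ hφ

end Coarea

section StraightenedFlux

variable {M : Type*} [MetricSpace M] [ChartedSpace (EuclideanHalfSpace 3) M]
  {u χ : M → ℝ} {p : M} {j : Fin 3} {e : OpenPartialHomeomorph E3 E3} {z : E3}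

/-- The support of `χ` in the coordinates `e`. -/
def straightSupport (χ : M → ℝ) (p : M) (e : OpenPartialHomeomorph E3 E3) : Set E3 :=
  (e ∘ extChartAt (𝓡∂ 3) p) '' tsupport χ

namespace IsStraightening

theorem apply_extChartAt_chartParam_symm (h : IsStraightening u p j e)
    (hz : z ∈ straightDom j e) : e (extChartAt (𝓡∂ 3) p (chartParam p (e.symm z))) = z := by
  rw [(extChartAt (𝓡∂ 3) p).right_inv (h.mapsTo hz), e.right_inv hz.1]

theorem isCompact_straightSupport (h : IsStraightening u p j e) (hχc : HasCompactSupport χ)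
    (hχs : tsupport χ ⊆ (chartParam p ∘ e.symm) '' straightDom j e) :
    IsCompact (straightSupport χ p e) := by
  rw [h.image_eq] at hχs
  exact hχc.isCompact.image_of_continuousOn <| e.continuousOn.comp
    ((continuousOn_extChartAt p).mono fun x hx ↦ (hχs hx).1) fun x hx ↦ (hχs hx).2

theorem straightSupport_subset (h : IsStraightening u p j e)
    (hχs : tsupport χ ⊆ (chartParam p ∘ e.symm) '' straightDom j e) :
    straightSupport χ p e ⊆ straightDom j e := by
  rintro _ ⟨x, hx, rfl⟩
  obtain ⟨z, hz, rfl⟩ := hχs hx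
  exact (congrArg (· ∈ straightDom j e) (h.apply_extChartAt_chartParam_symm hz)).mpr hz

end IsStraightening

variable [RiemannianBundle (fun x : M ↦ TangentSpace (𝓡∂ 3) x)]

/-- The density of the weighted flux of `∇u` through the level sets of `u`, with respect to Lebesgue
measure on the coordinate planes of the straightened coordinates. -/
noncomputable def fluxDensity (u χ : M → ℝ) (p : M) (j : Fin 3) (e : OpenPartialHomeomorph E3 E3) :
    E3 → ℝ :=
  (straightDom j e).indicator fun z ↦
    √(pullGram p (e.symm z) (fderiv ℝ e.symm z ∘L sliceLin j)).det *
      (χ (chartParam p (e.symm z)) * ‖riemGradient u (chartParam p (e.symm z))‖)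

namespace IsStraightening

theorem fluxDensity_eq_zero (h : IsStraightening u p j e) (hz : z ∉ straightSupport χ p e) :
    fluxDensity u χ p j e z = 0 := by
  refine indicator_apply_eq_zero.2 fun hzW ↦ ?_
  have hχ : χ (chartParam p (e.symm z)) = 0 := by
    contrapose! hz
    exact ⟨_, subset_tsupport χ hz, h.apply_extChartAt_chartParam_symm hzW⟩
  rw [hχ, zero_mul, mul_zero]

variable [IsManifold (𝓡∂ 3) ∞ M]

theorem sqrt_det_mul_eq_fluxDensity (h : IsStraightening u p j e)
    (hu : ContMDiff (𝓡∂ 3) 𝓘(ℝ, ℝ) 1 u) (φ : ℝ → ℝ) (hz : z ∈ straightDom j e) :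
    √(pullGram p (e.symm z) (fderiv ℝ e.symm z)).det *
        (φ (u (chartParam p (e.symm z))) *
          (χ (chartParam p (e.symm z)) * gradPair u u (chartParam p (e.symm z)))) =
      φ (z j) * fluxDensity u χ p j e z := by
  rw [fluxDensity, indicator_of_mem hz, ← h.norm_riemGradient_mul_sqrt_det hu hz,
    h.apply_symm hz, gradPair_self]
  ring

variable [IsContMDiffRiemannianBundle (𝓡∂ 3) ∞ E3 (fun x : M ↦ TangentSpace (𝓡∂ 3) x)]
  [IsRiemannianManifold (𝓡∂ 3) M]

theorem continuousOn_fluxDensity (h : IsStraightening u p j e)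
    (hu : ContMDiff (𝓡∂ 3) 𝓘(ℝ, ℝ) 1 u) (hχ : Continuous χ) (hχc : HasCompactSupport χ)
    (hχs : tsupport χ ⊆ (chartParam p ∘ e.symm) '' straightDom j e) :
    ContinuousOn (fluxDensity u χ p j e) {z | z j ≤ 1} := by
  have hnorm : Continuous fun x ↦ ‖riemGradient u x‖ := by
    simp only [norm_riemGradient]
    exact (continuous_gradPair hu hu).sqrt
  have hdom : ContinuousOn (fluxDensity u χ p j e) (straightDom j e) := by
    have hJ := continuousOn_sqrt_det_pullGram h.mapsTo (e.continuousOn_symm.mono inter_subset_left)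
      ((h.continuousOn_fderiv_symm.mono inter_subset_left).clm_comp
        (continuousOn_const (c := sliceLin j)))
    have hΨ := h.hasMetricJacobian.continuousOn
    exact (hJ.mul ((hχ.comp_continuousOn hΨ).mul (hnorm.comp_continuousOn hΨ))).congr
      fun z hz ↦ indicator_of_mem hz _
  intro z hz
  by_cases hzt : z ∈ e.target
  · have hzdom := hdom z ⟨hzt, hz⟩
    rwa [straightDom, inter_comm, continuousWithinAt_inter (e.open_target.mem_nhds hzt)] at hzdom
  · have hzsupp : z ∉ straightSupport χ p e := fun hzs ↦ hzt (h.straightSupport_subset hχs hzs).1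
    have hzero : fluxDensity u χ p j e =ᶠ[𝓝 z] fun _ ↦ 0 := by
      filter_upwards [(h.isCompact_straightSupport hχc hχs).isClosed.isOpen_compl.mem_nhds hzsupp]
        with w hw using h.fluxDensity_eq_zero hw
    exact (continuousAt_const.congr hzero.symm).continuousWithinAt

theorem integrable_mul_fluxDensity (h : IsStraightening u p j e)
    (hu : ContMDiff (𝓡∂ 3) 𝓘(ℝ, ℝ) 1 u) (hχ : Continuous χ) (hχc : HasCompactSupport χ)
    (hχs : tsupport χ ⊆ (chartParam p ∘ e.symm) '' straightDom j e) {φ : ℝ → ℝ}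
    (hφ : Continuous φ) : Integrable fun z : E3 ↦ φ (z j) * fluxDensity u χ p j e z :=
  integrable_of_continuousOn_of_eq_zero (h.isCompact_straightSupport hχc hχs)
    ((hφ.comp (by fun_prop : Continuous fun z : E3 ↦ z j)).continuousOn.mul
      ((h.continuousOn_fluxDensity hu hχ hχc hχs).mono fun _ hz ↦
        (h.straightSupport_subset hχs hz).2))
    fun z hz ↦ by rw [h.fluxDensity_eq_zero hz, mul_zero]

theorem integrable_fluxDensity_slice (h : IsStraightening u p j e)
    (hu : ContMDiff (𝓡∂ 3) 𝓘(ℝ, ℝ) 1 u) (hχ : Continuous χ) (hχc : HasCompactSupport χ)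
    (hχs : tsupport χ ⊆ (chartParam p ∘ e.symm) '' straightDom j e) (s : ℝ) :
    Integrable fun v ↦ fluxDensity u χ p j e (slice j s v) :=
  integrable_comp_slice j (h.isCompact_straightSupport hχc hχs)
    ((h.continuousOn_fluxDensity hu hχ hχc hχs).mono fun _ hz ↦ (h.straightSupport_subset hχs hz).2)
    (fun _ ↦ h.fluxDensity_eq_zero) s

variable [MeasurableSpace M] [BorelSpace M]

theorem integrableOn_level (h : IsStraightening u p j e)
    (hu : ContMDiff (𝓡∂ 3) 𝓘(ℝ, ℝ) 1 u) (hχ : Continuous χ) (hχc : HasCompactSupport χ)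
    (hχs : tsupport χ ⊆ (chartParam p ∘ e.symm) '' straightDom j e) (s : ℝ) :
    IntegrableOn (fun x ↦ χ x * ‖riemGradient u x‖) {x | u x = s} μHE[2] := by
  have himage : IntegrableOn (fun x ↦ χ x * ‖riemGradient u x‖)
      ({x | u x = s} ∩ (chartParam p ∘ e.symm) '' straightDom j e) μHE[2] := by
    rw [← h.image_slice s, (h.hasMetricJacobian_slice s).integrableOn_image]
    exact (h.integrable_fluxDensity_slice hu hχ hχc hχs s).integrableOn.congr_fun
      (fun v hv ↦ indicator_of_mem (s := straightDom j e) hv _)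
      (h.hasMetricJacobian_slice s).measurableSet
  refine himage.of_forall_sdiff_eq_zero
    (measurableSet_eq_fun hu.continuous.measurable measurable_const) fun x hx ↦ ?_
  rw [image_eq_zero_of_notMem_tsupport fun hxs ↦ hx.2 ⟨hx.1, hχs hxs⟩, zero_mul]

theorem levelFlux_eq_integral_slice (h : IsStraightening u p j e)
    (hu : ContMDiff (𝓡∂ 3) 𝓘(ℝ, ℝ) 1 u)
    (hχs : tsupport χ ⊆ (chartParam p ∘ e.symm) '' straightDom j e) (s : ℝ) :
    levelFlux u χ s = ∫ v, fluxDensity u χ p j e (slice j s v) := by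
  have hrestrict : levelFlux u χ s = ∫ x in {x | u x = s} ∩
      (chartParam p ∘ e.symm) '' straightDom j e, χ x * ‖riemGradient u x‖ ∂μHE[2] :=
    setIntegral_eq_of_subset_of_forall_sdiff_eq_zero
      (measurableSet_eq_fun hu.continuous.measurable measurable_const) inter_subset_left
      fun x hx ↦ by
        rw [image_eq_zero_of_notMem_tsupport fun hxs ↦ hx.2 ⟨hx.1, hχs hxs⟩, zero_mul]
  rw [hrestrict, ← h.image_slice s, (h.hasMetricJacobian_slice s).integral_image]
  refine (setIntegral_congr_fun (g := fun v ↦ fluxDensity u χ p j e (slice j s v))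
    (h.hasMetricJacobian_slice s).measurableSet fun v hv ↦
    (indicator_of_mem (s := straightDom j e) hv _).symm).trans ?_
  exact setIntegral_eq_integral_of_forall_compl_eq_zero fun v hv ↦
    indicator_of_notMem (s := straightDom j e) hv _

theorem integral_mul_gradPair_eq (h : IsStraightening u p j e) (hu : ContMDiff (𝓡∂ 3) 𝓘(ℝ, ℝ) 1 u)
    (hχs : tsupport χ ⊆ (chartParam p ∘ e.symm) '' straightDom j e) (φ : ℝ → ℝ) :
    ∫ x, φ (u x) * (χ x * gradPair u u x) ∂μHE[3] = ∫ z, φ (z j) * fluxDensity u χ p j e z := by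
  have hrestrict : ∫ x, φ (u x) * (χ x * gradPair u u x) ∂μHE[3] =
      ∫ x in (chartParam p ∘ e.symm) '' straightDom j e,
        φ (u x) * (χ x * gradPair u u x) ∂μHE[3] :=
    (setIntegral_eq_integral_of_forall_compl_eq_zero fun x hx ↦ by
      rw [image_eq_zero_of_notMem_tsupport fun hxs ↦ hx (hχs hxs), zero_mul, mul_zero]).symm
  rw [hrestrict, h.hasMetricJacobian.integral_image]
  refine (setIntegral_congr_fun (measurableSet_straightDom j e) fun z hz ↦
    h.sqrt_det_mul_eq_fluxDensity hu φ hz).trans ?_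
  exact setIntegral_eq_integral_of_forall_compl_eq_zero fun z hz ↦ by
    rw [fluxDensity, indicator_of_notMem hz, mul_zero]

theorem integrable_mul_gradPair (h : IsStraightening u p j e)
    (hu : ContMDiff (𝓡∂ 3) 𝓘(ℝ, ℝ) 1 u) (hχ : Continuous χ) (hχc : HasCompactSupport χ)
    (hχs : tsupport χ ⊆ (chartParam p ∘ e.symm) '' straightDom j e) {φ : ℝ → ℝ}
    (hφ : Continuous φ) : Integrable (fun x ↦ φ (u x) * (χ x * gradPair u u x)) μHE[3] := by
  refine (integrableOn_iff_integrable_of_support_subset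
    (s := (chartParam p ∘ e.symm) '' straightDom j e) fun x hx ↦ ?_).1 ?_
  · contrapose! hx
    simp [image_eq_zero_of_notMem_tsupport fun hxs ↦ hx (hχs hxs)]
  · rw [h.hasMetricJacobian.integrableOn_image]
    exact (h.integrable_mul_fluxDensity hu hχ hχc hχs hφ).integrableOn.congr_fun
      (fun z hz ↦ (h.sqrt_det_mul_eq_fluxDensity hu φ hz).symm) (measurableSet_straightDom j e)

theorem hasCoarea (h : IsStraightening u p j e) (hu : ContMDiff (𝓡∂ 3) 𝓘(ℝ, ℝ) 1 u)
    (hχ : Continuous χ) (hχc : HasCompactSupport χ)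
    (hχs : tsupport χ ⊆ (chartParam p ∘ e.symm) '' straightDom j e) : HasCoarea u χ := by
  have hslice : ∀ (φ : ℝ → ℝ) (s : ℝ),
      ∫ v, φ (slice j s v j) * fluxDensity u χ p j e (slice j s v) =
        φ s * levelFlux u χ s := fun φ s ↦ by
    simp only [slice_same, h.levelFlux_eq_integral_slice hu hχs]
    exact integral_const_mul _ _
  refine ⟨h.integrableOn_level hu hχ hχc hχs, ?_, fun φ hφ ↦ ?_,
    fun φ hφ ↦ h.integrable_mul_gradPair hu hχ hχc hχs hφ, fun φ hφ ↦ ?_⟩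
  · rw [funext (h.levelFlux_eq_integral_slice hu hχs)]
    exact continuousOn_integral_slice (h.isCompact_straightSupport hχc hχs)
      (h.continuousOn_fluxDensity hu hχ hχc hχs) fun _ ↦ h.fluxDensity_eq_zero
  · rw [h.integral_mul_gradPair_eq hu hχs,
      integral_eq_integral_slice j (h.integrable_mul_fluxDensity hu hχ hχc hχs hφ)]
    simp only [hslice]
  · simpa only [hslice] using
      integrable_integral_slice j (h.integrable_mul_fluxDensity hu hχ hχc hχs hφ)

end IsStraightening

theorem hasCoarea_of_gradPair_self_ne_zero [IsManifold (𝓡∂ 3) ∞ M]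
    [IsContMDiffRiemannianBundle (𝓡∂ 3) ∞ E3 (fun x : M ↦ TangentSpace (𝓡∂ 3) x)]
    [IsRiemannianManifold (𝓡∂ 3) M] [MeasurableSpace M] [BorelSpace M] (hu : IsHarmonic u)
    (hub : ∀ x ∈ (𝓡∂ 3).boundary M, u x = 1) (hinf : Tendsto u (cocompact M) (𝓝 0))
    (hχ : Continuous χ) (hχc : HasCompactSupport χ)
    (hreg : ∀ x ∈ tsupport χ, gradPair u u x ≠ 0) : HasCoarea u χ := by
  have hbox : ∀ p ∈ tsupport χ, ∃ U ∈ 𝓝 p, ∀ χ' : M → ℝ, Continuous χ' →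
      HasCompactSupport χ' → tsupport χ' ⊆ U → HasCoarea u χ' := by
    intro p hp
    obtain ⟨j, e, he, hpe⟩ := exists_isStraightening hu hub hinf (hreg p hp)
    refine ⟨_, he.isOpen_image.mem_nhds ?_,
      fun χ' hχ' hχc' hχs' ↦ he.hasCoarea (hu.1.of_le one_le_two) hχ' hχc' hχs'⟩
    rw [he.image_eq]
    exact ⟨mem_extChartAt_source p, hpe⟩
  choose! U hU hUχ using hbox
  obtain ⟨t, ρ, hρ, hρ_sum⟩ := exists_finite_partition_of_unity hχc.isCompact hU
  have hsplit : χ = fun x ↦ ∑ p ∈ t, ρ p x * χ x := by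
    ext x
    rw [← Finset.sum_mul]
    by_cases hx : x ∈ tsupport χ
    · rw [hρ_sum x hx, one_mul]
    · rw [image_eq_zero_of_notMem_tsupport hx, mul_zero]
  rw [hsplit]
  exact HasCoarea.sum fun p hp ↦ hUχ p (hρ p hp).1 _ ((hρ p hp).2.1.continuous.mul hχ)
    hχc.mul_left (tsupport_mul_subset_left.trans (hρ p hp).2.2)

end StraightenedFlux

section GradientBound

variable {M : Type*} [MetricSpace M] [ChartedSpace (EuclideanHalfSpace 3) M]
  [IsManifold (𝓡∂ 3) ∞ M] [RiemannianBundle (fun x : M ↦ TangentSpace (𝓡∂ 3) x)] {u : M → ℝ}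
  {p : M} {y : E3}

theorem abs_chartPartial_le (hy : y ∈ chartDom p)
    (hu : MDifferentiableAt (𝓡∂ 3) 𝓘(ℝ, ℝ) u (chartParam p y)) (i : Fin 3) :
    |chartPartial p u i y| ≤ √(chartMetric p y i i) * √(gradPair u u (chartParam p y)) := by
  have hnorm : ‖chartDeriv (𝓡∂ 3) p y (stdVec i)‖ = √(chartMetric p y i i) :=
    norm_eq_sqrt_real_inner _
  rw [← inner_riemGradient_chartDeriv hy hu i, mul_comm, ← norm_riemGradient, ← hnorm]
  exact abs_real_inner_le_norm _ _

variable [IsContMDiffRiemannianBundle (𝓡∂ 3) ∞ E3 (fun x : M ↦ TangentSpace (𝓡∂ 3) x)]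

theorem isBigO_chartPartial (hu : ContMDiff (𝓡∂ 3) 𝓘(ℝ, ℝ) 1 u) (hy : y ∈ chartDom p)
    (i : Fin 3) :
    chartPartial p u i =O[𝓝[chartDom p] y] fun z ↦ √(gradPair u u (chartParam p z)) := by
  have hmetric : (fun z ↦ √(chartMetric p z i i)) =O[𝓝[chartDom p] y] fun _ ↦ (1 : ℝ) :=
    ((contDiffOn_chartMetric p i i).continuousOn y hy).sqrt.isBigO_one ℝ
  refine .trans (.of_bound' ?_) (hmetric.mul (Asymptotics.isBigO_refl _ _) |>.congr_right
    fun _ ↦ one_mul _)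
  filter_upwards [self_mem_nhdsWithin] with z hz
  rw [Real.norm_eq_abs, Real.norm_of_nonneg (by positivity)]
  exact abs_chartPartial_le hz (hu.mdifferentiable one_ne_zero _) i

theorem isBigO_fderivWithin_quadratic {E ι : Type*} [NormedAddCommGroup E] [NormedSpace ℝ E]
    [Fintype ι] {S : Set E} {y : E} (hS : UniqueDiffOn ℝ S) (hy : y ∈ S) {h : ι → E → ℝ}
    {B : ι → ι → E → ℝ} {r : E → ℝ} (hh : ∀ k, ContDiffOn ℝ 1 (h k) S)
    (hB : ∀ k l, ContDiffOn ℝ 1 (B k l) S) (hr : ∀ k, h k =O[𝓝[S] y] r) :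
    fderivWithin ℝ (fun z ↦ ∑ k, ∑ l, h k z * B k l z * h l z) S =O[𝓝[S] y] r := by
  have hbdd : ∀ {f : E → ℝ}, ContDiffOn ℝ 1 f S → f =O[𝓝[S] y] fun _ ↦ (1 : ℝ) := fun hf ↦
    (hf.continuousOn y hy).isBigO_one ℝ
  have hbdd' : ∀ {f : E → ℝ}, ContDiffOn ℝ 1 f S →
      fderivWithin ℝ f S =O[𝓝[S] y] fun _ ↦ (1 : ℝ) := fun hf ↦
    (hf.continuousOn_fderivWithin hS le_rfl y hy).isBigO_one ℝ
  have hderiv : ∀ z ∈ S, fderivWithin ℝ (fun z ↦ ∑ k, ∑ l, h k z * B k l z * h l z) S z =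
      ∑ k, ∑ l, ((h k z * B k l z) • fderivWithin ℝ (h l) S z +
        h l z • (h k z • fderivWithin ℝ (B k l) S z + B k l z • fderivWithin ℝ (h k) S z)) := by
    intro z hz
    have hd : ∀ {f : E → ℝ}, ContDiffOn ℝ 1 f S →
        HasFDerivWithinAt f (fderivWithin ℝ f S z) S z := fun hf ↦
      (hf.differentiableOn one_ne_zero z hz).hasFDerivWithinAt
    exact (HasFDerivWithinAt.fun_sum fun k _ ↦ HasFDerivWithinAt.fun_sum fun l _ ↦
      ((hd (hh k)).mul (hd (hB k l))).mul (hd (hh l))).fderivWithin (hS z hz)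
  refine .congr' (.fun_sum fun k _ ↦ .fun_sum fun l _ ↦ ?_)
    (by filter_upwards [self_mem_nhdsWithin] with z hz using (hderiv z hz).symm) .rfl
  have hfirst := ((hr k).mul (hbdd (hB k l))).smul (hbdd' (hh l))
  have hsecond := (hr l).smul (((hbdd (hh k)).smul (hbdd' (hB k l))).add
    ((hbdd (hB k l)).smul (hbdd' (hh k))))
  simp only [smul_eq_mul, mul_one] at hfirst hsecond
  exact hfirst.add hsecond

theorem isBigO_chartPartial_gradPair_self (hu : ContMDiff (𝓡∂ 3) 𝓘(ℝ, ℝ) 2 u)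
    (hy : y ∈ chartDom p) (i : Fin 3) :
    chartPartial p (gradPair u u) i =O[𝓝[chartDom p] y]
      fun z ↦ √(gradPair u u (chartParam p z)) := by
  have hpartial : ∀ k, ContDiffOn ℝ 1 (chartPartial p u k) (chartDom p) :=
    contDiffOn_chartPartial (m := 1) hu p
  have hquad := isBigO_fderivWithin_quadratic (uniqueDiffOn_extChartAt_target p) hy
    (h := chartPartial p u) (B := fun k l z ↦ (chartMetric p z)⁻¹ k l) hpartial
    (fun k l ↦ (contDiffOn_chartMetric_inv p k l).of_le (by simp))
    (isBigO_chartPartial (hu.of_le one_le_two) hy)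
  refine .trans (.of_bound 1 ?_) hquad
  filter_upwards [self_mem_nhdsWithin] with z hz
  have hcongr : EqOn (gradPair u u ∘ chartParam p) (fun z ↦ ∑ k, ∑ l,
      chartPartial p u k z * (chartMetric p z)⁻¹ k l * chartPartial p u l z) (chartDom p) :=
    fun z hz ↦ gradPair_chartParam hz (hu.mdifferentiable two_ne_zero _)
      (hu.mdifferentiable two_ne_zero _)
  rw [chartPartial, ← fderivWithin_chartDom hz, fderivWithin_congr hcongr (hcongr hz)]
  refine (ContinuousLinearMap.le_opNorm _ _).trans_eq ?_
  rw [stdVec, PiLp.norm_single, norm_one, mul_one, one_mul]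

theorem isBigO_gradPair_gradPair_self (hu : ContMDiff (𝓡∂ 3) 𝓘(ℝ, ℝ) 2 u) (hy : y ∈ chartDom p) :
    (fun z ↦ gradPair (gradPair u u) u (chartParam p z)) =O[𝓝[chartDom p] y]
      fun z ↦ gradPair u u (chartParam p z) := by
  have hN : ContMDiff (𝓡∂ 3) 𝓘(ℝ, ℝ) 1 (gradPair u u) := contMDiff_gradPair (m := 1) hu hu
  have hcongr : (fun z ↦ gradPair (gradPair u u) u (chartParam p z)) =ᶠ[𝓝[chartDom p] y] fun z ↦
      ∑ k, ∑ l, chartPartial p (gradPair u u) k z * (chartMetric p z)⁻¹ k l *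
        chartPartial p u l z := by
    filter_upwards [self_mem_nhdsWithin] with z hz
    exact gradPair_chartParam hz (hN.mdifferentiable one_ne_zero _)
      (hu.mdifferentiable two_ne_zero _)
  refine hcongr.trans_isBigO (.fun_sum fun k _ ↦ .fun_sum fun l _ ↦ ?_)
  refine (((isBigO_chartPartial_gradPair_self hu hy k).mul
    (((contDiffOn_chartMetric_inv p k l).continuousOn y hy).isBigO_one ℝ)).mul
    (isBigO_chartPartial (hu.of_le one_le_two) hy l)).congr_right fun z ↦ ?_
  rw [mul_one, Real.mul_self_sqrt (gradPair_self_nonneg _ _)]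

theorem exists_eventually_abs_gradPair_gradPair_le (hu : ContMDiff (𝓡∂ 3) 𝓘(ℝ, ℝ) 2 u) (p : M) :
    ∃ C : ℝ, 0 ≤ C ∧ ∀ᶠ x in 𝓝 p, |gradPair (gradPair u u) u x| ≤ C * gradPair u u x := by
  obtain ⟨C, hC, hbound⟩ :=
    (isBigO_gradPair_gradPair_self hu (mem_extChartAt_target (I := 𝓡∂ 3) p)).exists_nonneg
  have htend : Tendsto (extChartAt (𝓡∂ 3) p) (𝓝 p) (𝓝[chartDom p] (extChartAt (𝓡∂ 3) p p)) :=
    tendsto_nhdsWithin_iff.2 ⟨continuousAt_extChartAt p, by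
      filter_upwards [extChartAt_source_mem_nhds (I := 𝓡∂ 3) p] with x hx
      exact (extChartAt (𝓡∂ 3) p).map_source hx⟩
  refine ⟨C, hC, ?_⟩
  filter_upwards [htend.eventually hbound.bound, extChartAt_source_mem_nhds (I := 𝓡∂ 3) p]
    with x hx hxs
  have hparam : chartParam p (extChartAt (𝓡∂ 3) p x) = x := (extChartAt (𝓡∂ 3) p).left_inv hxs
  rwa [hparam, Real.norm_eq_abs,
    Real.norm_of_nonneg (gradPair_self_nonneg u x)] at hx

theorem exists_abs_gradPair_gradPair_le (hu : ContMDiff (𝓡∂ 3) 𝓘(ℝ, ℝ) 2 u) {K : Set M}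
    (hK : IsCompact K) :
    ∃ C : ℝ, 0 ≤ C ∧ ∀ x ∈ K, |gradPair (gradPair u u) u x| ≤ C * gradPair u u x := by
  refine hK.induction_on (p := fun S ↦ ∃ C : ℝ, 0 ≤ C ∧ ∀ x ∈ S,
    |gradPair (gradPair u u) u x| ≤ C * gradPair u u x) ⟨0, le_rfl, by simp⟩
    (fun s t hst ⟨C, h0, hC⟩ ↦ ⟨C, h0, fun x hx ↦ hC x (hst hx)⟩) ?_ fun p _ ↦ ?_
  · rintro s t ⟨C, h0, hC⟩ ⟨C', h0', hC'⟩
    refine ⟨C + C', by positivity, ?_⟩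
    rintro x (hx | hx)
    · nlinarith [hC x hx, gradPair_self_nonneg u x]
    · nlinarith [hC' x hx, gradPair_self_nonneg u x]
  · obtain ⟨C, h0, hC⟩ := exists_eventually_abs_gradPair_gradPair_le hu p
    exact ⟨_, mem_nhdsWithin_of_mem_nhds hC, C, h0, fun x hx ↦ hx⟩

end GradientBound

/-- A continuous probability density on the line vanishing off `[a, b]`, used to average over
levels. -/
structure IsBumpProfile (a b : ℝ) (φ : ℝ → ℝ) : Prop where
  continuous : Continuous φ
  nonneg : ∀ s, 0 ≤ φ s
  integral_eq_one : ∫ s, φ s = 1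
  eq_zero : ∀ s ∉ Icc a b, φ s = 0

theorem exists_isBumpProfile {a b : ℝ} (hab : a < b) : ∃ φ, IsBumpProfile a b φ := by
  let f : ContDiffBump ((a + b) / 2) := ⟨(b - a) / 4, (b - a) / 2, by linarith, by linarith⟩
  refine ⟨f.normed volume, f.continuous_normed, f.nonneg_normed, f.integral_normed, fun s hs ↦ ?_⟩
  by_contra hne
  have hball : s ∈ Metric.ball ((a + b) / 2) ((b - a) / 2) :=
    f.support_normed_eq (μ := volume) ▸ hne
  rw [← Real.Ioo_eq_ball] at hball
  exact hs (Ioo_subset_Icc_self hball)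

namespace IsBumpProfile

variable {a b s : ℝ} {φ : ℝ → ℝ}

theorem mono (h : IsBumpProfile a b φ) {a' b' : ℝ} (ha : a' ≤ a) (hb : b ≤ b') :
    IsBumpProfile a' b' φ :=
  ⟨h.continuous, h.nonneg, h.integral_eq_one,
    fun s hs ↦ h.eq_zero s fun hs' ↦ hs (Icc_subset_Icc ha hb hs')⟩

theorem integrable (h : IsBumpProfile a b φ) : Integrable φ :=
  h.continuous.integrable_of_hasCompactSupport (.intro isCompact_Icc h.eq_zero)

theorem eq_zero_of_le (h : IsBumpProfile a b φ) (hs : s ≤ a) : φ s = 0 :=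
  EqOn.closure (s := Iio a) (fun s hs ↦ h.eq_zero s fun hs' ↦ hs'.1.not_gt hs) h.continuous
    continuous_const (closure_Iio a ▸ hs)

theorem intervalIntegral_eq_zero (h : IsBumpProfile a b φ) (hs : s ≤ a) : ∫ r in a..s, φ r = 0 :=
  intervalIntegral.integral_zero_ae <| .of_forall fun _ hr ↦
    h.eq_zero_of_le (hr.2.trans (max_le le_rfl hs))

theorem intervalIntegral_eq_one (h : IsBumpProfile a b φ) (hs : b ≤ s) : ∫ r in a..s, φ r = 1 := by
  have hab : a ≤ b := by
    by_contra hba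
    simpa [funext fun s ↦ h.eq_zero s (Icc_eq_empty hba ▸ notMem_empty s)] using h.integral_eq_one
  rw [intervalIntegral.integral_of_le (hab.trans hs), ← integral_Icc_eq_integral_Ioc,
    ← h.integral_eq_one]
  exact setIntegral_eq_integral_of_forall_compl_eq_zero fun r hr ↦
    h.eq_zero r fun hr' ↦ hr (Icc_subset_Icc_right hs hr')

theorem intervalIntegral_mem_Icc (h : IsBumpProfile a b φ) (s : ℝ) :
    ∫ r in a..s, φ r ∈ Icc 0 1 := by
  rcases le_total s a with hs | hs
  · rw [h.intervalIntegral_eq_zero hs]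
    exact ⟨le_rfl, zero_le_one⟩
  · rw [intervalIntegral.integral_of_le hs, ← h.integral_eq_one]
    exact ⟨integral_nonneg h.nonneg, setIntegral_le_integral h.integrable (.of_forall h.nonneg)⟩

theorem abs_sub_integral_mul_le (h : IsBumpProfile a b φ) {F : ℝ → ℝ}
    (hF : Integrable fun s ↦ φ s * F s) {y ε : ℝ} (hε : ∀ s ∈ Icc a b, |y - F s| ≤ ε) :
    |y - ∫ s, φ s * F s| ≤ ε := by
  have haverage : ∀ c, ∫ s, φ s * c = c := fun c ↦ by
    rw [integral_mul_const, h.integral_eq_one, one_mul]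
  have hdiff : y - ∫ s, φ s * F s = ∫ s, φ s * (y - F s) := by
    simp only [mul_sub]
    rw [integral_sub (h.integrable.mul_const y) hF, haverage]
  rw [hdiff, ← Real.norm_eq_abs, ← haverage ε]
  refine norm_integral_le_of_norm_le (h.integrable.mul_const ε) (.of_forall fun s ↦ ?_)
  rw [norm_mul, Real.norm_of_nonneg (h.nonneg s)]
  by_cases hs : s ∈ Icc a b
  · exact mul_le_mul_of_nonneg_left (hε s hs) (h.nonneg s)
  · rw [h.eq_zero s hs, zero_mul, zero_mul]

end IsBumpProfile

section Flux

variable {M : Type*} [MetricSpace M] [ChartedSpace (EuclideanHalfSpace 3) M]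
  [IsManifold (𝓡∂ 3) ∞ M] [RiemannianBundle (fun x : M ↦ TangentSpace (𝓡∂ 3) x)]
  {u χ : M → ℝ} {φ Φ φ₀ φ₁ : ℝ → ℝ} {a b c : ℝ}

theorem gradPair_comp_mul {x : M} (hu : MDifferentiableAt (𝓡∂ 3) 𝓘(ℝ, ℝ) u x)
    (hχ : MDifferentiableAt (𝓡∂ 3) 𝓘(ℝ, ℝ) χ x) (hΦ : HasDerivAt Φ (φ (u x)) (u x)) :
    gradPair (fun x ↦ Φ (u x) * χ x) u x =
      Φ (u x) * gradPair χ u x + φ (u x) * (χ x * gradPair u u x) := by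
  have hΦu : MDifferentiableAt (𝓡∂ 3) 𝓘(ℝ, ℝ) (fun x ↦ Φ (u x)) x :=
    hΦ.differentiableAt.mdifferentiableAt.comp x hu
  rw [gradPair_mul hΦu hχ, gradPair_comp hΦ hu]
  ring

variable [IsContMDiffRiemannianBundle (𝓡∂ 3) ∞ E3 (fun x : M ↦ TangentSpace (𝓡∂ 3) x)]
  [IsRiemannianManifold (𝓡∂ 3) M] [MeasurableSpace M] [BorelSpace M]

theorem integral_mul_levelFlux_eq_neg (hu : IsHarmonic u)
    (hub : ∀ x ∈ (𝓡∂ 3).boundary M, u x = 1) (hχ : ContMDiff (𝓡∂ 3) 𝓘(ℝ, ℝ) 1 χ)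
    (hχc : HasCompactSupport χ) (hco : HasCoarea u χ) (hφ : Continuous φ)
    (hΦ : ∀ s, HasDerivAt Φ (φ s) s) (hb : b < 1) (hΦb : ∀ s, b ≤ s → Φ s = 0) :
    ∫ s, φ s * levelFlux u χ s = -∫ x, Φ (u x) * gradPair χ u x ∂μHE[3] := by
  have hu₁ : ContMDiff (𝓡∂ 3) 𝓘(ℝ, ℝ) 1 u := hu.1.of_le one_le_two
  have hΦ₁ : ContDiff ℝ 1 Φ := contDiff_one_iff_deriv.2
    ⟨fun s ↦ (hΦ s).differentiableAt, by rwa [funext fun s ↦ (hΦ s).deriv]⟩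
  have hsupp : tsupport (fun x ↦ Φ (u x) * χ x) ⊆ {x | u x ≤ b} :=
    closure_minimal (fun x hx ↦ not_lt.1 fun hlt : b < u x ↦
        hx (by simp only [hΦb _ hlt.le, zero_mul]))
      (isClosed_le hu₁.continuous continuous_const)
  have hzero := integral_gradPair_eq_zero hu ((hΦ₁.contMDiff.comp hu₁).mul hχ) hχc.mul_left
    (disjoint_left.2 fun x hx hxb ↦ hb.not_ge (hub x hxb ▸ hsupp hx))
  have hint : Integrable (fun x ↦ Φ (u x) * gradPair χ u x) μHE[3] :=
    ((hΦ₁.continuous.comp hu₁.continuous).mul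
      (continuous_gradPair hχ hu₁)).integrable_of_hasCompactSupport <| .intro hχc fun x hx ↦ by
        rw [Pi.mul_apply, gradPair_eq_zero_of_notMem_tsupport hx, mul_zero]
  have hsplit : ∀ x, gradPair (fun x ↦ Φ (u x) * χ x) u x = _ := fun x ↦
    gradPair_comp_mul (hu₁.mdifferentiable one_ne_zero x) (hχ.mdifferentiable one_ne_zero x)
      (hΦ (u x))
  have hsum : ∫ x, (Φ (u x) * gradPair χ u x + φ (u x) * (χ x * gradPair u u x)) ∂μHE[3] = 0 :=
    (integral_congr_ae (.of_forall hsplit)).symm.trans hzero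
  rw [integral_add hint (hco.integrable φ hφ), hco.coarea φ hφ] at hsum
  linarith

theorem abs_integral_mul_levelFlux_sub_le (hu : IsHarmonic u)
    (hub : ∀ x ∈ (𝓡∂ 3).boundary M, u x = 1) (hχ : ContMDiff (𝓡∂ 3) 𝓘(ℝ, ℝ) 1 χ)
    (hχc : HasCompactSupport χ) (hco : HasCoarea u χ) (hb : b < 1)
    (h₀ : IsBumpProfile a b φ₀) (h₁ : IsBumpProfile a b φ₁) :
    |(∫ s, φ₁ s * levelFlux u χ s) - ∫ s, φ₀ s * levelFlux u χ s| ≤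
      ∫ x in {x | a ≤ u x}, |gradPair χ u x| ∂μHE[3] := by
  set Φ : ℝ → ℝ := fun s ↦ (∫ r in a..s, φ₁ r) - ∫ r in a..s, φ₀ r
  have hΦ : ∀ s, HasDerivAt Φ (φ₁ s - φ₀ s) s := fun s ↦
    (hasDerivAt_intervalIntegral h₁.continuous a s).sub
      (hasDerivAt_intervalIntegral h₀.continuous a s)
  have hΦa : ∀ s ≤ a, Φ s = 0 := fun s hs ↦ by
    simp only [Φ, h₀.intervalIntegral_eq_zero hs, h₁.intervalIntegral_eq_zero hs, sub_zero]
  have hΦb : ∀ s, b ≤ s → Φ s = 0 := fun s hs ↦ by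
    simp only [Φ, h₀.intervalIntegral_eq_one hs, h₁.intervalIntegral_eq_one hs, sub_self]
  have hΦ_le : ∀ s, |Φ s| ≤ 1 := fun s ↦
    abs_sub_le_of_le_of_le (h₁.intervalIntegral_mem_Icc s).1 (h₁.intervalIntegral_mem_Icc s).2
      (h₀.intervalIntegral_mem_Icc s).1 (h₀.intervalIntegral_mem_Icc s).2 |>.trans_eq (sub_zero 1)
  have hflux := integral_mul_levelFlux_eq_neg (φ := fun s ↦ φ₁ s - φ₀ s) hu hub hχ hχc hco
    (h₁.continuous.sub h₀.continuous) hΦ hb hΦb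
  simp only [sub_mul] at hflux
  rw [integral_sub (hco.integrable_levelFlux _ h₁.continuous)
    (hco.integrable_levelFlux _ h₀.continuous)] at hflux
  have hrestrict : ∫ x in {x | a ≤ u x}, Φ (u x) * gradPair χ u x ∂μHE[3] =
      ∫ x, Φ (u x) * gradPair χ u x ∂μHE[3] :=
    setIntegral_eq_integral_of_forall_compl_eq_zero fun x (hx : ¬a ≤ u x) ↦ by
      rw [hΦa _ (not_le.1 hx).le, zero_mul]
  have hint : Integrable (gradPair χ u) μHE[3] :=
    integrable_gradPair hχ hχc (hu.1.of_le one_le_two)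
  rw [hflux, abs_neg, ← hrestrict, ← Real.norm_eq_abs]
  refine norm_integral_le_of_norm_le hint.abs.integrableOn (.of_forall fun x ↦ ?_)
  rw [norm_mul, Real.norm_eq_abs, Real.norm_eq_abs]
  exact mul_le_of_le_one_left (abs_nonneg _) (hΦ_le _)

theorem abs_levelFlux_sub_le_of_lt (hu : IsHarmonic u)
    (hub : ∀ x ∈ (𝓡∂ 3).boundary M, u x = 1) (hχ : ContMDiff (𝓡∂ 3) 𝓘(ℝ, ℝ) 1 χ)
    (hχc : HasCompactSupport χ) (hco : HasCoarea u χ) (hb : b < 1)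
    (h₀ : IsBumpProfile a b φ₀) (hc : c ∈ Ioo a 1) :
    |levelFlux u χ c - ∫ s, φ₀ s * levelFlux u χ s| ≤
      ∫ x in {x | a ≤ u x}, |gradPair χ u x| ∂μHE[3] := by
  refine le_of_forall_pos_le_add fun ε hε ↦ ?_
  have hcont : ContinuousAt (levelFlux u χ) c := hco.continuousOn.continuousAt (Iic_mem_nhds hc.2)
  obtain ⟨r, hr, hball⟩ := Metric.nhds_basis_closedBall.mem_iff.1
    (inter_mem (isOpen_Ioo.mem_nhds hc) (hcont (Metric.closedBall_mem_nhds _ hε)))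
  rw [Real.closedBall_eq_Icc] at hball
  obtain ⟨φ₁, h₁⟩ := exists_isBumpProfile (show c - r < c + r by linarith)
  have hleft : a < c - r := (hball (left_mem_Icc.2 (by linarith))).1.1
  have hright : c + r < 1 := (hball (right_mem_Icc.2 (by linarith))).1.2
  have haverage : |levelFlux u χ c - ∫ s, φ₁ s * levelFlux u χ s| ≤ ε :=
    h₁.abs_sub_integral_mul_le (hco.integrable_levelFlux _ h₁.continuous) fun s hs ↦ by
      rw [abs_sub_comm]
      exact (hball hs).2
  have hcompare := abs_integral_mul_levelFlux_sub_le hu hub hχ hχc hco (max_lt hb hright)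
    (h₀.mono le_rfl (le_max_left _ _)) (h₁.mono hleft.le (le_max_right _ _))
  exact (abs_sub_le _ _ _).trans (add_comm ε _ ▸ add_le_add haverage hcompare)

theorem abs_levelFlux_sub_le (hu : IsHarmonic u)
    (hub : ∀ x ∈ (𝓡∂ 3).boundary M, u x = 1) (hχ : ContMDiff (𝓡∂ 3) 𝓘(ℝ, ℝ) 1 χ)
    (hχc : HasCompactSupport χ) (hco : HasCoarea u χ) (hb : b < 1)
    (h₀ : IsBumpProfile a b φ₀) (hc : c ∈ Ioc a 1) :
    |levelFlux u χ c - ∫ s, φ₀ s * levelFlux u χ s| ≤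
      ∫ x in {x | a ≤ u x}, |gradPair χ u x| ∂μHE[3] := by
  have hclosure : c ∈ closure (Ioo a 1) :=
    closure_Ioo (hc.1.trans_le hc.2).ne ▸ Ioc_subset_Icc_self hc
  have : (𝓝[Ioo a 1] c).NeBot := mem_closure_iff_nhdsWithin_neBot.1 hclosure
  have hcont : ContinuousWithinAt (levelFlux u χ) (Ioo a 1) c :=
    (hco.continuousOn c hc.2).mono fun s hs ↦ hs.2.le
  refine le_of_tendsto (hcont.tendsto.sub_const _).abs ?_
  filter_upwards [self_mem_nhdsWithin] with s hs
  exact abs_levelFlux_sub_le_of_lt hu hub hχ hχc hco hb h₀ hs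

end Flux

/-- A smooth monotone step, equal to `0` on `(-∞, 1]` and to `1` on `[2, ∞)`. -/
noncomputable def smoothStep (r : ℝ) : ℝ := Real.smoothTransition (r - 1)

section SmoothStep

variable {r : ℝ}

theorem contDiff_smoothStep : ContDiff ℝ 1 smoothStep :=
  (Real.smoothTransition.contDiff (n := 1)).comp (contDiff_id.sub contDiff_const)

theorem smoothStep_of_le (h : r ≤ 1) : smoothStep r = 0 :=
  Real.smoothTransition.zero_of_nonpos (by linarith)

theorem smoothStep_of_ge (h : 2 ≤ r) : smoothStep r = 1 :=
  Real.smoothTransition.one_of_one_le (by linarith)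

theorem smoothStep_nonneg (r : ℝ) : 0 ≤ smoothStep r := Real.smoothTransition.nonneg _

theorem smoothStep_le_one (r : ℝ) : smoothStep r ≤ 1 := Real.smoothTransition.le_one _

theorem monotone_smoothStep : Monotone smoothStep := fun _ _ h ↦
  Real.smoothTransition.monotone (by linarith)

theorem hasDerivAt_smoothStep (r : ℝ) : HasDerivAt smoothStep (deriv smoothStep r) r :=
  (contDiff_smoothStep.differentiable one_ne_zero r).hasDerivAt

theorem deriv_smoothStep_of_lt (h : 2 < r) : deriv smoothStep r = 0 := by
  have hone : smoothStep =ᶠ[𝓝 r] fun _ ↦ 1 :=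
    (lt_mem_nhds h).mono fun s hs ↦ smoothStep_of_ge (le_of_lt hs)
  rw [hone.deriv_eq, deriv_const]

theorem deriv_smoothStep_of_gt (h : r < 1) : deriv smoothStep r = 0 := by
  have hzero : smoothStep =ᶠ[𝓝 r] fun _ ↦ 0 :=
    (gt_mem_nhds h).mono fun s hs ↦ smoothStep_of_le (le_of_lt hs)
  rw [hzero.deriv_eq, deriv_const]

theorem exists_abs_deriv_smoothStep_mul_le : ∃ C, ∀ r, |deriv smoothStep r * r| ≤ C := by
  have hcont : Continuous fun r ↦ deriv smoothStep r * r :=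
    (contDiff_smoothStep.continuous_deriv le_rfl).mul continuous_id
  refine hcont.bounded_above_of_compact_support <| .intro (isCompact_Icc (a := 1) (b := 2))
    fun r hr ↦ ?_
  rcases not_and_or.1 hr with h | h
  · rw [deriv_smoothStep_of_gt (not_le.1 h), zero_mul]
  · rw [deriv_smoothStep_of_lt (not_le.1 h), zero_mul]

end SmoothStep

theorem integrable_and_integral_eq_of_monotone {α : Type*} [MeasurableSpace α] {μ : Measure α}
    {f : ℕ → α → ℝ} {g : α → ℝ} {L : ℝ} (hf : ∀ n, Integrable (f n) μ) (hf₀ : ∀ n x, 0 ≤ f n x)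
    (hmono : ∀ x, Monotone fun n ↦ f n x) (hlim : ∀ x, Tendsto (fun n ↦ f n x) atTop (𝓝 (g x)))
    (hL : Tendsto (fun n ↦ ∫ x, f n x ∂μ) atTop (𝓝 L)) :
    Integrable g μ ∧ ∫ x, g x ∂μ = L := by
  have hg₀ : ∀ x, 0 ≤ g x := fun x ↦ ge_of_tendsto' (hlim x) fun n ↦ hf₀ n x
  have hgm : AEStronglyMeasurable g μ :=
    aestronglyMeasurable_of_tendsto_ae atTop (fun n ↦ (hf n).1) (.of_forall hlim)
  have hlintegral : ∫⁻ x, ENNReal.ofReal (g x) ∂μ = ENNReal.ofReal L := by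
    refine tendsto_nhds_unique
      (lintegral_tendsto_of_tendsto_of_monotone (fun n ↦ (hf n).1.aemeasurable.ennreal_ofReal)
        (.of_forall fun x m n hmn ↦ ENNReal.ofReal_le_ofReal (hmono x hmn))
        (.of_forall fun x ↦ (ENNReal.continuous_ofReal.tendsto _).comp (hlim x)))
      (((ENNReal.continuous_ofReal.tendsto _).comp hL).congr fun n ↦ ?_)
    exact ofReal_integral_eq_lintegral_ofReal (hf n) (.of_forall (hf₀ n))
  refine ⟨⟨hgm, ?_⟩, ?_⟩
  · rw [hasFiniteIntegral_iff_ofReal (.of_forall hg₀), hlintegral]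
    exact ENNReal.ofReal_lt_top
  · rw [integral_eq_lintegral_of_nonneg_ae (.of_forall hg₀) hgm, hlintegral,
      ENNReal.toReal_ofReal (ge_of_tendsto' hL fun n ↦ integral_nonneg (hf₀ n))]

section RegularCutoff

variable {M : Type*} [MetricSpace M] [ChartedSpace (EuclideanHalfSpace 3) M]
  [RiemannianBundle (fun x : M ↦ TangentSpace (𝓡∂ 3) x)]

/-- Cutoff to the regular part of `{a ≤ u}`: it vanishes where `|∇u|² ≤ 1 / (n + 1)` or `u ≤ a / 3`,
and increases with `n` to the indicator of `{∇u ≠ 0}` on `{a ≤ u}`. -/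
noncomputable def regularCutoff (u : M → ℝ) (a : ℝ) (n : ℕ) (x : M) : ℝ :=
  smoothStep ((n + 1) * gradPair u u x) * smoothStep (3 / a * u x)

variable {u : M → ℝ} {a : ℝ} {n : ℕ} {x : M}

theorem regularCutoff_nonneg : 0 ≤ regularCutoff u a n x :=
  mul_nonneg (smoothStep_nonneg _) (smoothStep_nonneg _)

theorem regularCutoff_le_one : regularCutoff u a n x ≤ 1 :=
  mul_le_one₀ (smoothStep_le_one _) (smoothStep_nonneg _) (smoothStep_le_one _)

theorem monotone_regularCutoff : Monotone fun n ↦ regularCutoff u a n x := fun _ _ hmn ↦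
  mul_le_mul_of_nonneg_right (monotone_smoothStep <| mul_le_mul_of_nonneg_right
    (add_le_add_left (Nat.cast_le.2 hmn) 1) (gradPair_self_nonneg u x)) (smoothStep_nonneg _)

theorem regularCutoff_eq_smoothStep (ha : 0 < a) (hx : 2 / 3 * a ≤ u x) :
    regularCutoff u a n x = smoothStep ((n + 1) * gradPair u u x) := by
  have htwo : 2 ≤ 3 / a * u x := calc
    2 = 3 / a * (2 / 3 * a) := by field_simp
    _ ≤ 3 / a * u x := by gcongr
  rw [regularCutoff, smoothStep_of_ge htwo, mul_one]

theorem eventually_two_lt_mul_gradPair_self (hx : gradPair u u x ≠ 0) :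
    ∀ᶠ n : ℕ in atTop, 2 < ((n : ℝ) + 1) * gradPair u u x :=
  ((tendsto_atTop_add_const_right _ 1 tendsto_natCast_atTop_atTop).atTop_mul_const
    ((gradPair_self_nonneg u x).lt_of_ne' hx)).eventually_gt_atTop 2

theorem eventually_regularCutoff_eq_one (ha : 0 < a) (hux : a ≤ u x) (hx : gradPair u u x ≠ 0) :
    ∀ᶠ n in atTop, regularCutoff u a n x = 1 := by
  filter_upwards [eventually_two_lt_mul_gradPair_self hx] with n hn
  rw [regularCutoff_eq_smoothStep ha (by linarith), smoothStep_of_ge hn.le]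

theorem tendsto_indicator_regularCutoff_mul_norm_riemGradient (ha : 0 < a) {c : ℝ} (hc : a ≤ c)
    (x : M) :
    Tendsto (fun n ↦ {x | u x = c}.indicator
        (fun x ↦ regularCutoff u a n x * ‖riemGradient u x‖) x) atTop
      (𝓝 ({x | u x = c}.indicator (fun x ↦ ‖riemGradient u x‖) x)) := by
  by_cases hxc : u x = c
  · simp only [indicator_of_mem (show x ∈ {x | u x = c} from hxc)]
    refine tendsto_const_nhds.congr' ?_
    by_cases hx : gradPair u u x = 0
    · exact .of_forall fun n ↦ by simp only [norm_riemGradient, hx, Real.sqrt_zero, mul_zero]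
    · filter_upwards [eventually_regularCutoff_eq_one ha (hc.trans_eq hxc.symm) hx] with n hn
      rw [hn, one_mul]
  · simp only [indicator_of_notMem (show x ∉ {x | u x = c} from hxc)]
    exact tendsto_const_nhds

variable [IsManifold (𝓡∂ 3) ∞ M]

theorem gradPair_regularCutoff (ha : 0 < a) (hu : ContinuousAt u x)
    (hN : MDifferentiableAt (𝓡∂ 3) 𝓘(ℝ, ℝ) (gradPair u u) x) (hux : a ≤ u x) :
    gradPair (regularCutoff u a n) u x =
      deriv smoothStep ((n + 1) * gradPair u u x) * (n + 1) * gradPair (gradPair u u) u x := by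
  have hev : regularCutoff u a n =ᶠ[𝓝 x] fun x ↦ smoothStep ((n + 1) * gradPair u u x) :=
    (hu.eventually (lt_mem_nhds (show 2 / 3 * a < u x by linarith))).mono fun z hz ↦
      regularCutoff_eq_smoothStep ha (le_of_lt hz)
  rw [gradPair_congr hev]
  exact gradPair_comp (f := gradPair u u) (Φ := fun r ↦ smoothStep ((n + 1) * r))
    ((hasDerivAt_smoothStep _).comp _ (hasDerivAt_const_mul ((n : ℝ) + 1))) hN

theorem abs_gradPair_regularCutoff_le (ha : 0 < a) (hu : ContinuousAt u x)
    (hN : MDifferentiableAt (𝓡∂ 3) 𝓘(ℝ, ℝ) (gradPair u u) x) (hux : a ≤ u x) {C D : ℝ}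
    (hC : |gradPair (gradPair u u) u x| ≤ C * gradPair u u x) (hC₀ : 0 ≤ C)
    (hD : ∀ r, |deriv smoothStep r * r| ≤ D) :
    |gradPair (regularCutoff u a n) u x| ≤ D * C := by
  set N : ℝ := gradPair u u x
  calc |gradPair (regularCutoff u a n) u x|
      = |deriv smoothStep ((n + 1) * N) * (n + 1)| * |gradPair (gradPair u u) u x| := by
        rw [gradPair_regularCutoff ha hu hN hux, abs_mul]
    _ ≤ |deriv smoothStep ((n + 1) * N) * (n + 1)| * (C * N) := by gcongr
    _ = |deriv smoothStep ((n + 1) * N) * ((n + 1) * N)| * C := by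
        rw [← mul_assoc (deriv _ _), abs_mul _ N, abs_of_nonneg (gradPair_self_nonneg u x)]
        ring
    _ ≤ D * C := by
        gcongr
        exact hD _

theorem tendsto_gradPair_regularCutoff (ha : 0 < a) (hu : ContinuousAt u x)
    (hN : MDifferentiableAt (𝓡∂ 3) 𝓘(ℝ, ℝ) (gradPair u u) x) (hux : a ≤ u x) {C : ℝ}
    (hC : |gradPair (gradPair u u) u x| ≤ C * gradPair u u x) :
    Tendsto (fun n ↦ gradPair (regularCutoff u a n) u x) atTop (𝓝 0) := by
  simp only [gradPair_regularCutoff ha hu hN hux]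
  refine tendsto_const_nhds.congr' ?_
  by_cases hx : gradPair u u x = 0
  · rw [hx, mul_zero, abs_nonpos_iff] at hC
    exact .of_forall fun n ↦ by simp only [hC, mul_zero]
  · filter_upwards [eventually_two_lt_mul_gradPair_self hx] with n hn
    rw [deriv_smoothStep_of_lt hn, zero_mul, zero_mul]

variable [IsContMDiffRiemannianBundle (𝓡∂ 3) ∞ E3 (fun x : M ↦ TangentSpace (𝓡∂ 3) x)]

theorem contMDiff_regularCutoff (hu : ContMDiff (𝓡∂ 3) 𝓘(ℝ, ℝ) 2 u) :
    ContMDiff (𝓡∂ 3) 𝓘(ℝ, ℝ) 1 (regularCutoff u a n) :=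
  (contDiff_smoothStep.contMDiff.comp
    (contMDiff_const.mul (contMDiff_gradPair (m := 1) hu hu))).mul
  (contDiff_smoothStep.contMDiff.comp (contMDiff_const.mul (hu.of_le one_le_two)))

theorem tsupport_regularCutoff_subset (ha : 0 < a) (hu : ContMDiff (𝓡∂ 3) 𝓘(ℝ, ℝ) 2 u) :
    tsupport (regularCutoff u a n) ⊆ {x | a / 3 ≤ u x ∧ 1 ≤ (n + 1) * gradPair u u x} := by
  have hN : Continuous (gradPair u u) := (contMDiff_gradPair (m := 1) hu hu).continuous
  refine closure_minimal (fun x hx ↦ ⟨?_, ?_⟩) ((isClosed_le continuous_const hu.continuous).inter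
    (isClosed_le continuous_const (continuous_const.mul hN)))
  · refine not_lt.1 fun hlt ↦ hx ?_
    have hle : 3 / a * u x ≤ 1 := calc
      3 / a * u x ≤ 3 / a * (a / 3) := by gcongr
      _ = 1 := by field_simp
    rw [regularCutoff, smoothStep_of_le hle, mul_zero]
  · refine not_lt.1 fun hlt ↦ hx ?_
    rw [regularCutoff, smoothStep_of_le hlt.le, zero_mul]

theorem gradPair_self_ne_zero_of_mem_tsupport_regularCutoff (ha : 0 < a)
    (hu : ContMDiff (𝓡∂ 3) 𝓘(ℝ, ℝ) 2 u) (hx : x ∈ tsupport (regularCutoff u a n)) :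
    gradPair u u x ≠ 0 := fun hN ↦
  absurd (tsupport_regularCutoff_subset ha hu hx).2 (by rw [hN, mul_zero]; norm_num)

theorem hasCompactSupport_regularCutoff (ha : 0 < a) (hu : ContMDiff (𝓡∂ 3) 𝓘(ℝ, ℝ) 2 u)
    (hinf : Tendsto u (cocompact M) (𝓝 0)) : HasCompactSupport (regularCutoff u a n) :=
  (isCompact_preimage_of_tendsto_cocompact hu.continuous hinf isClosed_Ici
    (notMem_Ici.2 (by linarith : 0 < a / 3))).of_isClosed_subset (isClosed_tsupport _)
    fun _ hx ↦ (tsupport_regularCutoff_subset ha hu hx).1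

variable [IsRiemannianManifold (𝓡∂ 3) M] [MeasurableSpace M] [BorelSpace M]

theorem hasCoarea_regularCutoff (hu : IsHarmonic u) (hub : ∀ x ∈ (𝓡∂ 3).boundary M, u x = 1)
    (hinf : Tendsto u (cocompact M) (𝓝 0)) (ha : 0 < a) : HasCoarea u (regularCutoff u a n) :=
  hasCoarea_of_gradPair_self_ne_zero hu hub hinf (contMDiff_regularCutoff hu.1).continuous
    (hasCompactSupport_regularCutoff ha hu.1 hinf) fun _ hx ↦
      gradPair_self_ne_zero_of_mem_tsupport_regularCutoff ha hu.1 hx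

theorem tendsto_integral_abs_gradPair_regularCutoff (hu : ContMDiff (𝓡∂ 3) 𝓘(ℝ, ℝ) 2 u)
    (hinf : Tendsto u (cocompact M) (𝓝 0)) (ha : 0 < a) :
    Tendsto (fun n ↦ ∫ x in {x | a ≤ u x}, |gradPair (regularCutoff u a n) u x| ∂μHE[3]) atTop
      (𝓝 0) := by
  have hN : MDifferentiable (𝓡∂ 3) 𝓘(ℝ, ℝ) (gradPair u u) :=
    (contMDiff_gradPair (m := 1) hu hu).mdifferentiable one_ne_zero
  have hK : IsCompact {x | a ≤ u x} :=
    isCompact_preimage_of_tendsto_cocompact hu.continuous hinf isClosed_Ici (notMem_Ici.2 ha)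
  obtain ⟨C, hC₀, hC⟩ := exists_abs_gradPair_gradPair_le hu hK
  obtain ⟨D, hD⟩ := exists_abs_deriv_smoothStep_mul_le
  have hmeas : MeasurableSet {x | a ≤ u x} :=
    (isClosed_le continuous_const hu.continuous).measurableSet
  have hlim := tendsto_integral_of_dominated_convergence
    (μ := (μHE[3] : Measure M).restrict {x | a ≤ u x})
    (F := fun n x ↦ |gradPair (regularCutoff u a n) u x|) (f := fun _ ↦ 0) (fun _ ↦ D * C)
    (fun n ↦ (continuous_gradPair (contMDiff_regularCutoff hu)
      (hu.of_le one_le_two)).abs.aestronglyMeasurable)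
    (integrableOn_const hK.measure_ne_top)
    (fun n ↦ (ae_restrict_mem hmeas).mono fun x hx ↦ by
      rw [Real.norm_eq_abs, abs_abs]
      exact abs_gradPair_regularCutoff_le ha hu.continuous.continuousAt (hN x) hx (hC x hx) hC₀ hD)
    ((ae_restrict_mem hmeas).mono fun x hx ↦ by
      simpa only [abs_zero] using (tendsto_gradPair_regularCutoff ha hu.continuous.continuousAt
        (hN x) hx (hC x hx)).abs)
  simpa only [integral_zero] using hlim

theorem tendsto_integral_mul_levelFlux_regularCutoff (hu : IsHarmonic u)
    (hub : ∀ x ∈ (𝓡∂ 3).boundary M, u x = 1) (hinf : Tendsto u (cocompact M) (𝓝 0)) (ha : 0 < a)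
    {b : ℝ} {φ : ℝ → ℝ} (hφ : IsBumpProfile a b φ) :
    Tendsto (fun n ↦ ∫ s, φ s * levelFlux u (regularCutoff u a n) s) atTop
      (𝓝 (∫ x, φ (u x) * gradPair u u x ∂μHE[3])) := by
  have hN : Continuous (gradPair u u) := (contMDiff_gradPair (m := 1) hu.1 hu.1).continuous
  have hco n : HasCoarea u (regularCutoff u a n) := hasCoarea_regularCutoff hu hub hinf ha
  have hint : Integrable (fun x ↦ φ (u x) * gradPair u u x) μHE[3] :=
    ((hφ.continuous.comp hu.1.continuous).mul hN).integrable_of_hasCompactSupport <|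
      .intro (isCompact_preimage_of_tendsto_cocompact hu.1.continuous hinf isClosed_Ici
        (notMem_Ici.2 ha)) fun x hx ↦ by
          rw [Pi.mul_apply, Function.comp_apply, hφ.eq_zero_of_le (not_le.1 hx).le, zero_mul]
  refine .congr (fun n ↦ (hco n).coarea φ hφ.continuous) ?_
  refine tendsto_integral_of_dominated_convergence (fun x ↦ φ (u x) * gradPair u u x)
    (fun n ↦ ((hco n).integrable φ hφ.continuous).1) hint
    (fun n ↦ .of_forall fun x ↦ ?_) (.of_forall fun x ↦ ?_)
  · have hN₀ := gradPair_self_nonneg u x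
    rw [Real.norm_of_nonneg
      (mul_nonneg (hφ.nonneg _) (mul_nonneg regularCutoff_nonneg hN₀))]
    exact mul_le_mul_of_nonneg_left (mul_le_of_le_one_left hN₀ regularCutoff_le_one) (hφ.nonneg _)
  · refine tendsto_const_nhds.congr' ?_
    rcases le_total (u x) a with hux | hux
    · exact .of_forall fun n ↦ by simp only [hφ.eq_zero_of_le hux, zero_mul]
    by_cases hx : gradPair u u x = 0
    · exact .of_forall fun n ↦ by simp only [hx, mul_zero]
    · filter_upwards [eventually_regularCutoff_eq_one ha hux hx] with n hn
      rw [hn, one_mul]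

theorem tendsto_levelFlux_regularCutoff (hu : IsHarmonic u)
    (hub : ∀ x ∈ (𝓡∂ 3).boundary M, u x = 1) (hinf : Tendsto u (cocompact M) (𝓝 0)) (ha : 0 < a)
    {b c : ℝ} {φ : ℝ → ℝ} (hb : b < 1) (hφ : IsBumpProfile a b φ) (hc : c ∈ Ioc a 1) :
    Tendsto (fun n ↦ levelFlux u (regularCutoff u a n) c) atTop
      (𝓝 (∫ x, φ (u x) * gradPair u u x ∂μHE[3])) := by
  have hdiff : Tendsto (fun n ↦ levelFlux u (regularCutoff u a n) c -
      ∫ s, φ s * levelFlux u (regularCutoff u a n) s) atTop (𝓝 0) :=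
    squeeze_zero_norm (fun n ↦ abs_levelFlux_sub_le hu hub (contMDiff_regularCutoff hu.1)
      (hasCompactSupport_regularCutoff ha hu.1 hinf) (hasCoarea_regularCutoff hu hub hinf ha)
      hb hφ hc) (tendsto_integral_abs_gradPair_regularCutoff hu.1 hinf ha)
  simpa only [sub_add_cancel, zero_add] using
    hdiff.add (tendsto_integral_mul_levelFlux_regularCutoff hu hub hinf ha hφ)

theorem exists_flux_eq (hu : IsHarmonic u) (hub : ∀ x ∈ (𝓡∂ 3).boundary M, u x = 1)
    (hinf : Tendsto u (cocompact M) (𝓝 0)) (ha : 0 < a) (ha₁ : a < 1) :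
    ∃ L : ℝ, ∀ c ∈ Ioc a 1, IntegrableOn (fun x ↦ ‖riemGradient u x‖) {x | u x = c} μHE[2] ∧
      ∫ x in {x | u x = c}, ‖riemGradient u x‖ ∂μHE[2] = L := by
  obtain ⟨b, hab, hb⟩ := exists_between ha₁
  obtain ⟨φ, hφ⟩ := exists_isBumpProfile hab
  refine ⟨∫ x, φ (u x) * gradPair u u x ∂μHE[3], fun c hc ↦ ?_⟩
  have hS : MeasurableSet {x | u x = c} :=
    (isClosed_eq hu.1.continuous continuous_const).measurableSet
  rw [← integrable_indicator_iff hS, ← integral_indicator hS]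
  refine integrable_and_integral_eq_of_monotone
    (f := fun n ↦ {x | u x = c}.indicator fun x ↦ regularCutoff u a n x * ‖riemGradient u x‖)
    (fun n ↦ ((hasCoarea_regularCutoff hu hub hinf ha).integrableOn c).integrable_indicator hS)
    (fun n ↦ indicator_nonneg fun x _ ↦ mul_nonneg regularCutoff_nonneg (norm_nonneg _))
    (fun x _ _ hmn ↦ indicator_le_indicator
      (mul_le_mul_of_nonneg_right (monotone_regularCutoff hmn) (norm_nonneg _)))
    (tendsto_indicator_regularCutoff_mul_norm_riemGradient ha hc.1.le) ?_
  exact (tendsto_levelFlux_regularCutoff hu hub hinf ha hb hφ hc).congr fun n ↦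
    (integral_indicator hS).symm

theorem integral_norm_riemGradient_level_eq (hu : IsHarmonic u)
    (hub : ∀ x ∈ (𝓡∂ 3).boundary M, u x = 1) (hinf : Tendsto u (cocompact M) (𝓝 0)) {c : ℝ}
    (hc : c ∈ Ioc 0 1) :
    IntegrableOn (fun x ↦ ‖riemGradient u x‖) {x | u x = c} μHE[2] ∧
      ∫ x in {x | u x = c}, ‖riemGradient u x‖ ∂μHE[2] =
        ∫ x in {x | u x = 1}, ‖riemGradient u x‖ ∂μHE[2] := by
  obtain ⟨a, ha, hac⟩ := exists_between hc.1
  obtain ⟨L, hL⟩ := exists_flux_eq hu hub hinf ha (hac.trans_le hc.2)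
  have hc_flux := hL c ⟨hac, hc.2⟩
  have hone_flux := hL 1 ⟨hac.trans_le hc.2, le_rfl⟩
  exact ⟨hc_flux.1, hc_flux.2.trans hone_flux.2.symm⟩

end RegularCutoff

theorem eventually_eq_zero_of_continuousAt_neg_log {X : Type*} [TopologicalSpace X]
    {u : X → ℝ} {x : X} (hu : ContinuousAt u x) (hx : u x = 0)
    (hlog : ContinuousAt (fun x ↦ -Real.log (u x)) x) : ∀ᶠ z in 𝓝 x, u z = 0 := by
  have hlog_lt : ∀ᶠ z in 𝓝 x, -Real.log (u z) < 1 :=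
    hlog.eventually (gt_mem_nhds (by simp [hx]))
  have hu_lt : ∀ᶠ z in 𝓝 x, |u z| < Real.exp (-1) :=
    hu.abs.eventually (gt_mem_nhds (by simp [hx, Real.exp_pos]))
  filter_upwards [hlog_lt, hu_lt] with z hz_log hz_lt
  by_contra hne
  have hlt := Real.log_lt_log (abs_pos.2 hne) hz_lt
  rw [Real.log_abs, Real.log_exp] at hlt
  linarith

section NegLog

variable {M : Type*} [MetricSpace M] [ChartedSpace (EuclideanHalfSpace 3) M]
  [RiemannianBundle (fun x : M ↦ TangentSpace (𝓡∂ 3) x)] {u : M → ℝ} {x : M}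

theorem norm_riemGradient_eq_zero (hx : gradPair u u x = 0) : ‖riemGradient u x‖ = 0 := by
  rw [norm_riemGradient, hx, Real.sqrt_zero]

variable [IsManifold (𝓡∂ 3) ∞ M]

theorem norm_riemGradient_neg_log (hu : MDifferentiableAt (𝓡∂ 3) 𝓘(ℝ, ℝ) u x) (hx : u x ≠ 0) :
    ‖riemGradient (fun x ↦ -Real.log (u x)) x‖ = |u x|⁻¹ * ‖riemGradient u x‖ := by
  have hlog : HasDerivAt (fun r ↦ -Real.log r) (-(u x)⁻¹) (u x) := (Real.hasDerivAt_log hx).neg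
  have hleft (g : M → ℝ) : gradPair (fun x ↦ -Real.log (u x)) g x = -(u x)⁻¹ * gradPair u g x :=
    gradPair_comp (g := g) hlog hu
  have hcomm (f g : M → ℝ) : gradPair f g x = gradPair g f x := real_inner_comm _ _
  rw [norm_riemGradient, norm_riemGradient, hleft, hcomm, hleft, ← mul_assoc,
    Real.sqrt_mul (mul_self_nonneg _), Real.sqrt_mul_self_eq_abs, abs_neg, abs_inv]

-- `Real.log 0 = 0`, so `-log u` takes finite values on `{u = 0}`.
theorem norm_riemGradient_neg_log_of_eq_zero (hu : ContinuousAt u x) (hx : u x = 0) :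
    ‖riemGradient (fun x ↦ -Real.log (u x)) x‖ = 0 := by
  have hmfderiv : mfderiv (𝓡∂ 3) 𝓘(ℝ, ℝ) (fun x ↦ -Real.log (u x)) x = 0 := by
    by_cases hd : MDifferentiableAt (𝓡∂ 3) 𝓘(ℝ, ℝ) (fun x ↦ -Real.log (u x)) x
    · have hconst : (fun x ↦ -Real.log (u x)) =ᶠ[𝓝 x] fun _ ↦ 0 :=
        (eventually_eq_zero_of_continuousAt_neg_log hu hx hd.continuousAt).mono fun z hz ↦ by
          simp only [hz, Real.log_zero, neg_zero]
      rw [hconst.mfderiv_eq]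
      exact mfderiv_const
    · exact mfderiv_zero_of_not_mdifferentiableAt hd
  apply norm_riemGradient_eq_zero
  rw [gradPair_eq_mfderiv, hmfderiv]
  rfl

end NegLog

section LevelSets

variable {M : Type*} [MetricSpace M] [ChartedSpace (EuclideanHalfSpace 3) M]
  [IsManifold (𝓡∂ 3) ∞ M] [RiemannianBundle (fun x : M ↦ TangentSpace (𝓡∂ 3) x)]
  [IsContMDiffRiemannianBundle (𝓡∂ 3) ∞ E3 (fun x : M ↦ TangentSpace (𝓡∂ 3) x)]
  [IsRiemannianManifold (𝓡∂ 3) M] [MeasurableSpace M] [BorelSpace M] {u : M → ℝ}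

theorem integral_norm_riemGradient_neg_log_level_eq (hu : IsHarmonic u)
    (hub : ∀ x ∈ (𝓡∂ 3).boundary M, u x = 1) (hinf : Tendsto u (cocompact M) (𝓝 0)) {c : ℝ}
    (hc : c ∈ Ioc 0 1) :
    IntegrableOn (fun x ↦ ‖riemGradient (fun x ↦ -Real.log (u x)) x‖) {x | u x = c} μHE[2] ∧
      ∫ x in {x | u x = c}, ‖riemGradient (fun x ↦ -Real.log (u x)) x‖ ∂μHE[2] =
        c⁻¹ * ∫ x in {x | u x = 1}, ‖riemGradient u x‖ ∂μHE[2] := by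
  obtain ⟨hint, hflux⟩ := integral_norm_riemGradient_level_eq hu hub hinf hc
  have hmeas : MeasurableSet {x | u x = c} :=
    (isClosed_eq hu.1.continuous continuous_const).measurableSet
  have hnorm : EqOn (fun x ↦ ‖riemGradient (fun x ↦ -Real.log (u x)) x‖)
      (fun x ↦ c⁻¹ * ‖riemGradient u x‖) {x | u x = c} := fun x (hx : u x = c) ↦ by
    have hux : u x ≠ 0 := hx ▸ hc.1.ne'
    simp only [norm_riemGradient_neg_log (hu.1.mdifferentiable two_ne_zero x) hux, hx,
      abs_of_pos hc.1]
  refine ⟨(IntegrableOn.congr_fun (hint.const_mul c⁻¹) hnorm.symm hmeas), ?_⟩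
  rw [setIntegral_congr_fun hmeas hnorm, integral_const_mul, hflux]

theorem norm_riemGradient_neg_log_eq_zero_of_ne_exp (hu : IsHarmonic u)
    (hub : ∀ x ∈ (𝓡∂ 3).boundary M, u x = 1) (hinf : Tendsto u (cocompact M) (𝓝 0)) {t : ℝ} {x : M}
    (ht : -Real.log (u x) = t) (hx : u x ≠ Real.exp (-t)) :
    ‖riemGradient (fun x ↦ -Real.log (u x)) x‖ = 0 := by
  rcases lt_trichotomy (u x) 0 with hneg | hzero | hpos
  · rw [norm_riemGradient_neg_log (hu.1.mdifferentiable two_ne_zero x) hneg.ne,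
      norm_riemGradient_eq_zero, mul_zero]
    exact by_contra fun hN ↦
      hneg.not_ge (mem_Icc_of_gradPair_self_ne_zero hu hub hinf hN).1
  · exact norm_riemGradient_neg_log_of_eq_zero hu.1.continuous.continuousAt hzero
  · exact absurd (by rw [← ht, neg_neg, Real.exp_log hpos]) hx

theorem norm_riemGradient_neg_log_eq_zero_of_eq_one (hu : IsHarmonic u)
    (hub : ∀ x ∈ (𝓡∂ 3).boundary M, u x = 1) (hinf : Tendsto u (cocompact M) (𝓝 0)) {x : M}
    (hx : u x = 1) (hxb : x ∉ (𝓡∂ 3).boundary M) :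
    ‖riemGradient (fun x ↦ -Real.log (u x)) x‖ = 0 := by
  rw [norm_riemGradient_neg_log (hu.1.mdifferentiable two_ne_zero x) (hx ▸ one_ne_zero),
    norm_riemGradient_eq_zero, mul_zero]
  exact by_contra fun hN ↦ (lt_one_of_gradPair_self_ne_zero hu hub hinf hN hxb).ne hx

end LevelSets

theorem proposition2p1_general {M : Type*} [MetricSpace M]
    [ChartedSpace (EuclideanHalfSpace 3) M] [IsManifold (𝓡∂ 3) ∞ M]
    [RiemannianBundle (fun x : M ↦ TangentSpace (𝓡∂ 3) x)]
    [IsContMDiffRiemannianBundle (𝓡∂ 3) ∞ E3 (fun x : M ↦ TangentSpace (𝓡∂ 3) x)]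
    [IsRiemannianManifold (𝓡∂ 3) M] [MeasurableSpace M] [BorelSpace M]
    (u : M → ℝ) (hu : IsHarmonic u)
    (hu_boundary : ∀ x ∈ (𝓡∂ 3).boundary M, u x = 1)
    (hu_infinity : Tendsto u (cocompact M) (𝓝 0))
    (w : M → ℝ) (hw : w = fun x ↦ -Real.log (u x))
    (t : ℝ) (ht : 0 ≤ t) :
    IntegrableOn (fun x ↦ ‖riemGradient w x‖) {x | w x = t} μHE[2] ∧
      IntegrableOn (fun x ↦ ‖riemGradient w x‖) ((𝓡∂ 3).boundary M) μHE[2] ∧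
      ∫ x in {x | w x = t}, ‖riemGradient w x‖ ∂μHE[2] =
        (∫ x in (𝓡∂ 3).boundary M, ‖riemGradient w x‖ ∂μHE[2]) * Real.exp t := by
  subst hw
  obtain ⟨hint_t, hflux_t⟩ := integral_norm_riemGradient_neg_log_level_eq hu hu_boundary
    hu_infinity ⟨Real.exp_pos (-t), Real.exp_le_one_iff.2 (neg_nonpos.2 ht)⟩
  obtain ⟨hint_one, hflux_one⟩ := integral_norm_riemGradient_neg_log_level_eq hu hu_boundary
    hu_infinity (right_mem_Ioc.2 one_pos)
  have hmeas_t : MeasurableSet {x | -Real.log (u x) = t} := measurableSet_eq_fun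
    (Real.measurable_log.comp hu.1.continuous.measurable).neg measurable_const
  have hmeas_one : MeasurableSet {x | u x = 1} :=
    (isClosed_eq hu.1.continuous continuous_const).measurableSet
  have hsub : {x | u x = Real.exp (-t)} ⊆ {x | -Real.log (u x) = t} :=
    fun x (hx : u x = Real.exp (-t)) ↦ by simp only [mem_ofPred_eq, hx, Real.log_exp, neg_neg]
  have hzero_t := fun x (hx : x ∈ {x | -Real.log (u x) = t} \ {x | u x = Real.exp (-t)}) ↦
    norm_riemGradient_neg_log_eq_zero_of_ne_exp hu hu_boundary hu_infinity hx.1 hx.2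
  have hzero_one := fun x (hx : x ∈ {x | u x = 1} \ (𝓡∂ 3).boundary M) ↦
    norm_riemGradient_neg_log_eq_zero_of_eq_one hu hu_boundary hu_infinity hx.1 hx.2
  refine ⟨hint_t.of_forall_sdiff_eq_zero hmeas_t hzero_t, hint_one.mono_set hu_boundary, ?_⟩
  rw [setIntegral_eq_of_subset_of_forall_sdiff_eq_zero hmeas_t hsub hzero_t, hflux_t,
    ← setIntegral_eq_of_subset_of_forall_sdiff_eq_zero hmeas_one hu_boundary hzero_one, hflux_one,
    Real.exp_neg, inv_inv, inv_one, one_mul, mul_comm]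

theorem proposition2p1 {M : Type*} [MetricSpace M] [ChartedSpace (EuclideanHalfSpace 3) M]
    [IsManifold (𝓡∂ 3) ∞ M] [RiemannianBundle (fun x : M ↦ TangentSpace (𝓡∂ 3) x)]
    [IsContMDiffRiemannianBundle (𝓡∂ 3) ∞ E3 (fun x : M ↦ TangentSpace (𝓡∂ 3) x)]
    [IsRiemannianManifold (𝓡∂ 3) M] [ConnectedSpace M] [MeasurableSpace M] [BorelSpace M]
    (hAF : IsAsymptoticallyFlat M)
    (hboundary : IsConnected ((𝓡∂ 3).boundary M))
    (u : M → ℝ) (hu : IsHarmonic u)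
    (hu_boundary : ∀ x ∈ (𝓡∂ 3).boundary M, u x = 1)
    (hu_infinity : Tendsto u (cocompact M) (𝓝 0))
    (w : M → ℝ) (hw : w = fun x ↦ -Real.log (u x))
    (t : ℝ) (ht : 0 ≤ t) :
    IntegrableOn (fun x ↦ ‖riemGradient w x‖) {x | w x = t} μHE[2] ∧
      IntegrableOn (fun x ↦ ‖riemGradient w x‖) ((𝓡∂ 3).boundary M) μHE[2] ∧
      ∫ x in {x | w x = t}, ‖riemGradient w x‖ ∂μHE[2] =
        (∫ x in (𝓡∂ 3).boundary M, ‖riemGradient w x‖ ∂μHE[2]) * Real.exp t :=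
  proposition2p1_general u hu hu_boundary hu_infinity w hw t ht
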